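/- Let $n\ge 1$, $d\ge 0$, $L,\tau,\epsilon>0$. Let $f=\frac1n\sum_{i=1}^n f_i$ with every $f_i:\mathbb R^d\to\mathbb R$ convex and $L$-smooth and $f$ $\tau$-strongly convex; let $\mathcal C\subset\mathbb R^d$ be convex with $\|x-y\|\le D$ on $\mathcal C$, possess a linear oracle ($u\mapsto$ a maximizer of $\langle u,v\rangle$ over $v\in\mathcal C$), let $x^*\in\mathcal C$ minimize $f$ on $\mathcal C$ and let $x^0\in\mathcal C$. *Algorithm.* $\mathrm{CondG}(g,u,y,\gamma,\tau,\eta)$: with $h(x)=\gamma[\langle g,x\rangle+\frac\tau2\|x-y\|^2]+\frac12\|x-u\|^2$ and $u_1=u$, for $t=1,2,\dots$ call the linear oracle to get $v_t$ maximizing $\langle\nabla h(u_t),u_t-v\rangle$ over $\mathcal C$; if $\langle\nabla h(u_t),u_t-v_t\rangle\le\eta$ output $u_t$, else $u_{t+1}=(1-\beta_t)u_t+\beta_tv_t$, $\beta_t=\max\{0,\min\{1,\frac{\langle\nabla h(u_t),u_t-v_t\rangle}{(\gamma\tau+1)\|u_t-v_t\|^2}\}\}$. In the first-order case let $\hat\nabla=\nabla$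 (one gradient query for each component); in the zeroth-order case let $\hat\nabla f_i(x)=\sum_{j=1}^d\frac{f_i(x+\mu e_j)-f_i(x-\mu e_j)}{2\mu}e_j$ ($2d$ function queries), $\mu>0$. ARCS: $\tilde x^0=x^0$; in epoch $s=1,2,\dots$ put $\tilde x=\tilde x^{s-1}$, $\tilde g=\frac1n\sum_i\hat\nabla f_i(\tilde x)$, $x_0=x^{s-1}$, $\bar x_0=\tilde x$; for $t=1,\dots,T_s$ pick $i_t\in\{1,\dots,n\}$ uniformly and independently, and set $$\underline x_t=\frac{(1+\tau\gamma_s)(1-\alpha_s-p_s)\bar x_{t-1}+\alpha_sx_{t-1}+(1+\tau\gamma_s)p_s\tilde x}{1+\tau\gamma_s(1-\alpha_s)},\quad G_t=\hat\nabla f_{i_t}(\underline x_t)-\hat\nabla f_{i_t}(\tilde x)+\tilde g,$$ $$x_t=\mathrm{CondG}(G_t,x_{t-1},\underline x_t,\gamma_s,\tau,\eta_{s,t}),\quad \bar x_t=(1-\alpha_s-p_s)\bar x_{t-1}+\alpha_sx_t+p_s\tilde x;$$ finally $x^s=x_{T_s}$ and $\tilde x^s=\sum_t\theta_t\bar x_t/\sum_t\theta_t$.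 *Parameters.* Let $c=3$ in the first-order and $c=5$ in the zeroth-order case; $s_0=\lfloor\log_2n\rfloor+1$, $\varsigma=\frac{cL}{4\tau}$, $D_0=4(f(x^0)-f(x^*))+cL\|x^0-x^*\|^2$; $T_s=2^{\min(s,s_0)-1}$, $p_s=\frac12$, $\alpha_s=\frac12$ for $s\le s_0$ and $\alpha_s=\min\{\sqrt{n/(4\varsigma)},\frac12\}$ for $s>s_0$, $\gamma_s=\frac1{cL\alpha_s}$; $\Gamma_t=(1+\tau\gamma_s)^t$ (first-order) or $(1+\tau\gamma_s/2)^t$ (zeroth-order); $\theta_t=\Gamma_{t-1}-(1-\alpha_s-p_s)\Gamma_t$ for $t\le T_s-1$, $\theta_{T_s}=\Gamma_{T_s-1}$; $\eta_{s,t}=\frac{D_0}{sT_sL}$ for $s\le s_0$, and for $s>s_0$, $\eta_{s,t}=\frac{(4/5)^{s-s_0-1}D_0}{snL}$ if $n\ge\varsigma$ and $\eta_{s,t}=\frac{(1/\Gamma_{T_{s_0}})^{s-s_0-1}D_0}{snL}$ if $n<\varsigma$. *Claim.* Let $S$ be the first epoch number ($S\ge0$) with $\mathbb E[f(\tilde x^S)-f(x^*)]\le\epsilon$,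 let $N_{GQO}$, $N_{FQO}$, $N_{LO}$ be the numbers of gradient queries (first-order case), function queries (zeroth-order case) and linear oracle calls in epochs $1,\dots,S$, and put $\Lambda=c'(2+\log s_0)\frac{D_0}{n}=\tilde{\mathcal O}(D_0/n)$ with $c'=5$ (first-order) or $c'=8$ (zeroth-order). In the zeroth-order case assume that $0<\mu\le\mu_0$, where $\mu_0>0$ depends only on $L,\tau,d,n,\epsilon$. Then $S$ exists, $\tilde x^S\in\mathcal C$, and on every sample path $$N_{GQO}=\begin{cases}\tilde{\mathcal O}\left(n\log\frac{D_0}\epsilon\right),&\epsilon\ge\Lambda\text{ or }n\ge\varsigma,\\ \tilde{\mathcal O}\left(n\log n+\sqrt{\frac{nL}\tau}\log\frac{D_0}{n\epsilon}\right),&\epsilon<\Lambda\text{ and }n<\varsigma,\end{cases}$$ $$N_{FQO}=\begin{cases}\tilde{\mathcal O}\left(nd\log\frac{D_0}\epsilon\right),&\epsilon\ge\Lambda\text{ or }n\ge\varsigma,\\ \tilde{\mathcal O}\left(nd\log n+d\sqrt{\frac{nL}\tau}\log\frac{D_0}{n\epsilon}\right),&\epsilon<\Lambda\text{ and }n<\varsigma,\end{cases}$$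 and in both cases $$N_{LO}=\begin{cases}\tilde{\mathcal O}\left(\frac1{\epsilon^2}\right),&\epsilon\ge\Lambda\text{ or }n\ge\varsigma,\\ \tilde{\mathcal O}\left(n^2+\frac n\epsilon\right),&\epsilon<\Lambda\text{ and }n<\varsigma.\end{cases}$$ Here every logarithm in the bounds is read as $\max\{1,\log(\cdot)\}$, and $\tilde{\mathcal O}$ hides a constant and a fixed power of a logarithm: of $D_0/\epsilon$ in the first lines, of $n+L/\tau+D_0/\epsilon$ in the second lines for $N_{GQO}$ and $N_{FQO}$, and of $n+D_0/\epsilon$ in the second line for $N_{LO}$. The power is absolute; the constant is absolute for $N_{GQO}$ and $N_{FQO}$, and depends only on $L,\tau,D,D_0$ for $N_{LO}$. -/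

import Mathlib

open scoped BigOperators

noncomputable section

namespace ARCS

/-! ### The finite-sum problem -/

/-- The ambient space `ℝ^d` with its Euclidean norm. -/
abbrev Vec (d : ℕ) := EuclideanSpace ℝ (Fin d)

/-- `f` is `L`-smooth. -/
def LSmooth {d : ℕ} (L : ℝ) (f : Vec d → ℝ) : Prop :=
  ContDiff ℝ 1 f ∧
    ∀ x y, |f y - f x - inner ℝ (gradient f x) (y - x)| ≤ L / 2 * ‖y - x‖ ^ 2

/-- `f` (differentiable) is `τ`-strongly convex; `τ = 0` is convexity. -/
def StronglyConvex {d : ℕ} (τ : ℝ) (f : Vec d → ℝ) : Prop :=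
  ∀ x y, f x + inner ℝ (gradient f x) (y - x) + τ / 2 * ‖y - x‖ ^ 2 ≤ f y

/-- The objective `(1/n) ∑ i, f i`. -/
def objective {d n : ℕ} (f : Fin n → Vec d → ℝ) (x : Vec d) : ℝ :=
  (1 / (n : ℝ)) * ∑ i, f i x

/-- `lo` is a linear oracle for `K`: `lo u` is a maximizer of `⟨u, v⟩` over `v ∈ K`. -/
def IsLinearOracle {d : ℕ} (K : Set (Vec d)) (lo : Vec d → Vec d) : Prop :=
  ∀ u, lo u ∈ K ∧ ∀ v ∈ K, inner ℝ u v ≤ inner ℝ u (lo u)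

/-! ### Gradient information and its cost -/

/-- The two cases: access to component gradients, or only to component values (with smoothing
parameter `μ`). -/
inductive Access where
  | first : Access
  | zeroth (μ : ℝ) : Access

/-- The coordinate-wise gradient estimator. -/
def coordGrad {d : ℕ} (μ : ℝ) (f : Vec d → ℝ) (x : Vec d) : Vec d :=
  ∑ j : Fin d,
    ((f (x + μ • EuclideanSpace.single j (1 : ℝ)) - f (x - μ • EuclideanSpace.single j (1 : ℝ)))
      / (2 * μ)) • EuclideanSpace.single j (1 : ℝ)

/-- The gradient, or its estimator, that the algorithm uses for one component function. -/
def est {d : ℕ} : Access → (Vec d → ℝ) → Vec d → Vec d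
  | .first, f, x => gradient f x
  | .zeroth μ, f, x => coordGrad μ f x

/-- Oracle calls for one evaluation of `est` on one component function: one gradient query in the
first-order case, two function queries per coordinate in the zeroth-order case. -/
def estCost (d : ℕ) : Access → ℕ
  | .first => 1
  | .zeroth _ => 2 * d

/-! ### The conditional gradient subroutine -/

/-- The gradient at `x` of `h(x) = γ (⟨g, x⟩ + τ/2 ‖x - y‖²) + 1/2 ‖x - u‖²`. -/
def hGrad {d : ℕ} (g u y : Vec d) (γ τ : ℝ) (x : Vec d) : Vec d :=
  γ • (g + τ • (x - y)) + (x - u)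

/-- The answer `v` of the linear oracle at `x`: it maximizes `⟨∇h(x), x - v⟩`. -/
def hVertex {d : ℕ} (lo : Vec d → Vec d) (g u y : Vec d) (γ τ : ℝ) (x : Vec d) : Vec d :=
  lo (-hGrad g u y γ τ x)

/-- The value `max_v ⟨∇h(x), x - v⟩`. -/
def hGap {d : ℕ} (lo : Vec d → Vec d) (g u y : Vec d) (γ τ : ℝ) (x : Vec d) : ℝ :=
  inner ℝ (hGrad g u y γ τ x) (x - hVertex lo g u y γ τ x)

/-- The iterates of CondG, started at `u` (index `0` is the first iterate) and continued without
the stopping test. -/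
def condGIter {d : ℕ} (lo : Vec d → Vec d) (g u y : Vec d) (γ τ : ℝ) : ℕ → Vec d
  | 0 => u
  | t + 1 =>
    let w := condGIter lo g u y γ τ t
    let v := hVertex lo g u y γ τ w
    let β := max 0 (min 1 (hGap lo g u y γ τ w / ((γ * τ + 1) * ‖w - v‖ ^ 2)))
    (1 - β) • w + β • v

/-- The stopping test of CondG at its iterate number `t`. -/
def CondGStops {d : ℕ} (lo : Vec d → Vec d) (g u y : Vec d) (γ τ η : ℝ) (t : ℕ) : Prop :=
  hGap lo g u y γ τ (condGIter lo g u y γ τ t) ≤ η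

open Classical in
/-- The output of CondG: the first iterate that passes the stopping test. (If there is none, the
value is irrelevant, since then the number of oracle calls is infinite.) -/
def condG {d : ℕ} (lo : Vec d → Vec d) (g u y : Vec d) (γ τ η : ℝ) : Vec d :=
  if h : ∃ t, CondGStops lo g u y γ τ η t then condGIter lo g u y γ τ (Nat.find h) else u

open Classical in
/-- The number of linear oracle calls of CondG: one per iterate that is tested, `⊤` if CondG
never stops. -/
def condGCalls {d : ℕ} (lo : Vec d → Vec d) (g u y : Vec d) (γ τ η : ℝ) : ℕ∞ :=
  if h : ∃ t, CondGStops lo g u y γ τ η t then ((Nat.find h + 1 : ℕ) : ℕ∞) else ⊤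

/-! ### The ARCS algorithm -/

/-- The parameters of ARCS; epochs `s` and inner iterations `t` are numbered from `1`. -/
structure Params where
  T : ℕ → ℕ
  γ : ℕ → ℝ
  α : ℕ → ℝ
  p : ℕ → ℝ
  θ : ℕ → ℕ → ℝ
  η : ℕ → ℕ → ℝ

/-- State between epochs: the points `x^s` and `x̃^s`, the number of gradient queries (first-order
case) or function queries (zeroth-order case) so far, the number of linear oracle calls so far. -/
structure State (d : ℕ) where
  x : Vec d
  xt : Vec d
  queries : ℕ
  loCalls : ℕ∞

/-- State of the inner loop: `x_t`, `x̄_t`, the running sum `∑ θ_t x̄_t`, and the counters. -/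
structure Inner (d : ℕ) where
  x : Vec d
  xbar : Vec d
  acc : Vec d
  queries : ℕ
  loCalls : ℕ∞

/-- Inner iteration `t` of epoch `s` with sampled index `i`; `xt` is `x̃`, `gt` is `g̃`. -/
def innerStep {d n : ℕ} (a : Access) (P : Params) (τ : ℝ) (f : Fin n → Vec d → ℝ)
    (lo : Vec d → Vec d) (s t : ℕ) (xt gt : Vec d) (z : Inner d) (i : Fin n) : Inner d :=
  let γ := P.γ s
  let α := P.α s
  let p := P.p s
  let xu : Vec d := (1 / (1 + τ * γ * (1 - α))) •
    (((1 + τ * γ) * (1 - α - p)) • z.xbar + α • z.x + ((1 + τ * γ) * p) • xt)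
  let G : Vec d := est a (f i) xu - est a (f i) xt + gt
  let x' : Vec d := condG lo G z.x xu γ τ (P.η s t)
  let xbar' : Vec d := (1 - α - p) • z.xbar + α • x' + p • xt
  { x := x'
    xbar := xbar'
    acc := z.acc + P.θ s t • xbar'
    queries := z.queries + 2 * estCost d a
    loCalls := z.loCalls + condGCalls lo G z.x xu γ τ (P.η s t) }

/-- The law of the inner state after `t` inner iterations with independent uniform indices. -/
def innerLoop {d n : ℕ} [NeZero n] (a : Access) (P : Params) (τ : ℝ) (f : Fin n → Vec d → ℝ)
    (lo : Vec d → Vec d) (s : ℕ) (xt gt : Vec d) (z₀ : Inner d) : ℕ → PMF (Inner d)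
  | 0 => PMF.pure z₀
  | t + 1 => (innerLoop a P τ f lo s xt gt z₀ t).bind fun z =>
      (PMF.uniformOfFintype (Fin n)).map fun i => innerStep a P τ f lo s (t + 1) xt gt z i

/-- Epoch `s`, as a random map on states. -/
def epoch {d n : ℕ} [NeZero n] (a : Access) (P : Params) (τ : ℝ) (f : Fin n → Vec d → ℝ)
    (lo : Vec d → Vec d) (s : ℕ) (st : State d) : PMF (State d) :=
  let gt : Vec d := (1 / (n : ℝ)) • ∑ i, est a (f i) st.xt
  (innerLoop a P τ f lo s st.xt gt
      { x := st.x
        xbar := st.xt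
        acc := 0
        queries := st.queries + n * estCost d a
        loCalls := st.loCalls } (P.T s)).map fun z =>
    { x := z.x
      xt := (1 / ∑ t ∈ Finset.Icc 1 (P.T s), P.θ s t) • z.acc
      queries := z.queries
      loCalls := z.loCalls }

/-- The law of the state of ARCS, started at `x₀`, after `S` epochs. -/
def run {d n : ℕ} [NeZero n] (a : Access) (P : Params) (τ : ℝ) (f : Fin n → Vec d → ℝ)
    (lo : Vec d → Vec d) (x₀ : Vec d) : ℕ → PMF (State d)
  | 0 => PMF.pure { x := x₀, xt := x₀, queries := 0, loCalls := 0 }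
  | S + 1 => (run a P τ f lo x₀ S).bind fun st => epoch a P τ f lo (S + 1) st

/-! ### The parameters for strongly convex problems -/

/-- The numerical constant in `γ_s`, `ς` and `D₀`. -/
def coef : Access → ℝ
  | .first => 3
  | .zeroth _ => 5

/-- `D₀ = 4 (f(x⁰) - f(x*)) + c L ‖x⁰ - x*‖²` with `c = 3` or `c = 5`. -/
def initGap {d : ℕ} (a : Access) (L : ℝ) (F : Vec d → ℝ) (x₀ xs : Vec d) : ℝ :=
  4 * (F x₀ - F xs) + coef a * L * ‖x₀ - xs‖ ^ 2

/-- `s₀ = ⌊log₂ n⌋ + 1`. -/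
def sZero (n : ℕ) : ℕ := Nat.log 2 n + 1

/-- `ς = 3L/(4τ)` or `5L/(4τ)`. -/
def sigma (a : Access) (L τ : ℝ) : ℝ := coef a * L / (4 * τ)

def scT (n s : ℕ) : ℕ := if s ≤ sZero n then 2 ^ (s - 1) else 2 ^ (sZero n - 1)

def scAlpha (a : Access) (n : ℕ) (L τ : ℝ) (s : ℕ) : ℝ :=
  if s ≤ sZero n then 1 / 2 else min (Real.sqrt ((n : ℝ) / (4 * sigma a L τ))) (1 / 2)

def scGamma (a : Access) (n : ℕ) (L τ : ℝ) (s : ℕ) : ℝ :=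
  1 / (coef a * L * scAlpha a n L τ s)

/-- `Γ_t` in epoch `s`: `(1 + τ γ_s)^t` or `(1 + τ γ_s / 2)^t`. -/
def scBigGamma (a : Access) (n : ℕ) (L τ : ℝ) (s t : ℕ) : ℝ :=
  match a with
  | .first => (1 + τ * scGamma a n L τ s) ^ t
  | .zeroth _ => (1 + τ * scGamma a n L τ s / 2) ^ t

def scTheta (a : Access) (n : ℕ) (L τ : ℝ) (s t : ℕ) : ℝ :=
  if t + 1 ≤ scT n s then
    scBigGamma a n L τ s (t - 1)
      - (1 - scAlpha a n L τ s - 1 / 2) * scBigGamma a n L τ s t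
  else scBigGamma a n L τ s (t - 1)

def scEta (a : Access) (n : ℕ) (L τ D₀ : ℝ) (s : ℕ) : ℝ :=
  if s ≤ sZero n then D₀ / (s * scT n s * L)
  else if sigma a L τ ≤ n then
    (4 / 5 : ℝ) ^ (s - sZero n - 1) * D₀ / (s * n * L)
  else
    (1 / scBigGamma a n L τ s (scT n (sZero n))) ^ (s - sZero n - 1) * D₀ / (s * n * L)

/-- The parameters of ARCS for strongly convex problems. -/
def scParams (a : Access) (n : ℕ) (L τ D₀ : ℝ) : Params where
  T := scT n
  γ := scGamma a n L τ
  α := scAlpha a n L τ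
  p := fun _ => 1 / 2
  θ := scTheta a n L τ
  η := fun s _ => scEta a n L τ D₀ s

/-- ARCS from `x₀` with the parameters for strongly convex problems. -/
def scRun {d n : ℕ} [NeZero n] (a : Access) (L τ D₀ : ℝ) (f : Fin n → Vec d → ℝ)
    (lo : Vec d → Vec d) (x₀ : Vec d) : ℕ → PMF (State d) :=
  run a (scParams a n L τ D₀) τ f lo x₀

/-! ### Oracle complexity -/

/-- Expectation of `φ` under `p` (the laws of the algorithm have finite support). -/
def expect {β : Type*} (p : PMF β) (φ : β → ℝ) : ℝ := ∑' b, (p b).toReal * φ b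

/-- The extended natural number `N` is finite and at most the real number `B`. -/
def AtMost (N : ℕ∞) (B : ℝ) : Prop := ∃ m : ℕ, N = (m : ℕ∞) ∧ (m : ℝ) ≤ B

/-- The method whose state after `S` epochs has law `r S` reaches expected accuracy `ε`, and up to
and including the first epoch `S` with `𝔼[F(x̃^S) - fmin] ≤ ε` it makes, on every sample path, at
most `Q` gradient (or function) queries and at most `B` linear oracle calls, the output being in
`K`. -/
def ReachesWithin {d : ℕ} (r : ℕ → PMF (State d)) (K : Set (Vec d)) (F : Vec d → ℝ)
    (fmin ε Q B : ℝ) : Prop :=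
  ∃ S, IsLeast {S | expect (r S) (fun st => F st.xt - fmin) ≤ ε} S ∧
    ∀ st ∈ (r S).support, st.xt ∈ K ∧ (st.queries : ℝ) ≤ Q ∧ AtMost st.loCalls B

/-- The logarithm as it is read inside order estimates: never less than `1`. -/
def lg (x : ℝ) : ℝ := max 1 (Real.log x)

/-- The accuracy threshold of order `D₀ / n` up to a logarithmic factor; `c = 5` in the first-order
case and `c = 8` in the zeroth-order case. -/
def threshold (a : Access) (n : ℕ) (D₀ : ℝ) : ℝ :=
  (match a with
    | .first => 5
    | .zeroth _ => 8) * (2 + Real.log (sZero n)) * D₀ / n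

end ARCS

end

/-!
The proof follows the expected optimality gap `A s = 𝔼[f(x̃^s) - f(x*)]` together with
`R s = 𝔼‖x^s - x*‖² / 2` through the epochs and then inverts the resulting rates.

*One inner iteration.* CondG returns an approximate minimizer `x` of a proximal model, in the sense
that `⟨∇h(x), x - v⟩ ≤ η` for all feasible `v`. The extrapolated point is chosen such that
`x̄_t - x̲_t = α (x_t - x⁺)`, where `x⁺` depends on the past only; so the linear error term of the
stochastic gradient averages out, and its variance is absorbed by the term `p f(x̃)`, thanks to the
co-coercivity of the component gradients (`step_average`). In the zeroth-order case the estimator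
has a bias `e`; half of the strong convexity pays for `⟨e, x* - x_t⟩` at the price of an additive
error of order `μ²`, which does not involve the diameter of the feasible set.

*One epoch.* With the weights `Γ_t` these inequalities telescope (`expect_epoch_le`), the
convexity of `f` turning the averaged gaps into the gap of the averaged point. The result is a
deterministic recursion for `A` and `R` (`EpochRecursion`).

*Rates.* In the first `s₀` epochs a combination of `A` and `R` is halved each time, so that
`A s ≲ (1 + log s) D₀ / 2 ^ s` (`EpochRecursion.gap_le_first`). Afterwards another combination is
divided in every epoch by `rate`, which is `9 / 8` if `ς ≤ n` and `Γ_T ≥ 1 + α / 4` otherwise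
(`EpochRecursion.gap_le_late`). In both regimes the tolerances `η_s` are such that the errors sum
to a harmonic series, hence the logarithms.

*Counting.* Exact line search makes CondG stop after `O((1 + γτ) D² / η)` steps
(`index_le_of_gap_gt`). As the accuracy is not yet reached in the epoch before the last one, the
rates bound the number of epochs as well as the powers of `2` and of `rate` that enter the number of
linear oracle calls. If `ς ≤ n`, the tolerances shrink by `4 / 5 ≥ (8 / 9) ^ 2` per epoch, at
most the square of the contraction of the gap; this gives the order `1 / ε²`.
-/

noncomputable section

namespace ARCS

/-! ### Expectations under laws of finite support -/

section Expectation

variable {α β : Type*}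

lemma expect_eq_sum (p : PMF α) (φ : α → ℝ) {s : Finset α} (hs : p.support ⊆ s) :
    expect p φ = ∑ b ∈ s, (p b).toReal * φ b := by
  unfold expect
  apply tsum_eq_sum
  intro b hb
  have : p b = 0 := by
    by_contra h
    exact hb (hs ((PMF.mem_support_iff p b).2 h))
  simp [this]

lemma expect_mono (p : PMF α) (hp : p.support.Finite) {φ ψ : α → ℝ}
    (h : ∀ b ∈ p.support, φ b ≤ ψ b) : expect p φ ≤ expect p ψ := by
  rw [expect_eq_sum p φ (s := hp.toFinset) (by simp),
    expect_eq_sum p ψ (s := hp.toFinset) (by simp)]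
  apply Finset.sum_le_sum
  intro b hb
  exact mul_le_mul_of_nonneg_left (h b (by simpa using hb)) ENNReal.toReal_nonneg

lemma expect_add (p : PMF α) (hp : p.support.Finite) (φ ψ : α → ℝ) :
    expect p (fun b => φ b + ψ b) = expect p φ + expect p ψ := by
  rw [expect_eq_sum p φ (s := hp.toFinset) (by simp),
    expect_eq_sum p ψ (s := hp.toFinset) (by simp),
    expect_eq_sum p _ (s := hp.toFinset) (by simp), ← Finset.sum_add_distrib]
  exact Finset.sum_congr rfl fun b _ => by ring

lemma expect_const_mul (p : PMF α) (c : ℝ) (φ : α → ℝ) :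
    expect p (fun b => c * φ b) = c * expect p φ := by
  unfold expect
  rw [← tsum_mul_left]
  exact tsum_congr fun b => by ring

lemma expect_const (p : PMF α) (c : ℝ) : expect p (fun _ => c) = c := by
  unfold expect
  rw [tsum_mul_right, ← ENNReal.tsum_toReal_eq (fun b => PMF.apply_ne_top p b), p.tsum_coe]
  simp

lemma expect_nonneg (p : PMF α) {φ : α → ℝ} (h : ∀ b ∈ p.support, 0 ≤ φ b) :
    0 ≤ expect p φ := by
  apply tsum_nonneg
  intro b
  by_cases hb : b ∈ p.support
  · exact mul_nonneg ENNReal.toReal_nonneg (h b hb)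
  · rw [PMF.mem_support_iff, not_not] at hb
    simp [hb]

lemma expect_pure (a : α) (φ : α → ℝ) : expect (PMF.pure a) φ = φ a := by
  classical
  rw [expect_eq_sum (s := {a}) _ _ (by simp)]
  simp

lemma support_bind_finite (p : PMF α) (g : α → PMF β) (hp : p.support.Finite)
    (hg : ∀ a ∈ p.support, (g a).support.Finite) : (p.bind g).support.Finite := by
  rw [PMF.support_bind]
  exact hp.biUnion hg

lemma expect_bind (p : PMF α) (g : α → PMF β) (hp : p.support.Finite)
    (hg : ∀ a ∈ p.support, (g a).support.Finite) (φ : β → ℝ) :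
    expect (p.bind g) φ = expect p (fun a => expect (g a) φ) := by
  have hb := support_bind_finite p g hp hg
  rw [expect_eq_sum (p.bind g) φ (s := hb.toFinset) (by simp),
    expect_eq_sum p _ (s := hp.toFinset) (by simp)]
  have key : ∀ b, ((p.bind g) b).toReal
      = ∑ a ∈ hp.toFinset, (p a).toReal * (g a b).toReal := by
    intro b
    rw [PMF.bind_apply, tsum_eq_sum (s := hp.toFinset), ENNReal.toReal_sum]
    · exact Finset.sum_congr rfl fun a _ => ENNReal.toReal_mul
    · intro a _
      exact ENNReal.mul_ne_top (PMF.apply_ne_top _ _) (PMF.apply_ne_top _ _)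
    · intro a ha
      have : p a = 0 := by simpa using ha
      simp [this]
  simp_rw [key, Finset.sum_mul]
  rw [Finset.sum_comm]
  refine Finset.sum_congr rfl fun a ha => ?_
  rw [expect_eq_sum (g a) φ (s := hb.toFinset), Finset.mul_sum]
  · exact Finset.sum_congr rfl fun b _ => by ring
  · intro b hb'
    have ha' : a ∈ p.support := by simpa using ha
    simp only [Set.Finite.coe_toFinset, PMF.support_bind, Set.mem_iUnion]
    exact ⟨a, ha', hb'⟩

lemma support_map_finite (h : α → β) (p : PMF α) (hp : p.support.Finite) :
    (p.map h).support.Finite := by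
  rw [PMF.support_map]
  exact hp.image h

lemma expect_map (h : α → β) (p : PMF α) (hp : p.support.Finite) (φ : β → ℝ) :
    expect (p.map h) φ = expect p (fun a => φ (h a)) := by
  unfold PMF.map
  rw [expect_bind p _ hp (fun a _ => by simp)]
  simp only [Function.comp, expect_pure]

lemma expect_uniform {n : ℕ} [NeZero n] (φ : Fin n → ℝ) :
    expect (PMF.uniformOfFintype (Fin n)) φ = (1 / (n : ℝ)) * ∑ i, φ i := by
  rw [expect_eq_sum (s := Finset.univ) _ _ (by simp), Finset.mul_sum]
  refine Finset.sum_congr rfl fun i _ => ?_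
  simp

end Expectation

/-! ### Smooth convex functions and gradient estimators -/

section Calculus

variable {d n : ℕ}

lemma LSmooth.hasGradientAt {L : ℝ} {f : Vec d → ℝ} (h : LSmooth L f) (x : Vec d) :
    HasGradientAt f (gradient f x) x :=
  ((h.1.differentiable (by norm_num)) x).hasGradientAt

lemma gradient_objective {L : ℝ} {f : Fin n → Vec d → ℝ} (h : ∀ i, LSmooth L (f i)) (x : Vec d) :
    gradient (objective f) x = (1 / (n : ℝ)) • ∑ i, gradient (f i) x := by
  apply HasGradientAt.gradient
  rw [hasGradientAt_iff_hasFDerivAt, map_smul, map_sum]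
  have := HasFDerivAt.fun_sum (u := Finset.univ) (x := x)
    (fun i _ => (hasGradientAt_iff_hasFDerivAt.1 ((h i).hasGradientAt x)))
  exact this.const_smul (1 / (n : ℝ))

lemma LSmooth.le {L : ℝ} {f : Vec d → ℝ} (h : LSmooth L f) (x y : Vec d) :
    f y ≤ f x + inner ℝ (gradient f x) (y - x) + L / 2 * ‖y - x‖ ^ 2 := by
  have := (abs_le.1 (h.2 x y)).2
  linarith

lemma objective_le {L : ℝ} [NeZero n] {f : Fin n → Vec d → ℝ} (h : ∀ i, LSmooth L (f i))
    (x y : Vec d) :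
    objective f y ≤ objective f x + inner ℝ (gradient (objective f) x) (y - x)
      + L / 2 * ‖y - x‖ ^ 2 := by
  have hn : (0 : ℝ) < n := Nat.cast_pos.2 (NeZero.pos n)
  have h1 : ∑ i, f i y ≤ ∑ i, (f i x + inner ℝ (gradient (f i) x) (y - x)
      + L / 2 * ‖y - x‖ ^ 2) := Finset.sum_le_sum fun i _ => (h i).le x y
  rw [Finset.sum_add_distrib, Finset.sum_add_distrib, Finset.sum_const, Finset.card_univ,
    Fintype.card_fin, nsmul_eq_mul] at h1
  rw [gradient_objective h, inner_smul_left, sum_inner]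
  unfold objective
  have h2 := mul_le_mul_of_nonneg_left h1 (by positivity : (0 : ℝ) ≤ 1 / n)
  have h3 : (1 / (n : ℝ)) * (n * (L / 2 * ‖y - x‖ ^ 2)) = L / 2 * ‖y - x‖ ^ 2 := by
    field_simp
  simp only [conj_trivial]
  linarith [h2, h3]

/-- Co-coercivity of the gradient: the convex function `f - ⟨∇f(x), ·⟩` is minimal at `x`, and a
gradient step of length `1 / L` from `y` decreases it by `‖∇f(y) - ∇f(x)‖² / (2L)`. -/
lemma norm_gradient_sub_sq_le {L : ℝ} (hL : 0 < L) {f : Vec d → ℝ} (h : LSmooth L f)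
    (hc : StronglyConvex 0 f) (x y : Vec d) :
    ‖gradient f x - gradient f y‖ ^ 2
      ≤ 2 * L * (f y - f x - inner ℝ (gradient f x) (y - x)) := by
  set u := gradient f y - gradient f x with hu
  have h1 := hc x (y - (1 / L) • u)
  have h2 := h.le y (y - (1 / L) • u)
  have e1 : y - (1 / L) • u - y = -((1 / L) • u) := by abel
  have e2 : y - (1 / L) • u - x = (y - x) - (1 / L) • u := by abel
  rw [e1, norm_neg, norm_smul, inner_neg_right, inner_smul_right, mul_pow] at h2
  rw [e2, inner_sub_right, inner_smul_right] at h1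
  have e3 : ‖(1 / L : ℝ)‖ ^ 2 = 1 / L ^ 2 := by
    rw [Real.norm_eq_abs, sq_abs]; ring
  have e4 : inner ℝ (gradient f y) u - inner ℝ (gradient f x) u = ‖u‖ ^ 2 := by
    rw [← inner_sub_left, ← hu, real_inner_self_eq_norm_sq]
  rw [e3] at h2
  have e5 : ‖gradient f x - gradient f y‖ = ‖u‖ := by rw [hu, norm_sub_rev]
  rw [e5]
  have h3 : 1 / L * ‖u‖ ^ 2 - L / 2 * (1 / L ^ 2 * ‖u‖ ^ 2)
      ≤ f y - f x - inner ℝ (gradient f x) (y - x) := by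
    have e6 := congrArg (1 / L * ·) e4
    simp only [mul_sub] at e6
    linarith
  have h4 : 1 / L * ‖u‖ ^ 2 - L / 2 * (1 / L ^ 2 * ‖u‖ ^ 2) = ‖u‖ ^ 2 / (2 * L) := by
    field_simp; ring
  rw [h4, div_le_iff₀ (by positivity)] at h3
  linarith

lemma norm_coordGrad_sub_le {L μ : ℝ} (hμ : 0 < μ) {f : Vec d → ℝ} (h : LSmooth L f)
    (x : Vec d) : ‖coordGrad μ f x - gradient f x‖ ≤ d * (L * μ / 2) := by
  have hx : gradient f x = ∑ j : Fin d, (gradient f x j) • EuclideanSpace.single j (1 : ℝ) := by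
    ext k
    simp [Finset.sum_apply, Pi.single_apply]
  have : coordGrad μ f x - gradient f x = ∑ j : Fin d,
      ((f (x + μ • EuclideanSpace.single j (1 : ℝ)) - f (x - μ • EuclideanSpace.single j (1 : ℝ)))
      / (2 * μ) - gradient f x j) • EuclideanSpace.single j (1 : ℝ) := by
    conv_lhs => rw [hx]
    unfold coordGrad
    rw [← Finset.sum_sub_distrib]
    exact Finset.sum_congr rfl fun j _ => (sub_smul _ _ _).symm
  rw [this]
  refine (norm_sum_le _ _).trans ?_
  calc _ ≤ ∑ j : Fin d, L * μ / 2 := by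
        refine Finset.sum_le_sum fun j _ => ?_
        set e : Vec d := EuclideanSpace.single j (1 : ℝ)
        have hin : inner ℝ (gradient f x) e = gradient f x j := by
          rw [EuclideanSpace.inner_single_right]; simp
        have he : ‖e‖ = 1 := by simp [e]
        rw [norm_smul, he, mul_one, Real.norm_eq_abs]
        have h1 := h.2 x (x + μ • e)
        have h2 := h.2 x (x - μ • e)
        have n1 : ‖μ • e‖ ^ 2 = μ ^ 2 := by
          rw [norm_smul, he, mul_one, Real.norm_eq_abs, sq_abs]
        rw [add_sub_cancel_left, inner_smul_right, hin, n1] at h1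
        have e1 : x - μ • e - x = -(μ • e) := by abel
        rw [e1, norm_neg, inner_neg_right, inner_smul_right, hin, n1] at h2
        rw [abs_le] at h1 h2 ⊢
        have e2 : (f (x + μ • e) - f (x - μ • e)) / (2 * μ) - gradient f x j
          = (f (x + μ • e) - f (x - μ • e) - 2 * μ * gradient f x j) / (2 * μ) := by
          field_simp
        rw [e2]
        constructor
        · rw [le_div_iff₀ (by positivity)]; nlinarith
        · rw [div_le_iff₀ (by positivity)]; nlinarith
    _ = d * (L * μ / 2) := by simp

end Calculus

/-! ### The conditional gradient subroutine -/

section ConditionalGradient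

variable {d : ℕ}

/-- The quadratic `h(x) = γ (⟨g, x⟩ + τ/2 ‖x - y‖²) + 1/2 ‖x - u‖²` minimized by CondG. -/
def hVal (g u y : Vec d) (γ τ : ℝ) (x : Vec d) : ℝ :=
  γ * (inner ℝ g x + τ / 2 * ‖x - y‖ ^ 2) + 1 / 2 * ‖x - u‖ ^ 2

lemma hVal_expand (g u y : Vec d) (γ τ : ℝ) (x z : Vec d) :
    hVal g u y γ τ z = hVal g u y γ τ x + inner ℝ (hGrad g u y γ τ x) (z - x)
      + (γ * τ + 1) / 2 * ‖z - x‖ ^ 2 := by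
  have e1 : z - y = (z - x) + (x - y) := by abel
  have e2 : z - u = (z - x) + (x - u) := by abel
  have e3 : inner ℝ g z = inner ℝ g x + inner ℝ g (z - x) := by rw [inner_sub_right]; ring
  unfold hVal hGrad
  rw [e1, e2, norm_add_sq_real, norm_add_sq_real, e3]
  simp only [inner_add_left, inner_smul_left, conj_trivial]
  rw [real_inner_comm (z - x) (x - y), real_inner_comm (z - x) (x - u)]
  ring

/-- The clipped quotient `g / c` minimizes `-λ g + λ² c / 2` over `λ ∈ [0, 1]`. The hypothesis
covers the junk value of `g / c` at `c = 0`. -/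
lemma clip_optimal {g c : ℝ} (hc : 0 ≤ c) (h0 : c = 0 → g = 0) {r : ℝ} (hr0 : 0 ≤ r)
    (hr1 : r ≤ 1) :
    -(max 0 (min 1 (g / c)) * g) + max 0 (min 1 (g / c)) ^ 2 * (c / 2)
      ≤ -(r * g) + r ^ 2 * (c / 2) := by
  rcases hc.eq_or_lt with h | h
  · have := h0 h.symm
    subst this
    rw [← h]; simp
  · obtain ⟨q, hq⟩ : ∃ q, q = g / c := ⟨_, rfl⟩
    have hg : g = q * c := by rw [hq]; field_simp
    rw [← hq, hg]
    have key : ∀ b : ℝ, b ^ 2 / 2 - b * q ≤ r ^ 2 / 2 - r * q →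
        -(b * (q * c)) + b ^ 2 * (c / 2) ≤ -(r * (q * c)) + r ^ 2 * (c / 2) := by
      intro b hb
      have := mul_le_mul_of_nonneg_right hb h.le
      nlinarith
    apply key
    rcases le_total q 0 with h1 | h1
    · rw [max_eq_left ((min_le_right _ _).trans h1)]
      nlinarith
    · rcases le_total 1 q with h2 | h2
      · rw [min_eq_left h2, max_eq_right zero_le_one]
        nlinarith
      · rw [min_eq_right h2, max_eq_right h1]
        nlinarith [sq_nonneg (r - q)]

variable {K : Set (Vec d)} {lo : Vec d → Vec d} (hlo : IsLinearOracle K lo)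
  (g u y : Vec d) (γ τ : ℝ)

include hlo in
lemma inner_hGrad_le_hGap (x : Vec d) {v : Vec d} (hv : v ∈ K) :
    inner ℝ (hGrad g u y γ τ x) (x - v) ≤ hGap lo g u y γ τ x := by
  have := (hlo (-hGrad g u y γ τ x)).2 v hv
  unfold hGap hVertex
  simp only [inner_neg_left, inner_sub_right] at this ⊢
  linarith

include hlo in
lemma condGIter_mem (hK : Convex ℝ K) (hu : u ∈ K) (t : ℕ) :
    condGIter lo g u y γ τ t ∈ K := by
  induction t with
  | zero => exact hu
  | succ t ih =>
    apply hK ih (hlo _).1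
    · have : max 0 (min 1 (hGap lo g u y γ τ (condGIter lo g u y γ τ t) / ((γ * τ + 1) *
          ‖condGIter lo g u y γ τ t - hVertex lo g u y γ τ (condGIter lo g u y γ τ t)‖ ^ 2)))
          ≤ 1 := max_le zero_le_one (min_le_left _ _)
      exact sub_nonneg.2 this
    · exact le_max_left _ _
    · ring

/-- The step of CondG is an exact line search, so it does at least as well as any step `r`. -/
lemma hVal_condGIter_succ_le (hM : 0 ≤ γ * τ) (t : ℕ) {D r : ℝ} (hr0 : 0 ≤ r) (hr1 : r ≤ 1)
    (hD : ‖condGIter lo g u y γ τ t - hVertex lo g u y γ τ (condGIter lo g u y γ τ t)‖ ≤ D) :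
    hVal g u y γ τ (condGIter lo g u y γ τ (t + 1)) ≤ hVal g u y γ τ (condGIter lo g u y γ τ t)
      - r * hGap lo g u y γ τ (condGIter lo g u y γ τ t)
      + r ^ 2 * ((γ * τ + 1) * D ^ 2 / 2) := by
  rw [condGIter]
  set w := condGIter lo g u y γ τ t
  set v := hVertex lo g u y γ τ w with hv
  set β := max 0 (min 1 (hGap lo g u y γ τ w / ((γ * τ + 1) * ‖w - v‖ ^ 2))) with hβ
  have e1 : (1 - β) • w + β • v - w = -(β • (w - v)) := by module
  rw [hVal_expand g u y γ τ w, e1, norm_neg, norm_smul, inner_neg_right, inner_smul_right]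
  have e2 : inner ℝ (hGrad g u y γ τ w) (w - v) = hGap lo g u y γ τ w := rfl
  have hc : (0 : ℝ) ≤ (γ * τ + 1) * ‖w - v‖ ^ 2 := by positivity
  have := clip_optimal (g := hGap lo g u y γ τ w) hc (fun h => by
    have : ‖w - v‖ = 0 := by
      rcases mul_eq_zero.1 h with h | h
      · linarith
      · exact pow_eq_zero_iff (two_ne_zero) |>.1 h
    rw [← e2, norm_eq_zero.1 this, inner_zero_right]) hr0 hr1
  rw [← hβ] at this
  rw [e2, mul_pow, Real.norm_eq_abs, sq_abs]
  have h3 : r ^ 2 * ((γ * τ + 1) * ‖w - v‖ ^ 2 / 2) ≤ r ^ 2 * ((γ * τ + 1) * D ^ 2 / 2) := by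
    gcongr
  linarith

include hlo in
/-- The gap estimate of CondG. The objective at every iterate is compared with its value at the
`N`-th one; with the competing steps `4 / (t + 4)` half of the gap contracts the suboptimality and
the other half is a decrease of at least `2η / (t + 4)`. -/
lemma index_le_of_gap_gt (hK : Convex ℝ K) {D : ℝ} (hD : ∀ x ∈ K, ∀ y ∈ K, ‖x - y‖ ≤ D)
    (hu : u ∈ K) (hM : 0 ≤ γ * τ) {η : ℝ} (hη : 0 < η) {N : ℕ}
    (hN : ∀ t < N, η < hGap lo g u y γ τ (condGIter lo g u y γ τ t)) :
    (N : ℝ) ≤ 8 * ((γ * τ + 1) * D ^ 2) / η + 1 := by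
  set C := (γ * τ + 1) * D ^ 2 with hC
  have hC0 : 0 ≤ C := by positivity
  set it := condGIter lo g u y γ τ
  have hmem : ∀ t, it t ∈ K := condGIter_mem hlo g u y γ τ hK hu
  set δ : ℕ → ℝ := fun t => hVal g u y γ τ (it t) - hVal g u y γ τ (it N) with hδ
  have hgap : ∀ t, δ t ≤ hGap lo g u y γ τ (it t) := by
    intro t
    have h1 := inner_hGrad_le_hGap hlo g u y γ τ (it t) (hmem N)
    have h2 := hVal_expand g u y γ τ (it t) (it N)
    rw [← neg_sub (it N), inner_neg_right] at h1
    have : 0 ≤ (γ * τ + 1) / 2 * ‖it N - it t‖ ^ 2 := by positivity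
    simp only [hδ]; linarith
  have hstep : ∀ t, ∀ r : ℝ, 0 ≤ r → r ≤ 1 →
      δ (t + 1) ≤ δ t - r * hGap lo g u y γ τ (it t) + r ^ 2 * (C / 2) := by
    intro t r h0 h1
    have := hVal_condGIter_succ_le (lo := lo) g u y γ τ hM t h0 h1
      (hD _ (hmem t) _ (hlo _).1)
    simp only [hδ]
    linarith
  rcases Nat.eq_zero_or_pos N with h0 | hpos
  · rw [h0]
    have : 0 ≤ 8 * C / η := by positivity
    push_cast; linarith
  have main : ∀ m : ℕ, m + 1 ≤ N →
      ((m : ℝ) + 3) * (m + 4) * δ (m + 1) ≤ 6 * C + 8 * C * m - η * (m * (m + 7)) := by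
    intro m
    induction m with
    | zero =>
      intro _
      have h1 := hstep 0 1 zero_le_one le_rfl
      have h2 := hgap 0
      norm_num at h1 ⊢
      linarith
    | succ m ih =>
      intro hm
      have ih := ih (by omega)
      have hg := hN (m + 1) (by omega)
      have hd := hgap (m + 1)
      have hm0 : (0 : ℝ) ≤ m := m.cast_nonneg
      have h1 := hstep (m + 1) (4 / (m + 5)) (by positivity)
        ((div_le_one (by positivity)).2 (by linarith))
      set G := hGap lo g u y γ τ (it (m + 1))
      set x : ℝ := (m : ℝ)
      have h2 : δ (m + 1 + 1) * (x + 5) ^ 2 ≤ δ (m + 1) * (x + 5) ^ 2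
          - 4 * (x + 5) * G + 8 * C := by
        have := mul_le_mul_of_nonneg_right h1 (by positivity : (0 : ℝ) ≤ (x + 5) ^ 2)
        have e : (δ (m + 1) - 4 / (x + 5) * G + (4 / (x + 5)) ^ 2 * (C / 2)) * (x + 5) ^ 2
          = δ (m + 1) * (x + 5) ^ 2 - 4 * (x + 5) * G + 8 * C := by
          field_simp; ring
        linarith
      have h3 : (x + 5) * (2 * (δ (m + 1) + η)) ≤ (x + 5) * (4 * G) := by
        apply mul_le_mul_of_nonneg_left _ (by positivity)
        have : G ≥ δ (m + 1) := hd
        linarith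
      have h4 : δ (m + 1 + 1) * (x + 5) ^ 2 ≤ (x + 5) * ((x + 3) * δ (m + 1) - 2 * η)
          + 8 * C := by nlinarith
      have h5 : (x + 5) * (δ (m + 1 + 1) * (x + 5)) * (x + 4) ≤
          (x + 5) * ((x + 4) * ((x + 3) * δ (m + 1) - 2 * η) + 8 * C) := by
        have := mul_le_mul_of_nonneg_right h4 (by positivity : (0 : ℝ) ≤ x + 4)
        nlinarith
      have h6 : δ (m + 1 + 1) * (x + 5) * (x + 4) ≤
          (x + 4) * ((x + 3) * δ (m + 1) - 2 * η) + 8 * C := by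
        have hp : (0 : ℝ) < x + 5 := by positivity
        rw [mul_assoc] at h5
        exact le_of_mul_le_mul_left h5 hp
      push_cast
      nlinarith
  obtain ⟨m, rfl⟩ : ∃ m, N = m + 1 := ⟨N - 1, by omega⟩
  have h1 := main m le_rfl
  have h2 : δ (m + 1) = 0 := by simp [hδ]
  rw [h2, mul_zero] at h1
  have hm0 : (0 : ℝ) ≤ m := m.cast_nonneg
  have h3 : (m : ℝ) ≤ 8 * C / η := by
    rw [le_div_iff₀ hη]
    by_contra hcon
    push Not at hcon
    nlinarith [mul_nonneg hm0 hη.le, mul_nonneg hm0 hm0, mul_nonneg hC0 hm0,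
      mul_lt_mul_of_pos_right hcon (by positivity : (0 : ℝ) < m + 7)]
  push_cast
  linarith

include hlo in
lemma exists_condGStops (hK : Convex ℝ K) {D : ℝ} (hD : ∀ x ∈ K, ∀ y ∈ K, ‖x - y‖ ≤ D)
    (hu : u ∈ K) (hM : 0 ≤ γ * τ) {η : ℝ} (hη : 0 < η) :
    ∃ t, CondGStops lo g u y γ τ η t := by
  by_contra hcon
  push Not at hcon
  obtain ⟨N, hN⟩ := exists_nat_gt (8 * ((γ * τ + 1) * D ^ 2) / η + 1)
  have := index_le_of_gap_gt hlo g u y γ τ hK hD hu hM hη (N := N)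
    (fun t _ => not_le.1 (hcon t))
  linarith

include hlo in
lemma condGCalls_le (hK : Convex ℝ K) {D : ℝ} (hD : ∀ x ∈ K, ∀ y ∈ K, ‖x - y‖ ≤ D)
    (hu : u ∈ K) (hM : 0 ≤ γ * τ) {η : ℝ} (hη : 0 < η) :
    AtMost (condGCalls lo g u y γ τ η) (8 * ((γ * τ + 1) * D ^ 2) / η + 2) := by
  classical
  have h := exists_condGStops hlo g u y γ τ hK hD hu hM hη
  refine ⟨Nat.find h + 1, by rw [condGCalls, dif_pos h], ?_⟩
  have := index_le_of_gap_gt hlo g u y γ τ hK hD hu hM hη (N := Nat.find h)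
    (fun t ht => not_le.1 (Nat.find_min h ht))
  push_cast
  linarith

include hlo in
lemma condG_mem (hK : Convex ℝ K) (hu : u ∈ K) (η : ℝ) : condG lo g u y γ τ η ∈ K := by
  unfold condG
  split_ifs
  · exact condGIter_mem hlo g u y γ τ hK hu _
  · exact hu

include hlo in
lemma inner_hGrad_condG_le (hK : Convex ℝ K) {D : ℝ} (hD : ∀ x ∈ K, ∀ y ∈ K, ‖x - y‖ ≤ D)
    (hu : u ∈ K) (hM : 0 ≤ γ * τ) {η : ℝ} (hη : 0 < η) {v : Vec d} (hv : v ∈ K) :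
    inner ℝ (hGrad g u y γ τ (condG lo g u y γ τ η)) (condG lo g u y γ τ η - v) ≤ η := by
  classical
  have h := exists_condGStops hlo g u y γ τ hK hD hu hM hη
  refine (inner_hGrad_le_hGap hlo g u y γ τ _ hv).trans ?_
  have := Nat.find_spec h
  rw [condG, dif_pos h]
  exact this

end ConditionalGradient

/-! ### One inner iteration -/

section OneStep

variable {V : Type*} [NormedAddCommGroup V] [InnerProductSpace ℝ V]

lemma inner_sub_sub_eq (a b v : V) :
    inner ℝ (a - b) (a - v) = (‖a - b‖ ^ 2 + ‖a - v‖ ^ 2 - ‖b - v‖ ^ 2) / 2 := by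
  have h : b - v = (a - v) - (a - b) := by abel
  rw [h, norm_sub_sq_real (a - v) (a - b), real_inner_comm (a - v) (a - b)]
  ring

lemma norm_sub_weighted_mean_sq_le {s : ℝ} (hs : 0 ≤ s) (x u z : V) :
    (1 + s) * ‖x - (1 / (1 + s)) • (u + s • z)‖ ^ 2 ≤ s * ‖x - z‖ ^ 2 + ‖x - u‖ ^ 2 := by
  have hs' : (1 : ℝ) + s ≠ 0 := by positivity
  have e : x - (1 / (1 + s)) • (u + s • z) = (1 / (1 + s)) • ((x - u) + s • (x - z)) := by
    have : x = (1 / (1 + s)) • ((1 + s) • x) := by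
      rw [smul_smul, one_div_mul_cancel hs', one_smul]
    nth_rewrite 1 [this]
    module
  rw [e, norm_smul, mul_pow, norm_add_sq_real, norm_smul, mul_pow, inner_smul_right,
    Real.norm_eq_abs, Real.norm_eq_abs, sq_abs, sq_abs]
  have h := sq_nonneg ‖(x - u) - (x - z)‖
  rw [norm_sub_sq_real] at h
  have h1 : (1 + s) * ((1 / (1 + s)) ^ 2 * (‖x - u‖ ^ 2 + 2 * (s * inner ℝ (x - u) (x - z))
      + s ^ 2 * ‖x - z‖ ^ 2)) = (‖x - u‖ ^ 2 + 2 * (s * inner ℝ (x - u) (x - z))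
      + s ^ 2 * ‖x - z‖ ^ 2) / (1 + s) := by
    field_simp
  rw [h1, div_le_iff₀ (by positivity)]
  have h2 : 0 ≤ s * (‖x - u‖ ^ 2 - 2 * inner ℝ (x - u) (x - z) + ‖x - z‖ ^ 2) := by
    apply mul_nonneg hs
    have := sq_nonneg ‖(x - u) - (x - z)‖
    rw [norm_sub_sq_real] at this
    exact this
  nlinarith

lemma neg_inner_le_sq {b : ℝ} (hb : 0 < b) (x y : V) :
    -inner ℝ x y ≤ ‖x‖ ^ 2 / (2 * b) + b / 2 * ‖y‖ ^ 2 := by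
  have h1 := neg_le_of_abs_le (abs_real_inner_le_norm x y)
  have h2 : 0 ≤ (‖x‖ - b * ‖y‖) ^ 2 / (2 * b) := by positivity
  have h3 : (‖x‖ - b * ‖y‖) ^ 2 / (2 * b)
      = ‖x‖ ^ 2 / (2 * b) + b / 2 * ‖y‖ ^ 2 - ‖x‖ * ‖y‖ := by
    field_simp; ring
  linarith

lemma sum_norm_sub_mean_sq_le {n : ℕ} [NeZero n] (c : Fin n → V) :
    ∑ i, ‖c i - (1 / (n : ℝ)) • ∑ j, c j‖ ^ 2 ≤ ∑ i, ‖c i‖ ^ 2 := by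
  have hn : (0 : ℝ) < n := Nat.cast_pos.2 (NeZero.pos n)
  set m := (1 / (n : ℝ)) • ∑ j, c j with hm
  have hs : ∑ j, c j = (n : ℝ) • m := by
    rw [hm, smul_smul, mul_one_div_cancel hn.ne', one_smul]
  have : ∑ i, ‖c i - m‖ ^ 2 = ∑ i, ‖c i‖ ^ 2 - n * ‖m‖ ^ 2 := by
    simp_rw [norm_sub_sq_real]
    rw [Finset.sum_add_distrib, Finset.sum_sub_distrib, ← Finset.mul_sum, ← sum_inner, hs,
      inner_smul_left, real_inner_self_eq_norm_sq]
    simp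
    ring
  rw [this]
  have : 0 ≤ n * ‖m‖ ^ 2 := by positivity
  linarith

/-- The descent inequality along one sample path, before averaging over the sampled index. Here
`z` is the extrapolated point, `x` the approximate solution of the proximal subproblem for the
stochastic gradient `G`, `w = α / γ`, and `e` will be the mean of the error `G - g`. -/
lemma step_pathwise {F : V → ℝ} {x xb xb' z u v xt g G e : V} {α γ τ p b L η w : ℝ}
    (hγ : 0 < γ) (hτ : 0 ≤ τ) (hα : 0 < α) (hb : 0 < b) (hw : w * γ = α)
    (hbL : (L + b) * α ^ 2 ≤ w)
    (hsm : F xb' ≤ F z + inner ℝ g (xb' - z) + L / 2 * ‖xb' - z‖ ^ 2)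
    (hgap : inner ℝ (γ • (G + τ • (x - z)) + (x - u)) (x - v) ≤ η)
    (hz : (1 + τ * γ * (1 - α)) • z
      = ((1 + τ * γ) * (1 - α - p)) • xb + α • u + ((1 + τ * γ) * p) • xt)
    (hbar : xb' = (1 - α - p) • xb + α • x + p • xt) :
    F xb' + w * ((1 + γ * τ) / 2 * ‖x - v‖ ^ 2) ≤ F z + (1 - α - p) * inner ℝ g (xb - z)
      + α * inner ℝ g (v - z) + p * inner ℝ g (xt - z)
      + w * (η + γ * τ / 2 * ‖z - v‖ ^ 2 + 1 / 2 * ‖u - v‖ ^ 2)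
      + α * inner ℝ (G - g - e) (v - (1 / (1 + γ * τ)) • (u + (γ * τ) • z))
      + ‖G - g - e‖ ^ 2 / (2 * b) + α * inner ℝ e (v - x) := by
  have hs : 0 ≤ γ * τ := by positivity
  have hs' : (1 : ℝ) + γ * τ ≠ 0 := by positivity
  have hw0 : 0 < w := by
    by_contra h
    push Not at h
    have := mul_nonpos_of_nonpos_of_nonneg h hγ.le
    linarith
  obtain ⟨y, hy⟩ : ∃ y, y = (1 / (1 + γ * τ)) • (u + (γ * τ) • z) := ⟨_, rfl⟩
  have hy' : (1 + γ * τ) • y = u + (γ * τ) • z := by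
    rw [hy, smul_smul, mul_one_div_cancel hs', one_smul]
  have h1 : xb' - z = α • (x - y) := by
    have : (1 + γ * τ) • (xb' - z) = (1 + γ * τ) • (α • (x - y)) := by
      rw [hbar]
      linear_combination (norm := module) (-1 : ℝ) • hz + α • hy'
    exact smul_right_injective V hs' this
  have hR := norm_sub_weighted_mean_sq_le hs x u z
  rw [← hy] at hR ⊢
  set R := ‖x - y‖ ^ 2 with hRdef
  have hnorm : ‖xb' - z‖ ^ 2 = α ^ 2 * R := by
    rw [h1, norm_smul, mul_pow, Real.norm_eq_abs, sq_abs]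
  have hR0 : 0 ≤ R := by positivity
  have g1 : γ * inner ℝ G (x - v) + γ * τ * ((‖x - z‖ ^ 2 + ‖x - v‖ ^ 2 - ‖z - v‖ ^ 2) / 2)
      + (‖x - u‖ ^ 2 + ‖x - v‖ ^ 2 - ‖u - v‖ ^ 2) / 2 ≤ η := by
    rw [← inner_sub_sub_eq x z v, ← inner_sub_sub_eq x u v]
    simp only [inner_add_left, inner_smul_left, conj_trivial] at hgap
    linarith
  have g2 : α * inner ℝ G (x - v) ≤ w * (η + γ * τ / 2 * ‖z - v‖ ^ 2 + 1 / 2 * ‖u - v‖ ^ 2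
      - (1 + γ * τ) / 2 * ‖x - v‖ ^ 2 - (1 + γ * τ) / 2 * R) := by
    have : α * inner ℝ G (x - v) = w * (γ * inner ℝ G (x - v)) := by rw [← hw]; ring
    rw [this]
    apply mul_le_mul_of_nonneg_left _ hw0.le
    linarith
  have g3 : inner ℝ g (xb' - z) = (1 - α - p) * inner ℝ g (xb - z) + α * inner ℝ g (x - z)
      + p * inner ℝ g (xt - z) := by
    rw [← inner_smul_right, ← inner_smul_right, ← inner_smul_right, ← inner_add_right,
      ← inner_add_right, hbar]
    congr 1
    module
  have g4 : α * inner ℝ g (x - z) = α * inner ℝ g (v - z) + α * inner ℝ G (x - v)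
      + α * inner ℝ (G - g - e) (v - y) - inner ℝ (G - g - e) (xb' - z)
      + α * inner ℝ e (v - x) := by
    rw [h1, inner_smul_right]
    simp only [inner_sub_left, inner_sub_right]
    ring
  have g5 := neg_inner_le_sq hb (G - g - e) (xb' - z)
  rw [hnorm] at g5 hsm
  have g6 : (L + b) * α ^ 2 / 2 * R ≤ w * ((1 + γ * τ) / 2 * R) := by
    have h := mul_le_mul_of_nonneg_right hbL hR0
    have h' : 0 ≤ w * (γ * τ) * R := by positivity
    nlinarith
  rw [g3, g4] at hsm
  linarith

end OneStep

section Average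

variable {d n : ℕ} [NeZero n]

/-- The descent inequality of one inner iteration in expectation over the sampled index. The
parameter `κ` bounds the error of the gradient estimator, and `σ` is the factor lost in the
variance bound: `κ = 0`, `σ = 1` for exact gradients, and `σ = 2` otherwise, when half of the
strong convexity, too, is spent on the bias. -/
lemma step_average (a : Access) {f : Fin n → Vec d → ℝ} {L τ κ σ β α γ η w : ℝ}
    (hL : 0 < L) (hτ : 0 < τ)
    (hsm : ∀ i, LSmooth L (f i)) (hcv : ∀ i, StronglyConvex 0 (f i))
    (hsc : StronglyConvex τ (objective f))
    (herr : ∀ i x, ‖est a (f i) x - gradient (f i) x‖ ≤ κ)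
    (hcase : (κ = 0 ∧ σ = 1 ∧ β = γ * τ) ∨ (σ = 2 ∧ β = γ * τ / 2))
    (hα : 0 < α) (hα2 : α ≤ 1 / 2) (hγ : 0 < γ) (hw : w * γ = α)
    (hwL : w = (1 + 2 * σ) * L * α ^ 2)
    {xb z u v xt gt : Vec d} {x xb' G : Fin n → Vec d}
    (hgt : gt = (1 / (n : ℝ)) • ∑ i, est a (f i) xt)
    (hG : ∀ i, G i = est a (f i) z - est a (f i) xt + gt)
    (hgap : ∀ i, inner ℝ (hGrad (G i) u z γ τ (x i)) (x i - v) ≤ η)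
    (hz : (1 + τ * γ * (1 - α)) • z
      = ((1 + τ * γ) * (1 - α - 1 / 2)) • xb + α • u + ((1 + τ * γ) * (1 / 2)) • xt)
    (hbar : ∀ i, xb' i = (1 - α - 1 / 2) • xb + α • x i + (1 / 2 : ℝ) • xt) :
    (1 / (n : ℝ)) * ∑ i, (objective f (xb' i) - objective f v
        + w * ((1 + β) / 2 * ‖x i - v‖ ^ 2))
      ≤ (1 / 2 - α) * (objective f xb - objective f v)
        + 1 / 2 * (objective f xt - objective f v)
        + w * (η + 1 / 2 * ‖u - v‖ ^ 2) + κ ^ 2 * (1 / τ + 1 / L) := by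
  have hn : (0 : ℝ) < n := Nat.cast_pos.2 (NeZero.pos n)
  have hσ : 1 ≤ σ := by rcases hcase with ⟨_, h, _⟩ | ⟨h, _⟩ <;> norm_num [h]
  set F := objective f with hF
  set g := gradient F z with hg
  have hgsum : g = (1 / (n : ℝ)) • ∑ i, gradient (f i) z := gradient_objective hsm z
  set e : Vec d := (1 / (n : ℝ)) • ∑ i, (est a (f i) z - gradient (f i) z) with he
  have hκ : 0 ≤ κ := (norm_nonneg _).trans (herr ⟨0, NeZero.pos n⟩ z)
  have henorm : ‖e‖ ≤ κ := by
    rw [he, norm_smul, Real.norm_eq_abs, abs_of_pos (by positivity)]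
    have : ‖∑ i, (est a (f i) z - gradient (f i) z)‖ ≤ n * κ := by
      refine (norm_sum_le _ _).trans ?_
      refine (Finset.sum_le_sum fun i _ => herr i z).trans ?_
      simp
    calc 1 / (n : ℝ) * _ ≤ 1 / n * (n * κ) := by gcongr
      _ = κ := by field_simp
  -- centred stochastic gradients
  set c : Fin n → Vec d := fun i => est a (f i) z - est a (f i) xt with hc
  have hGe : ∀ i, G i - g - e = c i - (1 / (n : ℝ)) • ∑ j, c j := by
    intro i
    rw [hG, hgt, hgsum, he, hc]
    simp only [Finset.sum_sub_distrib]
    module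
  have hsum0 : ∑ i, (G i - g - e) = 0 := by
    simp_rw [hGe]
    rw [Finset.sum_sub_distrib, Finset.sum_const, Finset.card_univ, Fintype.card_fin,
      ← Nat.cast_smul_eq_nsmul ℝ, smul_smul, mul_one_div_cancel hn.ne', one_smul, sub_self]
  have hcsq : ∀ i, ‖c i‖ ^ 2 ≤ σ * ‖gradient (f i) z - gradient (f i) xt‖ ^ 2 + 8 * κ ^ 2 := by
    intro i
    have h1 : c i = (gradient (f i) z - gradient (f i) xt)
      + ((est a (f i) z - gradient (f i) z) - (est a (f i) xt - gradient (f i) xt)) := by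
      simp only [hc]; abel
    have h2 : ‖(est a (f i) z - gradient (f i) z) - (est a (f i) xt - gradient (f i) xt)‖
        ≤ 2 * κ := by
      refine (norm_sub_le _ _).trans ?_
      linarith [herr i z, herr i xt]
    set A := gradient (f i) z - gradient (f i) xt
    set B := (est a (f i) z - gradient (f i) z) - (est a (f i) xt - gradient (f i) xt)
    rw [h1]
    rcases hcase with ⟨h, h', _⟩ | ⟨h', _⟩
    · rw [h, mul_zero] at h2
      have : B = 0 := norm_le_zero_iff.1 h2
      rw [this, add_zero, h', h]
      linarith
    · rw [h']
      have h3 : ‖A + B‖ ^ 2 ≤ (‖A‖ + ‖B‖) ^ 2 := by gcongr; exact norm_add_le _ _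
      have h4 : ‖B‖ ^ 2 ≤ (2 * κ) ^ 2 := by gcongr
      nlinarith [sq_nonneg (‖A‖ - ‖B‖)]
  have hvar : ∑ i, ‖G i - g - e‖ ^ 2
      ≤ n * (σ * (2 * L * (F xt - F z - inner ℝ g (xt - z))) + 8 * κ ^ 2) := by
    simp_rw [hGe]
    refine (sum_norm_sub_mean_sq_le c).trans ?_
    refine (Finset.sum_le_sum fun i _ => hcsq i).trans ?_
    rw [Finset.sum_add_distrib, ← Finset.mul_sum, Finset.sum_const, Finset.card_univ,
      Fintype.card_fin, nsmul_eq_mul]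
    have h1 : ∑ i, ‖gradient (f i) z - gradient (f i) xt‖ ^ 2
        ≤ ∑ i, 2 * L * (f i xt - f i z - inner ℝ (gradient (f i) z) (xt - z)) :=
      Finset.sum_le_sum fun i _ => norm_gradient_sub_sq_le hL (hsm i) (hcv i) z xt
    have h2 : ∑ i, 2 * L * (f i xt - f i z - inner ℝ (gradient (f i) z) (xt - z))
        = n * (2 * L * (F xt - F z - inner ℝ g (xt - z))) := by
      rw [← Finset.mul_sum, Finset.sum_sub_distrib, Finset.sum_sub_distrib, ← sum_inner, hgsum,
        inner_smul_left, hF, objective, objective]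
      simp only [conj_trivial]
      field_simp
    rw [h2] at h1
    have := mul_le_mul_of_nonneg_left h1 (by linarith : (0 : ℝ) ≤ σ)
    linarith
  -- the bias is paid for by part of the strong convexity
  have hw0 : 0 < w := by rw [hwL]; positivity
  have hbias : ∀ i, α * inner ℝ e (v - x i) ≤ κ ^ 2 / τ
      + w * ((γ * τ - β) / 2 * ‖x i - v‖ ^ 2) := by
    intro i
    rcases hcase with ⟨h, _, h'⟩ | ⟨_, h'⟩
    · have : e = 0 := norm_le_zero_iff.1 (h ▸ henorm)
      rw [this, inner_zero_left, h', h]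
      simp
    · have h1 := neg_inner_le_sq (b := τ / 2) (by positivity) e (x i - v)
      have h2 : ‖e‖ ^ 2 ≤ κ ^ 2 := by gcongr
      rw [← inner_neg_right, neg_sub] at h1
      have h3 : ‖e‖ ^ 2 / (2 * (τ / 2)) ≤ κ ^ 2 / τ := by
        rw [mul_div_cancel₀ τ two_ne_zero]; gcongr
      have h4 : α * inner ℝ e (v - x i) ≤ α * (κ ^ 2 / τ) + α * (τ / 2 / 2 * ‖x i - v‖ ^ 2) := by
        rw [← mul_add]
        apply mul_le_mul_of_nonneg_left _ hα.le
        linarith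
      have h5 : w * ((γ * τ - β) / 2 * ‖x i - v‖ ^ 2) = α * (τ / 2 / 2 * ‖x i - v‖ ^ 2) := by
        rw [h', ← hw]; ring
      have h6 : α * (κ ^ 2 / τ) ≤ 1 * (κ ^ 2 / τ) := by
        apply mul_le_mul_of_nonneg_right (by linarith) (by positivity)
      rw [h5]
      linarith
  set y : Vec d := (1 / (1 + γ * τ)) • (u + (γ * τ) • z) with hy
  set b := 2 * L * σ with hb
  have hb0 : 0 < b := by rw [hb]; positivity
  have hpath : ∀ i, F (xb' i) + w * ((1 + β) / 2 * ‖x i - v‖ ^ 2)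
      ≤ F z + (1 / 2 - α) * inner ℝ g (xb - z)
      + α * inner ℝ g (v - z) + 1 / 2 * inner ℝ g (xt - z)
      + w * (η + γ * τ / 2 * ‖z - v‖ ^ 2 + 1 / 2 * ‖u - v‖ ^ 2) + κ ^ 2 / τ
      + α * inner ℝ (G i - g - e) (v - y) + ‖G i - g - e‖ ^ 2 / (2 * b) := by
    intro i
    have := step_pathwise (F := F) (e := e) (b := b) (L := L) (w := w) hγ hτ.le hα hb0 hw
      (by rw [hwL, hb]; apply le_of_eq; ring) (objective_le hsm z (xb' i)) (hgap i) hz (hbar i)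
    rw [← hy, ← hg] at this
    have e1 : (1 : ℝ) - α - 1 / 2 = 1 / 2 - α := by ring
    rw [e1] at this
    linarith [hbias i]
  obtain ⟨P, hP⟩ : ∃ P, P = F z + (1 / 2 - α) * inner ℝ g (xb - z)
      + α * inner ℝ g (v - z) + 1 / 2 * inner ℝ g (xt - z)
      + w * (η + γ * τ / 2 * ‖z - v‖ ^ 2 + 1 / 2 * ‖u - v‖ ^ 2) + κ ^ 2 / τ := ⟨_, rfl⟩
  have hsum : ∑ i, (F (xb' i) + w * ((1 + β) / 2 * ‖x i - v‖ ^ 2))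
      ≤ n * P + (∑ i, ‖G i - g - e‖ ^ 2) / (2 * b) := by
    refine (Finset.sum_le_sum fun i _ => hpath i).trans (le_of_eq ?_)
    rw [← hP, Finset.sum_add_distrib, Finset.sum_add_distrib, ← Finset.mul_sum, ← sum_inner,
      hsum0, inner_zero_left, ← Finset.sum_div, Finset.sum_const, Finset.card_univ,
      Fintype.card_fin, nsmul_eq_mul]
    ring
  have hvar' : (∑ i, ‖G i - g - e‖ ^ 2) / (2 * b)
      ≤ n * (1 / 2 * (F xt - F z - inner ℝ g (xt - z)) + κ ^ 2 / L) := by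
    rw [div_le_iff₀ (by positivity)]
    refine hvar.trans ?_
    have h1 : n * (1 / 2 * (F xt - F z - inner ℝ g (xt - z)) + κ ^ 2 / L) * (2 * b)
      = n * (σ * (2 * L * (F xt - F z - inner ℝ g (xt - z))) + 4 * σ * κ ^ 2) := by
      rw [hb]; field_simp; ring
    rw [h1]
    apply mul_le_mul_of_nonneg_left _ hn.le
    rcases hcase with ⟨h, _, _⟩ | ⟨h, _⟩
    · rw [h]; simp
    · rw [h]; linarith
  have hc1 : F z + inner ℝ g (xb - z) ≤ F xb := by
    have := hsc z xb
    have h2 : 0 ≤ τ / 2 * ‖xb - z‖ ^ 2 := by positivity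
    linarith
  have hc2 : F z + inner ℝ g (v - z) + τ / 2 * ‖z - v‖ ^ 2 ≤ F v := by
    rw [norm_sub_rev z v]
    exact hsc z v
  have hc1' := mul_le_mul_of_nonneg_left hc1 (by linarith : (0 : ℝ) ≤ 1 / 2 - α)
  have hc2' := mul_le_mul_of_nonneg_left hc2 hα.le
  have hwγ : w * (γ * τ / 2 * ‖z - v‖ ^ 2) = α * (τ / 2 * ‖z - v‖ ^ 2) := by rw [← hw]; ring
  have hlhs : ∑ i, (F (xb' i) - F v + w * ((1 + β) / 2 * ‖x i - v‖ ^ 2))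
      = ∑ i, (F (xb' i) + w * ((1 + β) / 2 * ‖x i - v‖ ^ 2)) - n * F v := by
    rw [eq_sub_iff_add_eq]
    have : (n : ℝ) * F v = ∑ _i : Fin n, F v := by simp
    rw [this, ← Finset.sum_add_distrib]
    exact Finset.sum_congr rfl fun i _ => by ring
  rw [hlhs, one_div_mul_eq_div, div_le_iff₀ hn]
  have : P + (1 / 2 * (F xt - F z - inner ℝ g (xt - z)) + κ ^ 2 / L) - F v
      ≤ (1 / 2 - α) * (F xb - F v)
        + 1 / 2 * (F xt - F v)
        + w * (η + 1 / 2 * ‖u - v‖ ^ 2) + κ ^ 2 * (1 / τ + 1 / L) := by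
    have e1 : κ ^ 2 * (1 / τ + 1 / L) = κ ^ 2 / τ + κ ^ 2 / L := by ring
    rw [e1, hP]
    have e2 : w * (η + γ * τ / 2 * ‖z - v‖ ^ 2 + 1 / 2 * ‖u - v‖ ^ 2)
      = w * (η + 1 / 2 * ‖u - v‖ ^ 2) + w * (γ * τ / 2 * ‖z - v‖ ^ 2) := by ring
    rw [e2, hwγ]
    nlinarith
  have := mul_le_mul_of_nonneg_left this hn.le
  linarith

end Average

/-! ### The parameters -/

section Parameters

/-- The growth rate `β` of the weights in epoch `s`: `Γ_t = (1 + β) ^ t`. -/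
def scBeta (a : Access) (n : ℕ) (L τ : ℝ) (s : ℕ) : ℝ :=
  match a with
  | .first => scGamma a n L τ s * τ
  | .zeroth _ => scGamma a n L τ s * τ / 2

/-- The quotient `α_s / γ_s`. -/
def scRatio (a : Access) (n : ℕ) (L τ : ℝ) (s : ℕ) : ℝ := coef a * L * scAlpha a n L τ s ^ 2

variable {a : Access} {n : ℕ} {L τ : ℝ} {s : ℕ}

lemma coef_pos (a : Access) : 0 < coef a := by cases a <;> norm_num [coef]

lemma three_le_coef (a : Access) : 3 ≤ coef a := by cases a <;> norm_num [coef]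

lemma coef_le_five (a : Access) : coef a ≤ 5 := by cases a <;> norm_num [coef]

lemma scBigGamma_eq (t : ℕ) : scBigGamma a n L τ s t = (1 + scBeta a n L τ s) ^ t := by
  cases a <;> simp only [scBigGamma, scBeta] <;> ring

lemma sigma_pos (a : Access) (hL : 0 < L) (hτ : 0 < τ) : 0 < sigma a L τ := by
  have := coef_pos a
  unfold sigma; positivity

lemma scAlpha_pos (hL : 0 < L) (hτ : 0 < τ) (hn : 0 < n) : 0 < scAlpha a n L τ s := by
  have := sigma_pos a hL hτ
  have : (0 : ℝ) < n := Nat.cast_pos.2 hn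
  unfold scAlpha
  split_ifs
  · norm_num
  · exact lt_min (by positivity) (by norm_num)

lemma scAlpha_le_half : scAlpha a n L τ s ≤ 1 / 2 := by
  unfold scAlpha
  split_ifs
  · exact le_rfl
  · exact min_le_right _ _

lemma scAlpha_eq_half (hL : 0 < L) (hτ : 0 < τ) (h : s ≤ sZero n ∨ sigma a L τ ≤ n) :
    scAlpha a n L τ s = 1 / 2 := by
  unfold scAlpha
  split_ifs with hs
  · rfl
  · have h1 := h.resolve_left hs
    have := sigma_pos a hL hτ
    apply min_eq_right
    rw [show (1 / 2 : ℝ) = Real.sqrt (1 / 4) by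
      rw [show (1 / 4 : ℝ) = (1 / 2) ^ 2 by norm_num, Real.sqrt_sq (by norm_num)]]
    apply Real.sqrt_le_sqrt
    rw [div_le_div_iff₀ (by norm_num) (by positivity)]
    linarith

lemma scAlpha_sq (hL : 0 < L) (hτ : 0 < τ) (hs : sZero n < s) (h : (n : ℝ) < sigma a L τ) :
    scAlpha a n L τ s ^ 2 * (4 * sigma a L τ) = n := by
  have h0 := sigma_pos a hL hτ
  have h2 : Real.sqrt ((n : ℝ) / (4 * sigma a L τ)) ≤ 1 / 2 := by
    rw [show (1 / 2 : ℝ) = Real.sqrt (1 / 4) by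
      rw [show (1 / 4 : ℝ) = (1 / 2) ^ 2 by norm_num, Real.sqrt_sq (by norm_num)]]
    apply Real.sqrt_le_sqrt
    rw [div_le_div_iff₀ (by positivity) (by norm_num)]
    linarith
  unfold scAlpha
  rw [if_neg (not_le.2 hs), min_eq_left h2, Real.sq_sqrt (by positivity)]
  field_simp

lemma scGamma_pos (hL : 0 < L) (hτ : 0 < τ) (hn : 0 < n) : 0 < scGamma a n L τ s := by
  have := coef_pos a
  have := scAlpha_pos (a := a) (s := s) hL hτ hn
  unfold scGamma; positivity

lemma scRatio_mul (hL : 0 < L) (hτ : 0 < τ) (hn : 0 < n) :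
    scRatio a n L τ s * scGamma a n L τ s = scAlpha a n L τ s := by
  have := coef_pos a
  have := scAlpha_pos (a := a) (s := s) hL hτ hn
  unfold scRatio scGamma
  field_simp

lemma scRatio_pos (hL : 0 < L) (hτ : 0 < τ) (hn : 0 < n) : 0 < scRatio a n L τ s := by
  have := coef_pos a
  have := scAlpha_pos (a := a) (s := s) hL hτ hn
  unfold scRatio; positivity

lemma scRatio_le (hL : 0 < L) (hτ : 0 < τ) (hn : 0 < n) :
    scRatio a n L τ s ≤ coef a * L / 4 := by
  have h1 := coef_pos a
  have h2 := scAlpha_pos (a := a) (s := s) hL hτ hn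
  have h3 := scAlpha_le_half (a := a) (n := n) (L := L) (τ := τ) (s := s)
  unfold scRatio
  have h4 : scAlpha a n L τ s ^ 2 ≤ (1 / 2) ^ 2 := by gcongr
  have h5 : 0 < coef a * L := by positivity
  nlinarith

lemma scGamma_mul (hL : 0 < L) (hτ : 0 < τ) (hn : 0 < n) :
    scGamma a n L τ s * τ * (4 * sigma a L τ * scAlpha a n L τ s) = 1 := by
  have := coef_pos a
  have := scAlpha_pos (a := a) (s := s) hL hτ hn
  unfold scGamma sigma
  field_simp

lemma scGamma_mul_le (hL : 0 < L) (hτ : 0 < τ) (hn : 0 < n) :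
    scGamma a n L τ s * τ ≤ 1 + 2 * τ / L := by
  have hc := three_le_coef a
  have ha := scAlpha_pos (a := a) (s := s) hL hτ hn
  have h := scGamma_mul (a := a) (s := s) hL hτ hn
  have hg := scGamma_pos (a := a) (s := s) hL hτ hn
  have hσ := sigma_pos a hL hτ
  have hn1 : (1 : ℝ) ≤ n := by exact_mod_cast hn
  by_cases hs : s ≤ sZero n ∨ sigma a L τ ≤ n
  · rw [scGamma, scAlpha_eq_half hL hτ hs]
    have h1 : 1 / (coef a * L * (1 / 2)) * τ = (2 * τ / L) / coef a := by field_simp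
    have h2 : (2 * τ / L) / coef a ≤ 2 * τ / L := div_le_self (by positivity) (by linarith)
    linarith
  · push Not at hs
    have h2 := scAlpha_sq hL hτ hs.1 hs.2
    set x := scGamma a n L τ s * τ
    have hx : 0 < x := by positivity
    have h3 : x ^ 2 * (4 * sigma a L τ * n) = 1 := by
      rw [← h2]
      calc _ = (x * (4 * sigma a L τ * scAlpha a n L τ s)) ^ 2 := by ring
        _ = 1 := by rw [h]; ring
    have h4 : x ^ 2 * (4 * 1 * 1) ≤ x ^ 2 * (4 * sigma a L τ * n) := by
      gcongr; linarith
    have : 0 < 2 * τ / L := by positivity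
    nlinarith

lemma scBeta_pos (hL : 0 < L) (hτ : 0 < τ) (hn : 0 < n) : 0 < scBeta a n L τ s := by
  have := scGamma_pos (a := a) (s := s) hL hτ hn
  cases a <;> simp only [scBeta] <;> positivity

lemma scBeta_le (hL : 0 < L) (hτ : 0 < τ) (hn : 0 < n) :
    scBeta a n L τ s ≤ scGamma a n L τ s * τ := by
  have := scGamma_pos (a := a) (s := s) hL hτ hn
  have : 0 < scGamma a n L τ s * τ := by positivity
  cases a <;> simp only [scBeta] at * <;> linarith

lemma le_scBeta (hL : 0 < L) (hτ : 0 < τ) (hn : 0 < n) :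
    scGamma a n L τ s * τ / 2 ≤ scBeta a n L τ s := by
  have := scGamma_pos (a := a) (s := s) hL hτ hn
  have : 0 < scGamma a n L τ s * τ := by positivity
  cases a <;> simp only [scBeta] at * <;> linarith

lemma scGamma_mul_nat (hL : 0 < L) (hτ : 0 < τ) (hn : 0 < n) (hs : sZero n < s)
    (h : (n : ℝ) < sigma a L τ) : scGamma a n L τ s * τ * n = scAlpha a n L τ s := by
  have ha := scAlpha_pos (a := a) (s := s) hL hτ hn
  have h1 := scGamma_mul (a := a) (s := s) hL hτ hn
  rw [← scAlpha_sq hL hτ hs h]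
  calc _ = scGamma a n L τ s * τ * (4 * sigma a L τ * scAlpha a n L τ s)
        * scAlpha a n L τ s := by ring
    _ = _ := by rw [h1, one_mul]

lemma scBeta_mul_nat_le (hL : 0 < L) (hτ : 0 < τ) (hn : 0 < n) (hs : sZero n < s)
    (h : (n : ℝ) < sigma a L τ) : scBeta a n L τ s * n ≤ scAlpha a n L τ s := by
  rw [← scGamma_mul_nat hL hτ hn hs h]
  exact mul_le_mul_of_nonneg_right (scBeta_le hL hτ hn) n.cast_nonneg

lemma scT_pos : 0 < scT n s := by
  unfold scT; split_ifs <;> positivity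

lemma two_pow_sZero_le (hn : 0 < n) : 2 ^ (sZero n - 1) ≤ n := by
  unfold sZero
  rw [Nat.add_sub_cancel]
  exact Nat.pow_log_le_self 2 hn.ne'

lemma lt_two_pow_sZero (n : ℕ) : n < 2 ^ sZero n := Nat.lt_pow_succ_log_self one_lt_two n

lemma one_le_sZero (n : ℕ) : 1 ≤ sZero n := Nat.succ_le_succ (Nat.zero_le _)

lemma scT_le (hn : 0 < n) : scT n s ≤ n := by
  unfold scT
  split_ifs with h
  · exact (Nat.pow_le_pow_right two_pos (by omega)).trans (two_pow_sZero_le hn)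
  · exact two_pow_sZero_le hn

lemma scT_sZero : scT n (sZero n) = 2 ^ (sZero n - 1) := if_pos le_rfl

lemma scT_of_le (hs : sZero n ≤ s) : scT n s = 2 ^ (sZero n - 1) := by
  unfold scT
  split_ifs with h
  · rw [le_antisymm h hs]
  · rfl

lemma lt_two_mul_scT (hs : sZero n ≤ s) : n < 2 * scT n s := by
  rw [scT_of_le hs, ← pow_succ', Nat.sub_add_cancel (one_le_sZero n)]
  exact lt_two_pow_sZero n

/-- The part of the weight `Γ_{t-1}` that the next inner iteration consumes; the rest is `θ_t`. -/
def scCarry (a : Access) (n : ℕ) (L τ : ℝ) (s t : ℕ) : ℝ :=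
  if t < scT n s then (1 / 2 - scAlpha a n L τ s) * (1 + scBeta a n L τ s) ^ t else 0

lemma scTheta_add_scCarry (t : ℕ) :
    scTheta a n L τ s (t + 1) + scCarry a n L τ s (t + 1) = (1 + scBeta a n L τ s) ^ t := by
  unfold scTheta scCarry
  simp only [scBigGamma_eq, Nat.add_sub_cancel]
  by_cases h : t + 1 < scT n s
  · rw [if_pos h, if_pos (by omega)]; ring
  · rw [if_neg h, if_neg (by omega)]; ring

lemma scBeta_le_one (hL : 0 < L) (hτ : 0 < τ) (hn : 0 < n) (hs : sZero n < s)
    (h : (n : ℝ) < sigma a L τ) : scBeta a n L τ s ≤ 1 := by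
  have h1 := scBeta_mul_nat_le hL hτ hn hs h
  have h2 := scAlpha_le_half (a := a) (n := n) (L := L) (τ := τ) (s := s)
  have hn1 : (1 : ℝ) ≤ n := by exact_mod_cast hn
  have := scBeta_pos (a := a) (s := s) hL hτ hn
  nlinarith

lemma scTheta_pos (hL : 0 < L) (hτ : 0 < τ) (hn : 0 < n) (t : ℕ) :
    0 < scTheta a n L τ s (t + 1) := by
  have hb := scBeta_pos (a := a) (s := s) hL hτ hn
  have ha := scAlpha_pos (a := a) (s := s) hL hτ hn
  have h := scTheta_add_scCarry (a := a) (n := n) (L := L) (τ := τ) (s := s) t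
  have hp : 0 < (1 + scBeta a n L τ s) ^ t := by positivity
  suffices scCarry a n L τ s (t + 1) < (1 + scBeta a n L τ s) ^ t by linarith
  unfold scCarry
  split_ifs with ht
  · by_cases hs : s ≤ sZero n ∨ sigma a L τ ≤ n
    · rw [scAlpha_eq_half hL hτ hs]; simpa using hp
    · push Not at hs
      have := scBeta_le_one hL hτ hn hs.1 hs.2
      rw [pow_succ']
      have : (1 / 2 - scAlpha a n L τ s) * (1 + scBeta a n L τ s) < 1 := by nlinarith
      nlinarith
  · exact hp

lemma scEta_pos (hL : 0 < L) (hτ : 0 < τ) (hn : 0 < n) (hs : 1 ≤ s) {D₀ : ℝ} (hD : 0 < D₀) :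
    0 < scEta a n L τ D₀ s := by
  have hT : (0 : ℝ) < scT n s := Nat.cast_pos.2 scT_pos
  have hb := scBeta_pos (a := a) (s := s) hL hτ hn
  have hn1 : (0 : ℝ) < n := Nat.cast_pos.2 hn
  have hs1 : (0 : ℝ) < s := Nat.cast_pos.2 hs
  unfold scEta
  simp only [scBigGamma_eq]
  split_ifs <;> positivity

end Parameters

/-! ### One epoch -/

section Epoch

/-- The standing assumptions. The real number `κ` bounds the error of the gradient estimator. -/
structure Admissible {d n : ℕ} (a : Access) (f : Fin n → Vec d → ℝ) (K : Set (Vec d))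
    (lo : Vec d → Vec d) (xs : Vec d) (L τ D κ : ℝ) : Prop where
  L_pos : 0 < L
  τ_pos : 0 < τ
  smooth : ∀ i, LSmooth L (f i)
  convex : ∀ i, StronglyConvex 0 (f i)
  strong : StronglyConvex τ (objective f)
  convexSet : Convex ℝ K
  diam : ∀ x ∈ K, ∀ y ∈ K, ‖x - y‖ ≤ D
  oracle : IsLinearOracle K lo
  mem : xs ∈ K
  min : ∀ x ∈ K, objective f xs ≤ objective f x
  err : ∀ i x, ‖est a (f i) x - gradient (f i) x‖ ≤ κ
  err_first : a = .first → κ = 0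

/-- The error that an inexact gradient estimator adds in one inner iteration. -/
def stepError (L τ κ : ℝ) : ℝ := κ ^ 2 * (1 / τ + 1 / L)

variable {d n : ℕ} [NeZero n] {a : Access} {f : Fin n → Vec d → ℝ} {K : Set (Vec d)}
  {lo : Vec d → Vec d} {xs : Vec d} {L τ D κ : ℝ}

lemma StronglyConvex.combo_le {F : Vec d → ℝ} (hτ : 0 ≤ τ) (h : StronglyConvex τ F)
    {r s : ℝ} (hr : 0 ≤ r) (hs : 0 ≤ s) (hrs : r + s = 1) (x y : Vec d) :
    F (r • x + s • y) ≤ r * F x + s * F y := by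
  set z := r • x + s • y with hz
  have h1 := h z x
  have h2 := h z y
  have e : r * inner ℝ (gradient F z) (x - z) + s * inner ℝ (gradient F z) (y - z) = 0 := by
    rw [← inner_smul_right, ← inner_smul_right, ← inner_add_right]
    have : r • (x - z) + s • (y - z) = 0 := by
      have hr' : r = 1 - s := by linarith
      rw [hz, hr']; module
    rw [this, inner_zero_right]
  have p1 : 0 ≤ τ / 2 * ‖x - z‖ ^ 2 := by positivity
  have p2 : 0 ≤ τ / 2 * ‖y - z‖ ^ 2 := by positivity
  have q1 := mul_le_mul_of_nonneg_left (le_of_add_le_of_nonneg_left h1 p1) hr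
  have q2 := mul_le_mul_of_nonneg_left (le_of_add_le_of_nonneg_left h2 p2) hs
  have : F z = r * F z + s * F z := by rw [← add_mul, hrs, one_mul]
  linarith

/-- The sum of the first `t` averaging weights of epoch `s`. -/
def thetaSum (a : Access) (n : ℕ) (L τ : ℝ) (s t : ℕ) : ℝ :=
  ∑ j ∈ Finset.Icc 1 t, scTheta a n L τ s j

lemma thetaSum_succ (a : Access) (n : ℕ) (L τ : ℝ) (s t : ℕ) :
    thetaSum a n L τ s (t + 1) = thetaSum a n L τ s t + scTheta a n L τ s (t + 1) := by
  unfold thetaSum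
  rw [Finset.sum_Icc_succ_top (by omega)]

omit [NeZero n] in
lemma thetaSum_nonneg (hL : 0 < L) (hτ : 0 < τ) (hn : 0 < n) (s t : ℕ) :
    0 ≤ thetaSum a n L τ s t := by
  induction t with
  | zero => simp [thetaSum]
  | succ t ih =>
    rw [thetaSum_succ]
    linarith [scTheta_pos (a := a) (s := s) hL hτ hn t]

/-- What holds on every sample path after `t` inner iterations: the iterates and the running
average stay in `K`, and the counters grow at most linearly, `B` bounding the cost of one call of
CondG. -/
structure InnerInv (a : Access) (K : Set (Vec d)) (Θ : ℝ) (q : ℕ) (B : ℝ) (z : Inner d) :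
    Prop where
  x_mem : z.x ∈ K
  xbar_mem : z.xbar ∈ K
  acc_mem : ∃ y ∈ K, z.acc = Θ • y
  queries_eq : z.queries = q
  calls : AtMost z.loCalls B

/-- The potential of the inner loop. The first term bounds the weighted gap of the iterates so far
(by Jensen's inequality, one step at a time), so that the law of a single state suffices. -/
def innerPotential (a : Access) (L τ : ℝ) (f : Fin n → Vec d → ℝ) (xs : Vec d) (s t : ℕ)
    (z : Inner d) : ℝ :=
  thetaSum a n L τ s t
      * (objective f ((1 / thetaSum a n L τ s t) • z.acc) - objective f xs)
    + scCarry a n L τ s t * (objective f z.xbar - objective f xs)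
    + scRatio a n L τ s * (1 + scBeta a n L τ s) ^ t * (1 / 2 * ‖z.x - xs‖ ^ 2)

lemma AtMost.add {N M : ℕ∞} {A B : ℝ} (h : AtMost N A) (h' : AtMost M B) :
    AtMost (N + M) (A + B) := by
  obtain ⟨m, rfl, hm⟩ := h
  obtain ⟨k, rfl, hk⟩ := h'
  exact ⟨m + k, by push_cast; rfl, by push_cast; linarith⟩

lemma AtMost.mono {N : ℕ∞} {A B : ℝ} (h : AtMost N A) (hAB : A ≤ B) : AtMost N B := by
  obtain ⟨m, rfl, hm⟩ := h
  exact ⟨m, rfl, hm.trans hAB⟩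

/-- A bound for the number of linear oracle calls in one call of CondG in epoch `s`. -/
def callBound (a : Access) (n : ℕ) (L τ D D₀ : ℝ) (s : ℕ) : ℝ :=
  8 * ((scGamma a n L τ s * τ + 1) * D ^ 2) / scEta a n L τ D₀ s + 2

omit [NeZero n] in
lemma extrapolated_eq {α β : ℝ} (hα : α ≤ 1 / 2) (hβ : 0 ≤ β) {y z : Vec d} (h : z =
    (1 / (1 + β * (1 - α))) • y) : (1 + β * (1 - α)) • z = y := by
  have : (1 + β * (1 - α)) ≠ 0 := by
    have : 0 ≤ β * (1 - α) := mul_nonneg hβ (by linarith)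
    positivity
  rw [h, smul_smul, mul_one_div_cancel this, one_smul]

lemma innerStep_inv (H : Admissible a f K lo xs L τ D κ) {D₀ : ℝ} (hD : 0 < D₀) {s t : ℕ}
    (hs : 1 ≤ s) {xt gt : Vec d} (hxt : xt ∈ K) {z : Inner d} {q : ℕ} {B : ℝ}
    (hz : InnerInv a K (thetaSum a n L τ s t) q B z) (i : Fin n) :
    InnerInv a K (thetaSum a n L τ s (t + 1)) (q + 2 * estCost d a)
      (B + callBound a n L τ D D₀ s)
      (innerStep a (scParams a n L τ D₀) τ f lo s (t + 1) xt gt z i) := by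
  have hn : 0 < n := NeZero.pos n
  have hα := scAlpha_pos (a := a) (s := s) H.L_pos H.τ_pos hn
  have hα2 := scAlpha_le_half (a := a) (n := n) (L := L) (τ := τ) (s := s)
  have hγ := scGamma_pos (a := a) (s := s) H.L_pos H.τ_pos hn
  have hη := scEta_pos (a := a) (s := s) H.L_pos H.τ_pos hn hs hD
  have hM : 0 ≤ scGamma a n L τ s * τ := (mul_pos hγ H.τ_pos).le
  have hx : (innerStep a (scParams a n L τ D₀) τ f lo s (t + 1) xt gt z i).x ∈ K :=
    condG_mem H.oracle _ _ _ _ _ H.convexSet hz.x_mem _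
  have hxbar : (innerStep a (scParams a n L τ D₀) τ f lo s (t + 1) xt gt z i).xbar ∈ K := by
    have : ∀ x ∈ K, (1 - scAlpha a n L τ s - 1 / 2) • z.xbar + scAlpha a n L τ s • x
        + (1 / 2 : ℝ) • xt ∈ K := by
      intro x hx
      have h1 : (1 - 2 * scAlpha a n L τ s) • z.xbar + (2 * scAlpha a n L τ s) • x ∈ K :=
        H.convexSet hz.xbar_mem hx (by linarith) (by linarith) (by ring)
      have h2 := H.convexSet h1 hxt (by norm_num : (0 : ℝ) ≤ 1 / 2)
        (by norm_num : (0 : ℝ) ≤ 1 / 2) (by norm_num)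
      convert h2 using 1
      module
    exact this _ hx
  refine ⟨hx, hxbar, ?_, ?_, ?_⟩
  · obtain ⟨y, hy, hacc⟩ := hz.acc_mem
    set xb := (innerStep a (scParams a n L τ D₀) τ f lo s (t + 1) xt gt z i).xbar with hxb
    have e : (innerStep a (scParams a n L τ D₀) τ f lo s (t + 1) xt gt z i).acc
      = z.acc + scTheta a n L τ s (t + 1) • xb := rfl
    rw [e, hacc, thetaSum_succ]
    have h1 := scTheta_pos (a := a) (s := s) H.L_pos H.τ_pos hn t
    have h2 := thetaSum_nonneg (a := a) H.L_pos H.τ_pos hn s t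
    set A := thetaSum a n L τ s t
    set b := scTheta a n L τ s (t + 1)
    have hAb : 0 < A + b := by linarith
    refine ⟨(A / (A + b)) • y + (b / (A + b)) • xb, H.convexSet hy hxbar (by positivity)
      (by positivity) (by field_simp), ?_⟩
    rw [smul_add, smul_smul, smul_smul, mul_div_cancel₀ _ hAb.ne', mul_div_cancel₀ _ hAb.ne']
  · change z.queries + 2 * estCost d a = _
    rw [hz.queries_eq]
  · exact hz.calls.add (condGCalls_le H.oracle _ _ _ _ _ H.convexSet H.diam hz.x_mem hM hη)

omit [NeZero n] in
/-- Jensen's inequality for one more term of a weighted average. The hypothesis `hΘ` covers the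
junk value of `1 / Θ` at the start. -/
lemma average_gap_le (H : Admissible a f K lo xs L τ D κ) {Θ θ : ℝ} (hΘ : 0 ≤ Θ) (hθ : 0 < θ)
    {acc x : Vec d} (hacc : ∃ y, acc = Θ • y) :
    (Θ + θ) * (objective f ((1 / (Θ + θ)) • (acc + θ • x)) - objective f xs)
      ≤ Θ * (objective f ((1 / Θ) • acc) - objective f xs)
        + θ * (objective f x - objective f xs) := by
  obtain ⟨y, rfl⟩ := hacc
  have hs : 0 < Θ + θ := by linarith
  have h1 := H.strong.combo_le H.τ_pos.le (r := Θ / (Θ + θ)) (s := θ / (Θ + θ)) (by positivity)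
    (by positivity) (by field_simp) y x
  have e1 : (1 / (Θ + θ)) • (Θ • y + θ • x) = (Θ / (Θ + θ)) • y + (θ / (Θ + θ)) • x := by
    rw [smul_add, smul_smul, smul_smul, one_div_mul_eq_div, one_div_mul_eq_div]
  have e2 : Θ * objective f ((1 / Θ) • (Θ • y)) = Θ * objective f y := by
    rcases hΘ.eq_or_lt with h | h
    · rw [← h]; simp
    · rw [smul_smul, one_div_mul_cancel h.ne', one_smul]
  rw [e1, mul_sub, mul_sub, mul_sub, e2]
  have h2 := mul_le_mul_of_nonneg_left h1 hs.le
  have e3 : (Θ + θ) * (Θ / (Θ + θ) * objective f y + θ / (Θ + θ) * objective f x)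
      = Θ * objective f y + θ * objective f x := by field_simp
  rw [e3] at h2
  linarith

lemma innerStep_potential (H : Admissible a f K lo xs L τ D κ) {D₀ : ℝ} (hD : 0 < D₀) {s t : ℕ}
    (hs : 1 ≤ s) (ht : t < scT n s) {xt gt : Vec d}
    (hgt : gt = (1 / (n : ℝ)) • ∑ i, est a (f i) xt) {z : Inner d} {q : ℕ} {B : ℝ}
    (hz : InnerInv a K (thetaSum a n L τ s t) q B z) :
    (1 / (n : ℝ)) * ∑ i, innerPotential a L τ f xs s (t + 1)
        (innerStep a (scParams a n L τ D₀) τ f lo s (t + 1) xt gt z i)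
      ≤ innerPotential a L τ f xs s t z + (1 + scBeta a n L τ s) ^ t
        * (1 / 2 * (objective f xt - objective f xs)
          + scRatio a n L τ s * scEta a n L τ D₀ s + stepError L τ κ) := by
  have hn : 0 < n := NeZero.pos n
  have hnr : (0 : ℝ) < n := Nat.cast_pos.2 hn
  have hα := scAlpha_pos (a := a) (s := s) H.L_pos H.τ_pos hn
  have hα2 := scAlpha_le_half (a := a) (n := n) (L := L) (τ := τ) (s := s)
  have hγ := scGamma_pos (a := a) (s := s) H.L_pos H.τ_pos hn
  have hη := scEta_pos (a := a) (s := s) H.L_pos H.τ_pos hn hs hD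
  have hM : 0 ≤ scGamma a n L τ s * τ := (mul_pos hγ H.τ_pos).le
  have hβ := scBeta_pos (a := a) (s := s) H.L_pos H.τ_pos hn
  have hw := scRatio_pos (a := a) (s := s) H.L_pos H.τ_pos hn
  have hcase : (κ = 0 ∧ (coef a - 1) / 2 = 1 ∧ scBeta a n L τ s = scGamma a n L τ s * τ) ∨
      ((coef a - 1) / 2 = 2 ∧ scBeta a n L τ s = scGamma a n L τ s * τ / 2) := by
    cases a with
    | first => exact Or.inl ⟨H.err_first rfl, by norm_num [coef], rfl⟩
    | zeroth μ => exact Or.inr ⟨by norm_num [coef], rfl⟩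
  set st := innerStep a (scParams a n L τ D₀) τ f lo s (t + 1) xt gt z with hst
  set α := scAlpha a n L τ s with hαdef
  set γ := scGamma a n L τ s with hγdef
  set β := scBeta a n L τ s with hβdef
  set η := scEta a n L τ D₀ s with hηdef
  set w := scRatio a n L τ s with hwdef
  set xu : Vec d := (1 / (1 + τ * γ * (1 - α))) •
    (((1 + τ * γ) * (1 - α - 1 / 2)) • z.xbar + α • z.x + ((1 + τ * γ) * (1 / 2)) • xt) with hxu
  have hxu' := extrapolated_eq (α := α) (β := τ * γ) hα2 (mul_pos H.τ_pos hγ).le hxu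
  have key := step_average (v := xs) (x := fun i => (st i).x) (xb' := fun i => (st i).xbar)
    (G := fun i => est a (f i) xu - est a (f i) xt + gt) (η := η) (w := w)
    a H.L_pos H.τ_pos H.smooth H.convex H.strong H.err hcase hα hα2 hγ
    (scRatio_mul H.L_pos H.τ_pos hn) (by rw [hwdef, scRatio]; ring) hgt (fun i => rfl)
    (fun i => inner_hGrad_condG_le H.oracle _ _ _ _ _ H.convexSet H.diam hz.x_mem hM hη H.mem)
    hxu' (fun i => rfl)
  have hθ := scTheta_pos (a := a) (s := s) H.L_pos H.τ_pos hn t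
  have hΘ := thetaSum_nonneg (a := a) H.L_pos H.τ_pos hn s t
  have hpoint : ∀ i, innerPotential a L τ f xs s (t + 1) (st i)
      ≤ thetaSum a n L τ s t
        * (objective f ((1 / thetaSum a n L τ s t) • z.acc) - objective f xs)
        + (1 + β) ^ t * (objective f (st i).xbar - objective f xs
          + w * ((1 + β) / 2 * ‖(st i).x - xs‖ ^ 2)) := by
    intro i
    have h1 := average_gap_le H hΘ hθ (x := (st i).xbar) (hz.acc_mem.imp fun _ h => h.2)
    have e1 : (st i).acc = z.acc + scTheta a n L τ s (t + 1) • (st i).xbar := rfl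
    have h2 := scTheta_add_scCarry (a := a) (n := n) (L := L) (τ := τ) (s := s) t
    unfold innerPotential
    rw [thetaSum_succ, e1, ← hβdef, ← hwdef]
    rw [← hβdef] at h2
    have e2 : (1 + β) ^ t * (objective f (st i).xbar - objective f xs
          + w * ((1 + β) / 2 * ‖(st i).x - xs‖ ^ 2))
        = scTheta a n L τ s (t + 1) * (objective f (st i).xbar - objective f xs)
        + scCarry a n L τ s (t + 1) * (objective f (st i).xbar - objective f xs)
        + w * (1 + β) ^ (t + 1) * (1 / 2 * ‖(st i).x - xs‖ ^ 2) := by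
      rw [mul_add, ← add_mul, h2]; ring
    rw [e2]
    linarith
  obtain ⟨P, hP⟩ : ∃ P, P = thetaSum a n L τ s t
      * (objective f ((1 / thetaSum a n L τ s t) • z.acc) - objective f xs) := ⟨_, rfl⟩
  rw [← hP] at hpoint
  have hsum := mul_le_mul_of_nonneg_left (Finset.sum_le_sum (s := Finset.univ)
    fun i _ => hpoint i) (by positivity : (0 : ℝ) ≤ 1 / n)
  refine hsum.trans ?_
  rw [Finset.sum_add_distrib, ← Finset.mul_sum, Finset.sum_const, Finset.card_univ,
    Fintype.card_fin, nsmul_eq_mul, mul_add, ← mul_assoc, one_div_mul_cancel hnr.ne', one_mul,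
    mul_left_comm (1 / (n : ℝ))]
  have key' := mul_le_mul_of_nonneg_left key (by positivity : (0 : ℝ) ≤ (1 + β) ^ t)
  refine (add_le_add_right key' _).trans (le_of_eq ?_)
  unfold innerPotential stepError
  rw [hP, scCarry, if_pos ht, ← hβdef, ← hwdef, ← hαdef]
  ring

lemma support_innerLoop_finite (P : Params) (s : ℕ) (xt gt : Vec d) (z₀ : Inner d) (t : ℕ) :
    (innerLoop a P τ f lo s xt gt z₀ t).support.Finite := by
  induction t with
  | zero => simp [innerLoop]
  | succ t ih =>
    exact support_bind_finite _ _ ih fun z _ => support_map_finite _ _ (Set.toFinite _)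

lemma innerLoop_inv (H : Admissible a f K lo xs L τ D κ) {D₀ : ℝ} (hD : 0 < D₀) {s : ℕ}
    (hs : 1 ≤ s) {xt gt : Vec d} (hxt : xt ∈ K) {z₀ : Inner d} {q : ℕ} {B : ℝ}
    (hz₀ : InnerInv a K 0 q B z₀) (t : ℕ) :
    ∀ z ∈ (innerLoop a (scParams a n L τ D₀) τ f lo s xt gt z₀ t).support,
      InnerInv a K (thetaSum a n L τ s t) (q + t * (2 * estCost d a))
        (B + t * callBound a n L τ D D₀ s) z := by
  induction t with
  | zero =>
    intro z hz
    simp only [innerLoop, PMF.support_pure, Set.mem_singleton_iff] at hz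
    subst hz
    simpa [thetaSum] using hz₀
  | succ t ih =>
    intro z hz
    simp only [innerLoop, PMF.support_bind, PMF.support_map, Set.mem_iUnion, Set.mem_image] at hz
    obtain ⟨z', hz', i, _, rfl⟩ := hz
    have := innerStep_inv H hD hs hxt (gt := gt) (ih z' hz') i
    convert this using 1
    · ring
    · push_cast; ring

lemma expect_innerLoop_le (H : Admissible a f K lo xs L τ D κ) {D₀ : ℝ} (hD : 0 < D₀) {s : ℕ}
    (hs : 1 ≤ s) {xt gt : Vec d} (hxt : xt ∈ K)
    (hgt : gt = (1 / (n : ℝ)) • ∑ i, est a (f i) xt) {z₀ : Inner d} {q : ℕ} {B : ℝ}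
    (hz₀ : InnerInv a K 0 q B z₀) {t : ℕ} (ht : t ≤ scT n s) :
    expect (innerLoop a (scParams a n L τ D₀) τ f lo s xt gt z₀ t)
        (innerPotential a L τ f xs s t)
      ≤ innerPotential a L τ f xs s 0 z₀ + (∑ j ∈ Finset.range t, (1 + scBeta a n L τ s) ^ j)
        * (1 / 2 * (objective f xt - objective f xs)
          + scRatio a n L τ s * scEta a n L τ D₀ s + stepError L τ κ) := by
  induction t with
  | zero => simp [innerLoop, expect_pure]
  | succ t ih =>
    have hfin := support_innerLoop_finite (a := a) (f := f) (lo := lo) (τ := τ)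
      (scParams a n L τ D₀) s xt gt z₀ t
    rw [innerLoop, expect_bind _ _ hfin fun z _ => support_map_finite _ _ (Set.toFinite _)]
    simp_rw [expect_map _ _ (Set.toFinite (PMF.uniformOfFintype (Fin n)).support)]
    refine (expect_mono _ hfin (ψ := fun z => innerPotential a L τ f xs s t z
      + (1 + scBeta a n L τ s) ^ t * (1 / 2 * (objective f xt - objective f xs)
          + scRatio a n L τ s * scEta a n L τ D₀ s + stepError L τ κ)) ?_).trans ?_
    · intro z hz
      rw [expect_uniform]
      exact innerStep_potential H hD hs (by omega) hgt (innerLoop_inv H hD hs hxt hz₀ t z hz)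
    · rw [expect_add _ hfin, expect_const, Finset.sum_range_succ]
      have := ih (by omega)
      linarith

/-- The weight `∑_{t < T} Γ_t` of epoch `s`. -/
def gammaSum (a : Access) (n : ℕ) (L τ : ℝ) (s : ℕ) : ℝ :=
  ∑ j ∈ Finset.range (scT n s), (1 + scBeta a n L τ s) ^ j

/-- What holds on every sample path between epochs. -/
structure StateInv (K : Set (Vec d)) (q : ℕ) (B : ℝ) (st : State d) : Prop where
  x_mem : st.x ∈ K
  xt_mem : st.xt ∈ K
  queries_eq : st.queries = q
  calls : AtMost st.loCalls B

omit [NeZero n] in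
lemma StateInv.inner {q : ℕ} {B : ℝ} {st : State d} (h : StateInv K q B st) :
    InnerInv a K 0 (q + n * estCost d a) B
      { x := st.x, xbar := st.xt, acc := 0, queries := st.queries + n * estCost d a
        loCalls := st.loCalls } :=
  ⟨h.x_mem, h.xt_mem, ⟨st.x, h.x_mem, (zero_smul _ _).symm⟩, by rw [h.queries_eq], h.calls⟩

lemma thetaSum_scT_pos (hL : 0 < L) (hτ : 0 < τ) (s : ℕ) :
    0 < thetaSum a n L τ s (scT n s) := by
  obtain ⟨m, hm⟩ : ∃ m, scT n s = m + 1 :=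
    ⟨scT n s - 1, by have := scT_pos (n := n) (s := s); omega⟩
  rw [hm, thetaSum_succ]
  linarith [thetaSum_nonneg (a := a) hL hτ (NeZero.pos n) s m,
    scTheta_pos (a := a) (s := s) hL hτ (NeZero.pos n) m]

lemma support_epoch_finite (P : Params) (s : ℕ) (st : State d) :
    (epoch a P τ f lo s st).support.Finite :=
  support_map_finite _ _ (support_innerLoop_finite _ _ _ _ _ _)

lemma epoch_inv (H : Admissible a f K lo xs L τ D κ) {D₀ : ℝ} (hD : 0 < D₀) {s : ℕ}
    (hs : 1 ≤ s) {st : State d} {q : ℕ} {B : ℝ} (h : StateInv K q B st) :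
    ∀ st' ∈ (epoch a (scParams a n L τ D₀) τ f lo s st).support,
      StateInv K (q + (n + 2 * scT n s) * estCost d a)
        (B + scT n s * callBound a n L τ D D₀ s) st' := by
  intro st' hst'
  simp only [epoch, PMF.support_map, Set.mem_image] at hst'
  obtain ⟨z, hz, rfl⟩ := hst'
  have hz' := innerLoop_inv H hD hs h.xt_mem h.inner _ z hz
  obtain ⟨y, hy, hacc⟩ := hz'.acc_mem
  refine ⟨hz'.x_mem, ?_, ?_, hz'.calls⟩
  · change (1 / thetaSum a n L τ s (scT n s)) • z.acc ∈ K
    have : z.acc = thetaSum a n L τ s (scT n s) • y := hacc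
    rw [this, smul_smul, one_div_mul_cancel (thetaSum_scT_pos H.L_pos H.τ_pos s).ne', one_smul]
    exact hy
  · have : z.queries = q + n * estCost d a + scT n s * (2 * estCost d a) := hz'.queries_eq
    rw [this]; ring

/-- The progress of one epoch from a given state. -/
lemma expect_epoch_le (H : Admissible a f K lo xs L τ D κ) {D₀ : ℝ} (hD : 0 < D₀) {s : ℕ}
    (hs : 1 ≤ s) {st : State d} {q : ℕ} {B : ℝ} (h : StateInv K q B st) :
    expect (epoch a (scParams a n L τ D₀) τ f lo s st) (fun st' =>
        thetaSum a n L τ s (scT n s) * (objective f st'.xt - objective f xs)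
        + scRatio a n L τ s * (1 + scBeta a n L τ s) ^ scT n s * (1 / 2 * ‖st'.x - xs‖ ^ 2))
      ≤ (1 / 2 - scAlpha a n L τ s + gammaSum a n L τ s / 2)
          * (objective f st.xt - objective f xs)
        + scRatio a n L τ s * (1 / 2 * ‖st.x - xs‖ ^ 2)
        + gammaSum a n L τ s
          * (scRatio a n L τ s * scEta a n L τ D₀ s + stepError L τ κ) := by
  have := expect_innerLoop_le H hD hs h.xt_mem rfl (h.inner (a := a) (n := n)) le_rfl
  rw [epoch, expect_map _ _ (support_innerLoop_finite _ _ _ _ _ _)]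
  have e1 : ∀ z : Inner d, innerPotential a L τ f xs s (scT n s) z
      = thetaSum a n L τ s (scT n s)
        * (objective f ((1 / thetaSum a n L τ s (scT n s)) • z.acc) - objective f xs)
        + scRatio a n L τ s * (1 + scBeta a n L τ s) ^ scT n s * (1 / 2 * ‖z.x - xs‖ ^ 2) := by
    intro z
    simp [innerPotential, scCarry]
  rw [funext e1] at this
  refine le_trans (le_of_eq ?_) (this.trans (le_of_eq ?_))
  · rfl
  · have hT : 0 < scT n s := scT_pos
    simp only [innerPotential, scCarry, if_pos hT, thetaSum, gammaSum, pow_zero]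
    simp
    ring

end Epoch

/-! ### The law of the method after several epochs -/

section Run

variable {d n : ℕ} [NeZero n] {a : Access} {f : Fin n → Vec d → ℝ} {K : Set (Vec d)}
  {lo : Vec d → Vec d} {x₀ xs : Vec d} {L τ D κ D₀ : ℝ}

lemma support_scRun_finite (S : ℕ) : (scRun a L τ D₀ f lo x₀ S).support.Finite := by
  unfold scRun
  induction S with
  | zero => simp [run]
  | succ S ih => exact support_bind_finite _ _ ih fun st _ => support_epoch_finite _ _ _

lemma scRun_inv (H : Admissible a f K lo xs L τ D κ) (hD : 0 < D₀) (hx₀ : x₀ ∈ K) (S : ℕ) :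
    ∀ st ∈ (scRun a L τ D₀ f lo x₀ S).support,
      StateInv K (∑ s ∈ Finset.range S, (n + 2 * scT n (s + 1)) * estCost d a)
        (∑ s ∈ Finset.range S, scT n (s + 1) * callBound a n L τ D D₀ (s + 1)) st := by
  unfold scRun
  induction S with
  | zero =>
    intro st hst
    simp only [run, PMF.support_pure, Set.mem_singleton_iff] at hst
    subst hst
    exact ⟨hx₀, hx₀, by simp, 0, by simp, by simp⟩
  | succ S ih =>
    intro st hst
    simp only [run, PMF.support_bind, Set.mem_iUnion] at hst
    obtain ⟨st', hst', h⟩ := hst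
    rw [Finset.sum_range_succ, Finset.sum_range_succ]
    exact epoch_inv H hD (by omega) (ih st' hst') st h

/-- The expected optimality gap of `x̃^S`. -/
def gapSeq (a : Access) (L τ D₀ : ℝ) (f : Fin n → Vec d → ℝ) (lo : Vec d → Vec d)
    (x₀ xs : Vec d) (S : ℕ) : ℝ :=
  expect (scRun a L τ D₀ f lo x₀ S) fun st => objective f st.xt - objective f xs

/-- Half of the expected squared distance of `x^S` to the minimizer. -/
def distSeq (a : Access) (L τ D₀ : ℝ) (f : Fin n → Vec d → ℝ) (lo : Vec d → Vec d)
    (x₀ xs : Vec d) (S : ℕ) : ℝ :=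
  expect (scRun a L τ D₀ f lo x₀ S) fun st => 1 / 2 * ‖st.x - xs‖ ^ 2

/-- The progress of one epoch as a recursion for two real sequences: `A` stands for the expected
gap, `R` for half the expected squared distance to the minimizer, `E` for the error of the gradient
estimator in one inner iteration. -/
structure EpochRecursion (a : Access) (n : ℕ) (L τ D₀ E : ℝ) (A R : ℕ → ℝ) : Prop where
  A_nonneg : ∀ s, 0 ≤ A s
  R_nonneg : ∀ s, 0 ≤ R s
  initial : 4 * A 0 + 2 * coef a * L * R 0 = D₀
  step : ∀ s, thetaSum a n L τ (s + 1) (scT n (s + 1)) * A (s + 1)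
      + scRatio a n L τ (s + 1) * (1 + scBeta a n L τ (s + 1)) ^ scT n (s + 1) * R (s + 1)
    ≤ (1 / 2 - scAlpha a n L τ (s + 1) + gammaSum a n L τ (s + 1) / 2) * A s
      + scRatio a n L τ (s + 1) * R s
      + gammaSum a n L τ (s + 1)
        * (scRatio a n L τ (s + 1) * scEta a n L τ D₀ (s + 1) + E)

lemma epochRecursion (H : Admissible a f K lo xs L τ D κ) (hD : 0 < D₀) (hx₀ : x₀ ∈ K)
    (hD₀ : D₀ = initGap a L (objective f) x₀ xs) :
    EpochRecursion a n L τ D₀ (stepError L τ κ) (gapSeq a L τ D₀ f lo x₀ xs)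
      (distSeq a L τ D₀ f lo x₀ xs) where
  A_nonneg s := expect_nonneg _ fun st hst =>
    sub_nonneg.2 (H.min _ (scRun_inv H hD hx₀ s st hst).xt_mem)
  R_nonneg s := expect_nonneg _ fun st _ => by positivity
  initial := by
    rw [hD₀]
    simp only [gapSeq, distSeq, scRun, run, expect_pure, initGap]
    ring
  step s := by
    have hfin := support_scRun_finite (a := a) (f := f) (lo := lo) (x₀ := x₀) (L := L) (τ := τ)
      (D₀ := D₀) s
    have hinv := scRun_inv H hD hx₀ s
    have hmono := expect_mono _ hfin fun st hst =>
      expect_epoch_le H hD (s := s + 1) (by omega) (hinv st hst)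
    have hsucc : ∀ φ : State d → ℝ, expect (scRun a L τ D₀ f lo x₀ (s + 1)) φ
        = expect (scRun a L τ D₀ f lo x₀ s) fun st =>
          expect (epoch a (scParams a n L τ D₀) τ f lo (s + 1) st) φ := fun φ =>
      expect_bind _ _ hfin (fun st _ => support_epoch_finite _ _ _) φ
    rw [← hsucc, expect_add _ (support_scRun_finite _), expect_add _ hfin, expect_add _ hfin,
      expect_const] at hmono
    simp only [gapSeq, distSeq, expect_const_mul] at hmono ⊢
    exact hmono

end Run

/-! ### Rates of convergence -/

section Rates

variable {a : Access} {n : ℕ} {L τ D₀ E : ℝ} {A R : ℕ → ℝ} {s : ℕ}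

lemma thetaSum_scT (s : ℕ) :
    thetaSum a n L τ s (scT n s)
      = gammaSum a n L τ s - (1 / 2 - scAlpha a n L τ s) * (gammaSum a n L τ s - 1) := by
  obtain ⟨m, hm⟩ : ∃ m, scT n s = m + 1 :=
    ⟨scT n s - 1, by have := scT_pos (n := n) (s := s); omega⟩
  have h : ∀ t ≤ m, thetaSum a n L τ s t = ∑ j ∈ Finset.range t, (1 + scBeta a n L τ s) ^ j
      - (1 / 2 - scAlpha a n L τ s) *
        ∑ j ∈ Finset.range t, (1 + scBeta a n L τ s) ^ (j + 1) := by
    intro t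
    induction t with
    | zero => simp [thetaSum]
    | succ t ih =>
      intro ht
      have h1 := scTheta_add_scCarry (a := a) (n := n) (L := L) (τ := τ) (s := s) t
      rw [scCarry, if_pos (by omega)] at h1
      rw [thetaSum_succ, ih (by omega), Finset.sum_range_succ, Finset.sum_range_succ]
      linarith
  have h1 := scTheta_add_scCarry (a := a) (n := n) (L := L) (τ := τ) (s := s) m
  rw [scCarry, if_neg (by omega), add_zero] at h1
  rw [gammaSum, hm, thetaSum_succ, h m le_rfl, h1]
  have e := Finset.sum_range_succ' (fun j => (1 + scBeta a n L τ s) ^ j) m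
  nth_rewrite 2 [e]
  rw [Finset.sum_range_succ]
  simp
  ring

lemma natCast_scT_le_gammaSum (hL : 0 < L) (hτ : 0 < τ) (hn : 0 < n) (s : ℕ) :
    (scT n s : ℝ) ≤ gammaSum a n L τ s := by
  have hβ := scBeta_pos (a := a) (s := s) hL hτ hn
  have : ∑ _j ∈ Finset.range (scT n s), (1 : ℝ) ≤ gammaSum a n L τ s :=
    Finset.sum_le_sum fun j _ => one_le_pow₀ (by linarith)
  simpa using this

lemma gammaSum_le (hL : 0 < L) (hτ : 0 < τ) (hn : 0 < n) (s : ℕ) :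
    gammaSum a n L τ s ≤ scT n s * (1 + scBeta a n L τ s) ^ scT n s := by
  have hβ := scBeta_pos (a := a) (s := s) hL hτ hn
  have : gammaSum a n L τ s
      ≤ ∑ _j ∈ Finset.range (scT n s), (1 + scBeta a n L τ s) ^ scT n s :=
    Finset.sum_le_sum fun j hj =>
      pow_le_pow_right₀ (by linarith) (Finset.mem_range.1 hj).le
  simpa using this

lemma gammaSum_pos (hL : 0 < L) (hτ : 0 < τ) (hn : 0 < n) (s : ℕ) : 0 < gammaSum a n L τ s :=
  lt_of_lt_of_le (Nat.cast_pos.2 scT_pos) (natCast_scT_le_gammaSum hL hτ hn s)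

lemma scBeta_congr {s' : ℕ} (h : scAlpha a n L τ s = scAlpha a n L τ s') :
    scBeta a n L τ s = scBeta a n L τ s' := by
  cases a <;> simp only [scBeta, scGamma, h]

lemma two_mul_gammaSum_le (hL : 0 < L) (hτ : 0 < τ) (hn : 0 < n) (h1 : 1 ≤ s)
    (hs : s + 1 ≤ sZero n) : 2 * gammaSum a n L τ s ≤ gammaSum a n L τ (s + 1) := by
  have hβ := scBeta_pos (a := a) (s := s) hL hτ hn
  have e1 : scBeta a n L τ (s + 1) = scBeta a n L τ s :=
    scBeta_congr (by rw [scAlpha_eq_half hL hτ (Or.inl hs),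
      scAlpha_eq_half hL hτ (Or.inl (by omega))])
  have e2 : scT n (s + 1) = scT n s + scT n s := by
    rw [scT, if_pos hs, scT, if_pos (by omega), ← two_mul, ← pow_succ']
    congr 1; omega
  rw [gammaSum, gammaSum, e1, e2, Finset.sum_range_add, two_mul]
  gcongr with j _
  · linarith
  · omega

lemma EpochRecursion.D₀_nonneg (h : EpochRecursion a n L τ D₀ E A R) (hL : 0 < L) : 0 ≤ D₀ := by
  rw [← h.initial]
  have := coef_pos a
  have := h.A_nonneg 0
  have := h.R_nonneg 0
  positivity

/-- The quantity that is halved, up to the errors, by each of the first `s₀` epochs. -/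
def doublingPotential (a : Access) (n : ℕ) (L τ : ℝ) (A R : ℕ → ℝ) (s : ℕ) : ℝ :=
  A s + coef a * L / 4 * ((1 + scBeta a n L τ s) ^ scT n s / gammaSum a n L τ s) * R s

/-- In one of the first `s₀` epochs, `α = p = 1/2` and the recursion can be divided by `∑ Γ_t`. -/
lemma EpochRecursion.step_doubling (h : EpochRecursion a n L τ D₀ E A R) (hL : 0 < L) (hτ : 0 < τ)
    (hn : 0 < n) (hs : s + 1 ≤ sZero n) :
    doublingPotential a n L τ A R (s + 1) ≤ A s / 2
      + coef a * L / 4 * (R s / gammaSum a n L τ (s + 1))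
      + coef a * D₀ / (4 * (s + 1) * 2 ^ s) + E := by
  have hW := gammaSum_pos (a := a) hL hτ hn (s + 1)
  have hα : scAlpha a n L τ (s + 1) = 1 / 2 := scAlpha_eq_half hL hτ (Or.inl hs)
  have hw : scRatio a n L τ (s + 1) = coef a * L / 4 := by rw [scRatio, hα]; ring
  have hstep := h.step s
  rw [thetaSum_scT, hα, hw] at hstep
  have hη : coef a * L / 4 * scEta a n L τ D₀ (s + 1)
      = coef a * D₀ / (4 * (s + 1) * 2 ^ s) := by
    rw [scEta, if_pos hs, scT, if_pos hs]
    push_cast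
    field_simp
  rw [hη] at hstep
  unfold doublingPotential
  set W := gammaSum a n L τ (s + 1)
  set G := (1 + scBeta a n L τ (s + 1)) ^ scT n (s + 1)
  refine le_of_mul_le_mul_left ?_ hW
  have e1 : W * (A (s + 1) + coef a * L / 4 * (G / W) * R (s + 1))
      = W * A (s + 1) + coef a * L / 4 * G * R (s + 1) := by field_simp
  have e2 : W * (A s / 2 + coef a * L / 4 * (R s / W) + coef a * D₀ / (4 * (s + 1) * 2 ^ s) + E)
      = W / 2 * A s + coef a * L / 4 * R s + W * (coef a * D₀ / (4 * (s + 1) * 2 ^ s) + E) := by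
    field_simp
    ring
  rw [e1, e2]
  linarith

lemma EpochRecursion.doublingPotential_le (h : EpochRecursion a n L τ D₀ E A R) (hL : 0 < L)
    (hτ : 0 < τ) (hn : 0 < n) (s : ℕ) (hs : s + 1 ≤ sZero n) :
    2 ^ (s + 1) * doublingPotential a n L τ A R (s + 1)
      ≤ D₀ / 4 + coef a / 2 * D₀ * (harmonic (s + 1) : ℝ) + (2 ^ (s + 2) - 2) * E := by
  have hc := coef_pos a
  induction s with
  | zero =>
    have h1 := h.step_doubling hL hτ hn hs
    have hW : gammaSum a n L τ (0 + 1) = 1 := by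
      rw [gammaSum, scT, if_pos hs]; simp
    rw [hW] at h1
    have h0 := h.initial
    simp only [harmonic_succ, harmonic_zero]
    norm_num at h1 ⊢
    linarith
  | succ s ih =>
    have ih := ih (by omega)
    have h1 := h.step_doubling hL hτ hn hs
    have hW := gammaSum_pos (a := a) hL hτ hn (s + 1)
    have hβ := scBeta_pos (a := a) (s := s + 1) hL hτ hn
    have hR : R (s + 1) / gammaSum a n L τ (s + 1 + 1)
        ≤ (1 + scBeta a n L τ (s + 1)) ^ scT n (s + 1) / gammaSum a n L τ (s + 1)
          * R (s + 1) / 2 := by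
      have h2 := two_mul_gammaSum_le (a := a) hL hτ hn (s := s + 1) (by omega) hs
      have h3 : (1 : ℝ) ≤ (1 + scBeta a n L τ (s + 1)) ^ scT n (s + 1) :=
        one_le_pow₀ (by linarith)
      have h4 := h.R_nonneg (s + 1)
      calc R (s + 1) / gammaSum a n L τ (s + 1 + 1)
          ≤ R (s + 1) / (2 * gammaSum a n L τ (s + 1)) := by gcongr
        _ = 1 / gammaSum a n L τ (s + 1) * R (s + 1) / 2 := by field_simp
        _ ≤ _ := by gcongr
    have hR' := mul_le_mul_of_nonneg_left hR (by positivity : 0 ≤ coef a * L / 4)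
    have h5 : doublingPotential a n L τ A R (s + 1 + 1)
        ≤ doublingPotential a n L τ A R (s + 1) / 2
          + coef a * D₀ / (4 * ((s + 1 : ℕ) + 1) * 2 ^ (s + 1)) + E := by
      unfold doublingPotential at h1 ⊢
      linarith
    have h6 := mul_le_mul_of_nonneg_left h5 (by positivity : (0 : ℝ) ≤ 2 ^ (s + 1 + 1))
    have h7 : (2 : ℝ) ^ (s + 1 + 1) * (coef a * D₀ / (4 * ((s + 1 : ℕ) + 1) * 2 ^ (s + 1)))
        = coef a / 2 * D₀ * (((s + 1 : ℕ) : ℝ) + 1)⁻¹ := by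
      rw [pow_succ]; field_simp; ring
    rw [harmonic_succ]
    push_cast at *
    rw [mul_add, mul_add, h7] at h6
    have h8 : (2 : ℝ) ^ (s + 1 + 2) = 2 * 2 ^ (s + 2) := by ring
    have h9 : (2 : ℝ) ^ (s + 1 + 1) = 2 ^ (s + 2) := by ring
    rw [h8]
    rw [h9] at h6 ⊢
    have h10 : (2 : ℝ) ^ (s + 2) * (doublingPotential a n L τ A R (s + 1) / 2)
        = 2 ^ (s + 1) * doublingPotential a n L τ A R (s + 1) := by ring
    rw [h10] at h6
    linarith

lemma EpochRecursion.le_doublingPotential (h : EpochRecursion a n L τ D₀ E A R) (hL : 0 < L)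
    (hτ : 0 < τ) (hn : 0 < n) (s : ℕ) : A s ≤ doublingPotential a n L τ A R s := by
  have hc := coef_pos a
  have hW := gammaSum_pos (a := a) hL hτ hn s
  have hβ := scBeta_pos (a := a) (s := s) hL hτ hn
  have := h.R_nonneg s
  unfold doublingPotential
  have : 0 ≤ coef a * L / 4 * ((1 + scBeta a n L τ s) ^ scT n s / gammaSum a n L τ s) * R s := by
    positivity
  linarith

/-- The expected gap in the first `s₀` epochs. -/
lemma EpochRecursion.gap_le_first (h : EpochRecursion a n L τ D₀ E A R) (hL : 0 < L)
    (hτ : 0 < τ) (hn : 0 < n) (hE : 0 ≤ E) (h1 : 1 ≤ s) (hs : s ≤ sZero n) :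
    A s ≤ D₀ / 2 ^ s * (1 / 4 + coef a / 2 * (1 + Real.log s)) + 2 * E := by
  have hc := coef_pos a
  have hD := h.D₀_nonneg hL
  obtain ⟨s, rfl⟩ : ∃ t, s = t + 1 := ⟨s - 1, by omega⟩
  have h2 := h.doublingPotential_le hL hτ hn s hs
  have h3 := h.le_doublingPotential hL hτ hn (s + 1)
  have h4 := harmonic_le_one_add_log (s + 1)
  have h5 : coef a / 2 * D₀ * (harmonic (s + 1) : ℝ)
      ≤ coef a / 2 * D₀ * (1 + Real.log (s + 1 : ℕ)) := by gcongr
  have hp : (0 : ℝ) < 2 ^ (s + 1) := by positivity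
  refine le_of_mul_le_mul_left ?_ hp
  have h6 := mul_le_mul_of_nonneg_left h3 hp.le
  have e : (2 : ℝ) ^ (s + 1) * (D₀ / 2 ^ (s + 1)
      * (1 / 4 + coef a / 2 * (1 + Real.log (s + 1 : ℕ))) + 2 * E)
      = D₀ / 4 + coef a / 2 * D₀ * (1 + Real.log (s + 1 : ℕ)) + 2 ^ (s + 2) * E := by
    field_simp; ring
  rw [e]
  linarith

/-- The factor by which the error decreases in each epoch after the first `s₀`. -/
def rate (a : Access) (n : ℕ) (L τ : ℝ) : ℝ :=
  if sigma a L τ ≤ n then 9 / 8 else (1 + scBeta a n L τ (sZero n + 1)) ^ scT n (sZero n + 1)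

lemma scAlpha_late (hs : sZero n < s) :
    scAlpha a n L τ s = scAlpha a n L τ (sZero n + 1) := by
  rw [scAlpha, if_neg (not_le.2 hs), scAlpha, if_neg (by omega)]

lemma scBeta_late (hs : sZero n < s) : scBeta a n L τ s = scBeta a n L τ (sZero n + 1) :=
  scBeta_congr (scAlpha_late hs)

lemma scRatio_late (hs : sZero n < s) : scRatio a n L τ s = scRatio a n L τ (sZero n + 1) := by
  rw [scRatio, scAlpha_late hs, scRatio]

lemma scT_late (hs : sZero n < s) : scT n s = scT n (sZero n + 1) := by
  rw [scT_of_le hs.le, scT_of_le (by omega)]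

lemma gammaSum_late (hs : sZero n < s) :
    gammaSum a n L τ s = gammaSum a n L τ (sZero n + 1) := by
  rw [gammaSum, scT_late hs, scBeta_late hs, gammaSum]

/-- If `n < ς` then one epoch after the first `s₀` contracts by at least `1 + α / 4`. -/
lemma one_add_scAlpha_le_rate (hL : 0 < L) (hτ : 0 < τ) (hn : 0 < n)
    (h : (n : ℝ) < sigma a L τ) : 1 + scAlpha a n L τ (sZero n + 1) / 4 ≤ rate a n L τ := by
  rw [rate, if_neg (not_le.2 h)]
  have hβ := scBeta_pos (a := a) (s := sZero n + 1) hL hτ hn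
  have h1 := scGamma_mul_nat (a := a) hL hτ hn (Nat.lt_succ_self (sZero n)) h
  have h2 := le_scBeta (a := a) (s := sZero n + 1) hL hτ hn
  have h3 : (n : ℝ) < 2 * scT n (sZero n + 1) := by
    exact_mod_cast lt_two_mul_scT (n := n) (s := sZero n + 1) (by omega)
  have h4 := one_add_mul_le_pow (a := scBeta a n L τ (sZero n + 1)) (by linarith)
    (scT n (sZero n + 1))
  refine le_trans ?_ h4
  have h5 : scBeta a n L τ (sZero n + 1) * n
      ≤ scBeta a n L τ (sZero n + 1) * (2 * scT n (sZero n + 1)) := by gcongr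
  have hn' : (0 : ℝ) < n := Nat.cast_pos.2 hn
  have h6 := mul_le_mul_of_nonneg_right h2 hn'.le
  change scGamma a n L τ (sZero n + 1) * τ * n = scAlpha a n L τ (sZero n + 1) at h1
  nlinarith

lemma one_lt_rate (hL : 0 < L) (hτ : 0 < τ) (hn : 0 < n) : 1 < rate a n L τ := by
  by_cases h : sigma a L τ ≤ n
  · rw [rate, if_pos h]; norm_num
  · have := one_add_scAlpha_le_rate hL hτ hn (not_le.1 h)
    have := scAlpha_pos (a := a) (s := sZero n + 1) hL hτ hn
    linarith

lemma rate_le_pow (hL : 0 < L) (hτ : 0 < τ) (hn : 0 < n) :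
    rate a n L τ ≤ (1 + scBeta a n L τ (sZero n + 1)) ^ scT n (sZero n + 1) := by
  rw [rate]
  split_ifs with h
  · have hβ := scBeta_pos (a := a) (s := sZero n + 1) hL hτ hn
    have hσ := sigma_pos a hL hτ
    have h1 := scGamma_mul (a := a) (s := sZero n + 1) hL hτ hn
    rw [scAlpha_eq_half hL hτ (Or.inr h)] at h1
    have h2 := le_scBeta (a := a) (s := sZero n + 1) hL hτ hn
    have h3 : (n : ℝ) < 2 * scT n (sZero n + 1) := by
      exact_mod_cast lt_two_mul_scT (n := n) (s := sZero n + 1) (by omega)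
    have h4 := one_add_mul_le_pow (a := scBeta a n L τ (sZero n + 1)) (by linarith)
      (scT n (sZero n + 1))
    refine le_trans ?_ h4
    have h5 : scBeta a n L τ (sZero n + 1) * sigma a L τ
      ≤ scBeta a n L τ (sZero n + 1) * (2 * scT n (sZero n + 1)) := by
      gcongr; linarith
    have h6 := mul_le_mul_of_nonneg_right h2 hσ.le
    nlinarith
  · exact le_rfl

lemma gammaSum_le_two_mul (hL : 0 < L) (hτ : 0 < τ) (hn : 0 < n) (h : (n : ℝ) < sigma a L τ) :
    gammaSum a n L τ (sZero n + 1) ≤ 2 * scT n (sZero n + 1) - 1 := by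
  have hβ := scBeta_pos (a := a) (s := sZero n + 1) hL hτ hn
  have h1 := scBeta_mul_nat_le (a := a) hL hτ hn (Nat.lt_succ_self (sZero n)) h
  have h2 := scAlpha_le_half (a := a) (n := n) (L := L) (τ := τ) (s := sZero n + 1)
  have hT := scT_le (s := sZero n + 1) hn
  obtain ⟨m, hm⟩ : ∃ m, scT n (sZero n + 1) = m + 1 :=
    ⟨scT n (sZero n + 1) - 1, by have := scT_pos (n := n) (s := sZero n + 1); omega⟩
  have hpow : ∀ j ∈ Finset.range m, (1 + scBeta a n L τ (sZero n + 1)) ^ (j + 1) ≤ 2 := by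
    intro j hj
    have hj' : j + 1 ≤ n := by have := Finset.mem_range.1 hj; omega
    have h3 : (1 + scBeta a n L τ (sZero n + 1)) ^ (j + 1)
        ≤ Real.exp (1 / 2) := by
      calc (1 + scBeta a n L τ (sZero n + 1)) ^ (j + 1)
          ≤ Real.exp (scBeta a n L τ (sZero n + 1)) ^ (j + 1) := by
            gcongr
            linarith [Real.add_one_le_exp (scBeta a n L τ (sZero n + 1))]
        _ = Real.exp ((j + 1 : ℕ) * scBeta a n L τ (sZero n + 1)) := (Real.exp_nat_mul _ _).symm
        _ ≤ Real.exp (1 / 2) := by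
            apply Real.exp_le_exp.2
            have : ((j + 1 : ℕ) : ℝ) ≤ n := by exact_mod_cast hj'
            change scBeta a n L τ (sZero n + 1) * n ≤ scAlpha a n L τ (sZero n + 1) at h1
            nlinarith
    have h4 : Real.exp (1 / 2) ≤ 2 := by
      have h5 : Real.exp (1 / 2) ^ 2 = Real.exp 1 := by
        rw [← Real.exp_nat_mul]; norm_num
      have h6 := Real.exp_one_lt_d9
      have := Real.exp_pos (1 / 2)
      nlinarith
    exact h3.trans h4
  have := Finset.sum_le_sum hpow
  rw [gammaSum, hm, Finset.sum_range_succ']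
  simp at this ⊢
  linarith

/-- The weight of `A s` in the recursion grows by at least `rate` in one epoch. If `n < ς` this is
`β (1/2 - α + W/2) ≤ α`, where `W = ∑ Γ_t ≤ 2T - 1` and `β T ≤ β n ≤ α`. -/
lemma rate_mul_le (hL : 0 < L) (hτ : 0 < τ) (hn : 0 < n) :
    rate a n L τ * (1 / 2 - scAlpha a n L τ (sZero n + 1) + gammaSum a n L τ (sZero n + 1) / 2)
      ≤ thetaSum a n L τ (sZero n + 1) (scT n (sZero n + 1)) := by
  rw [thetaSum_scT]
  have hW := gammaSum_pos (a := a) hL hτ hn (sZero n + 1)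
  by_cases h : sigma a L τ ≤ n
  · rw [rate, if_pos h, scAlpha_eq_half hL hτ (Or.inr h)]
    linarith
  · rw [rate, if_neg h]
    rw [not_le] at h
    have hβ := scBeta_pos (a := a) (s := sZero n + 1) hL hτ hn
    have hα := scAlpha_pos (a := a) (s := sZero n + 1) hL hτ hn
    have h1 := scBeta_mul_nat_le (a := a) hL hτ hn (Nat.lt_succ_self (sZero n)) h
    have h2 := gammaSum_le_two_mul hL hτ hn h
    have hT : (scT n (sZero n + 1) : ℝ) ≤ n := by
      exact_mod_cast scT_le (s := sZero n + 1) hn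
    have hgeom : (1 + scBeta a n L τ (sZero n + 1)) ^ scT n (sZero n + 1)
        = 1 + scBeta a n L τ (sZero n + 1) * gammaSum a n L τ (sZero n + 1) := by
      have := mul_geom_sum (1 + scBeta a n L τ (sZero n + 1)) (scT n (sZero n + 1))
      rw [add_sub_cancel_left] at this
      rw [gammaSum, this]; ring
    rw [hgeom]
    change scBeta a n L τ (sZero n + 1) * n ≤ scAlpha a n L τ (sZero n + 1) at h1
    set β := scBeta a n L τ (sZero n + 1)
    set α := scAlpha a n L τ (sZero n + 1)
    set W := gammaSum a n L τ (sZero n + 1)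
    have h3 : β * (1 / 2 - α + W / 2) ≤ α := by
      have : β * (1 / 2 - α + W / 2) ≤ β * n := by gcongr; linarith
      linarith
    have h4 := mul_le_mul_of_nonneg_left h3 hW.le
    nlinarith

lemma scEta_late_le (hL : 0 < L) (hτ : 0 < τ) (hn : 0 < n) (hD : 0 ≤ D₀) (k : ℕ) :
    rate a n L τ ^ k * scEta a n L τ D₀ (sZero n + k + 1)
      ≤ D₀ / ((sZero n + k + 1 : ℕ) * n * L) := by
  have hn' : (0 : ℝ) < n := Nat.cast_pos.2 hn
  have hg := one_lt_rate (a := a) hL hτ hn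
  rw [scEta, if_neg (by omega)]
  have e1 : sZero n + k + 1 - sZero n - 1 = k := by omega
  rw [e1]
  have hden : (0 : ℝ) < (sZero n + k + 1 : ℕ) * n * L := by positivity
  by_cases h : sigma a L τ ≤ n
  · rw [if_pos h, rate, if_pos h, ← mul_div_assoc, ← mul_assoc, ← mul_pow]
    gcongr
    exact mul_le_of_le_one_left hD (pow_le_one₀ (by norm_num) (by norm_num))
  · rw [if_neg h, scBigGamma_eq, scBeta_late (s := sZero n + k + 1) (by omega)]
    have e2 : (1 + scBeta a n L τ (sZero n + 1)) ^ scT n (sZero n) = rate a n L τ := by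
      rw [rate, if_neg h, scT_sZero, scT_of_le (by omega)]
    rw [e2, ← mul_div_assoc, ← mul_assoc, ← mul_pow, mul_one_div_cancel (by positivity),
      one_pow, one_mul]

/-- The quantity that every epoch after the first `s₀` divides by `rate`, up to the errors. -/
def latePotential (a : Access) (n : ℕ) (L τ : ℝ) (A R : ℕ → ℝ) (s : ℕ) : ℝ :=
  (1 / 2 - scAlpha a n L τ (sZero n + 1) + gammaSum a n L τ (sZero n + 1) / 2) * A s
    + scRatio a n L τ (sZero n + 1) * R s

lemma EpochRecursion.latePotential_le (h : EpochRecursion a n L τ D₀ E A R) (hL : 0 < L)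
    (hτ : 0 < τ) (hn : 0 < n) (k : ℕ) :
    rate a n L τ ^ k * latePotential a n L τ A R (sZero n + k)
      ≤ latePotential a n L τ A R (sZero n)
        + gammaSum a n L τ (sZero n + 1) * (coef a / 4 * (D₀ / n)
          * ((harmonic (sZero n + k) : ℝ) - harmonic (sZero n))
          + E * ∑ j ∈ Finset.range k, rate a n L τ ^ j) := by
  have hc := coef_pos a
  have hn' : (0 : ℝ) < n := Nat.cast_pos.2 hn
  have hD := h.D₀_nonneg hL
  have hW := gammaSum_pos (a := a) hL hτ hn (sZero n + 1)
  have hg := one_lt_rate (a := a) hL hτ hn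
  induction k with
  | zero => simp
  | succ k ih =>
    have hs : sZero n < sZero n + k + 1 := by omega
    have h1 := h.step (sZero n + k)
    rw [scT_late hs, scBeta_late hs, scRatio_late hs, scAlpha_late hs, gammaSum_late hs] at h1
    have e0 : thetaSum a n L τ (sZero n + k + 1) (scT n (sZero n + 1))
        = thetaSum a n L τ (sZero n + 1) (scT n (sZero n + 1)) := by
      have := thetaSum_scT (a := a) (n := n) (L := L) (τ := τ) (sZero n + k + 1)
      rw [scT_late hs, scAlpha_late hs, gammaSum_late hs] at this
      rw [this, thetaSum_scT]
    rw [e0] at h1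
    have hA := h.A_nonneg (sZero n + k + 1)
    have hR := h.R_nonneg (sZero n + k + 1)
    have h2 := mul_le_mul_of_nonneg_right (rate_mul_le (a := a) hL hτ hn) hA
    have hw := scRatio_pos (a := a) (s := sZero n + 1) hL hτ hn
    have h3 := mul_le_mul_of_nonneg_left (rate_le_pow (a := a) hL hτ hn) hw.le
    have h4 := mul_le_mul_of_nonneg_right h3 hR
    have h5 : rate a n L τ * latePotential a n L τ A R (sZero n + k + 1)
        ≤ latePotential a n L τ A R (sZero n + k) + gammaSum a n L τ (sZero n + 1)
        * (scRatio a n L τ (sZero n + 1) * scEta a n L τ D₀ (sZero n + k + 1) + E) := by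
      unfold latePotential
      linarith
    have hgk : 0 ≤ rate a n L τ ^ k := by positivity
    have h6 := mul_le_mul_of_nonneg_left h5 hgk
    have h7 := scEta_late_le (a := a) hL hτ hn hD k
    have h8 : scRatio a n L τ (sZero n + 1)
        * (rate a n L τ ^ k * scEta a n L τ D₀ (sZero n + k + 1))
        ≤ coef a / 4 * (D₀ / n) * ((sZero n + k + 1 : ℕ) : ℝ)⁻¹ := by
      calc _ ≤ coef a * L / 4 * (D₀ / ((sZero n + k + 1 : ℕ) * n * L)) := by
            have := scRatio_le (a := a) (s := sZero n + 1) hL hτ hn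
            have h0 : 0 ≤ D₀ / ((sZero n + k + 1 : ℕ) * n * L) := by positivity
            exact (mul_le_mul_of_nonneg_left h7 hw.le).trans (mul_le_mul_of_nonneg_right this h0)
        _ = _ := by field_simp
    have h9 := mul_le_mul_of_nonneg_left h8 hW.le
    rw [← add_assoc, harmonic_succ, Finset.sum_range_succ, pow_succ]
    push_cast at *
    linarith

/-- The factor by which the errors of the gradient estimator are amplified. -/
def errorFactor (a : Access) (n : ℕ) (L τ : ℝ) : ℝ := 4 + 2 / (rate a n L τ - 1)

/-- The expected gap after the first `s₀` epochs. -/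
lemma EpochRecursion.gap_le_late (h : EpochRecursion a n L τ D₀ E A R) (hL : 0 < L)
    (hτ : 0 < τ) (hn : 0 < n) (hE : 0 ≤ E) (k : ℕ) :
    A (sZero n + k) ≤ 6 * (D₀ / n) * (1 + Real.log (sZero n + k : ℕ)) / rate a n L τ ^ k
      + errorFactor a n L τ * E := by
  have hc := coef_pos a
  have hc5 := coef_le_five a
  have hn' : (0 : ℝ) < n := Nat.cast_pos.2 hn
  have hD := h.D₀_nonneg hL
  have hg := one_lt_rate (a := a) hL hτ hn
  have hgk : 1 ≤ rate a n L τ ^ k := one_le_pow₀ hg.le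
  have hW := gammaSum_pos (a := a) hL hτ hn (sZero n + 1)
  have hW' := gammaSum_pos (a := a) hL hτ hn (sZero n)
  have hα2 := scAlpha_le_half (a := a) (n := n) (L := L) (τ := τ) (s := sZero n + 1)
  obtain ⟨Q, hQ⟩ : ∃ Q, Q = 1 / 2 - scAlpha a n L τ (sZero n + 1)
    + gammaSum a n L τ (sZero n + 1) / 2 := ⟨_, rfl⟩
  have hQW : gammaSum a n L τ (sZero n + 1) ≤ 2 * Q := by rw [hQ]; linarith
  have hQ0 : 0 < Q := by linarith
  -- the two potentials at the change of regime
  have hstart : latePotential a n L τ A R (sZero n)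
      ≤ Q * (2 * doublingPotential a n L τ A R (sZero n)) := by
    have hT1 := natCast_scT_le_gammaSum (a := a) hL hτ hn (sZero n + 1)
    have hT2 := gammaSum_le (a := a) hL hτ hn (sZero n)
    have hTe : scT n (sZero n + 1) = scT n (sZero n) := by
      rw [scT_sZero, scT_of_le (by omega)]
    rw [hTe] at hT1
    have hw := scRatio_le (a := a) (s := sZero n + 1) hL hτ hn
    have h1 : 1 ≤ 2 * Q * ((1 + scBeta a n L τ (sZero n)) ^ scT n (sZero n)
        / gammaSum a n L τ (sZero n)) := by
      rw [← mul_div_assoc, one_le_div hW']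
      refine hT2.trans ?_
      have hβ := scBeta_pos (a := a) (s := sZero n) hL hτ hn
      gcongr
      linarith
    have hcL : 0 ≤ coef a * L / 4 := by positivity
    have h2 := mul_le_mul_of_nonneg_left h1 hcL
    have h3 := mul_le_mul_of_nonneg_right (hw.trans (by linarith)) (h.R_nonneg (sZero n))
      (b := scRatio a n L τ (sZero n + 1)) (c := coef a * L / 4 * (2 * Q *
        ((1 + scBeta a n L τ (sZero n)) ^ scT n (sZero n) / gammaSum a n L τ (sZero n))))
    have h4 : 0 ≤ Q * A (sZero n) := mul_nonneg hQ0.le (h.A_nonneg _)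
    unfold latePotential doublingPotential
    rw [← hQ]
    linarith
  have hdoub : doublingPotential a n L τ A R (sZero n)
      ≤ (D₀ / n) * (1 / 4 + coef a / 2 * (harmonic (sZero n) : ℝ)) + 2 * E := by
    have h1 := h.doublingPotential_le hL hτ hn (sZero n - 1)
      (by have := one_le_sZero n; omega)
    have e1 : sZero n - 1 + 1 = sZero n := by have := one_le_sZero n; omega
    have e2 : sZero n - 1 + 2 = sZero n + 1 := by have := one_le_sZero n; omega
    rw [e1, e2] at h1
    have h2 : (n : ℝ) ≤ 2 ^ sZero n := by exact_mod_cast (lt_two_pow_sZero n).le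
    have hp : (0 : ℝ) < 2 ^ sZero n := by positivity
    have hH : (0 : ℝ) ≤ harmonic (sZero n) := by
      have : (0 : ℚ) ≤ harmonic (sZero n) := by unfold harmonic; positivity
      exact_mod_cast this
    refine le_of_mul_le_mul_left (h1.trans ?_) hp
    have h3 : D₀ ≤ 2 ^ sZero n * (D₀ / n) := by
      rw [← mul_div_assoc, le_div_iff₀ hn', mul_comm]; gcongr
    have h4 := mul_le_mul_of_nonneg_right h3
      (by positivity : 0 ≤ 1 / 4 + coef a / 2 * (harmonic (sZero n) : ℝ))
    rw [pow_succ]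
    linarith
  have hmain := h.latePotential_le hL hτ hn k
  have hAB : Q * A (sZero n + k) ≤ latePotential a n L τ A R (sZero n + k) := by
    have := mul_nonneg (scRatio_pos (a := a) (s := sZero n + 1) hL hτ hn).le
      (h.R_nonneg (sZero n + k))
    unfold latePotential
    rw [← hQ]
    linarith
  have hHmono : (harmonic (sZero n) : ℝ) ≤ harmonic (sZero n + k) := by
    have : harmonic (sZero n) ≤ harmonic (sZero n + k) := by
      unfold harmonic
      exact Finset.sum_le_sum_of_subset_of_nonneg
        (Finset.range_mono (by omega)) (fun i _ _ => by positivity)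
    exact_mod_cast this
  have hHlog := harmonic_le_one_add_log (sZero n + k)
  set H₀ : ℝ := (harmonic (sZero n) : ℝ)
  set H₁ : ℝ := (harmonic (sZero n + k) : ℝ)
  set g := rate a n L τ
  have hgeom : (∑ j ∈ Finset.range k, g ^ j) ≤ g ^ k / (g - 1) := by
    rw [le_div_iff₀ (by linarith), geom_sum_mul]; linarith
  have hgeom0 : 0 ≤ ∑ j ∈ Finset.range k, g ^ j := Finset.sum_nonneg fun j _ => by positivity
  have hX : 0 ≤ coef a / 4 * (D₀ / n) * (H₁ - H₀) + E * ∑ j ∈ Finset.range k, g ^ j := by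
    have : 0 ≤ H₁ - H₀ := by linarith
    positivity
  have h1 : g ^ k * (Q * A (sZero n + k)) ≤ Q * (2 * doublingPotential a n L τ A R (sZero n)
      + 2 * (coef a / 4 * (D₀ / n) * (H₁ - H₀) + E * ∑ j ∈ Finset.range k, g ^ j)) := by
    have h2 := mul_le_mul_of_nonneg_left hAB (by positivity : 0 ≤ g ^ k)
    have h3 := mul_le_mul_of_nonneg_right hQW hX
    linarith
  have h2 : g ^ k * A (sZero n + k) ≤ 2 * doublingPotential a n L τ A R (sZero n)
      + 2 * (coef a / 4 * (D₀ / n) * (H₁ - H₀) + E * ∑ j ∈ Finset.range k, g ^ j) := by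
    refine le_of_mul_le_mul_left ?_ hQ0
    linarith
  have h3 : g ^ k * A (sZero n + k) ≤ 6 * (D₀ / n) * (1 + Real.log (sZero n + k : ℕ))
      + g ^ k * ((4 + 2 / (g - 1)) * E) := by
    have hDn : 0 ≤ D₀ / n := by positivity
    have h4 : 2 * ((D₀ / n) * (1 / 4 + coef a / 2 * H₀))
        + 2 * (coef a / 4 * (D₀ / n) * (H₁ - H₀))
        ≤ 6 * (D₀ / n) * (1 + Real.log (sZero n + k : ℕ)) := by
      have hlog0 : 0 ≤ Real.log (sZero n + k : ℕ) := Real.log_natCast_nonneg _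
      have h6 : coef a * H₁ ≤ 5 * (1 + Real.log (sZero n + k : ℕ)) := by
        calc coef a * H₁ ≤ coef a * (1 + Real.log (sZero n + k : ℕ)) := by gcongr
          _ ≤ _ := by gcongr
      have h5 : 1 / 2 + coef a / 2 * H₀ + coef a / 2 * H₁
          ≤ 6 * (1 + Real.log (sZero n + k : ℕ)) := by
        have : coef a / 2 * H₀ ≤ coef a / 2 * H₁ := by gcongr
        linarith
      have := mul_le_mul_of_nonneg_left h5 hDn
      linarith
    have h7 : E * ∑ j ∈ Finset.range k, g ^ j ≤ E * (g ^ k / (g - 1)) := by gcongr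
    have h8 : g ^ k * ((4 + 2 / (g - 1)) * E) = 4 * (g ^ k * E) + 2 * (E * (g ^ k / (g - 1))) := by
      ring
    have h9 : E ≤ g ^ k * E := le_mul_of_one_le_left hE hgk
    rw [h8]
    linarith
  have hgk0 : 0 < g ^ k := by positivity
  refine le_of_mul_le_mul_left (h3.trans (le_of_eq ?_)) hgk0
  unfold errorFactor
  rw [mul_add (g ^ k), mul_div_cancel₀ _ hgk0.ne']

end Rates

/-! ### Counting oracle calls -/

section Costs

variable {a : Access} {n : ℕ} {L τ D D₀ : ℝ} {s : ℕ}

/-- The growth rate of `1 / η_s` after the first `s₀` epochs. -/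
def toleranceRate (a : Access) (n : ℕ) (L τ : ℝ) : ℝ :=
  if sigma a L τ ≤ n then 5 / 4 else rate a n L τ

lemma one_le_toleranceRate (hL : 0 < L) (hτ : 0 < τ) (hn : 0 < n) :
    1 ≤ toleranceRate a n L τ := by
  unfold toleranceRate
  split_ifs
  · norm_num
  · exact (one_lt_rate hL hτ hn).le

/-- The constant in the bounds for the number of linear oracle calls. -/
def callConst (L τ D D₀ : ℝ) : ℝ := 8 * (2 + 2 * τ / L) * D ^ 2 * L / D₀ + 2

lemma callConst_nonneg (hL : 0 < L) (hτ : 0 < τ) (hD : 0 ≤ D₀) : 0 ≤ callConst L τ D D₀ := by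
  unfold callConst; positivity

lemma callBound_le (hL : 0 < L) (hτ : 0 < τ) (hn : 0 < n) (hD : 0 < D₀) {y : ℝ} (hy : 1 ≤ y)
    (h : D₀ / (y * L) ≤ scEta a n L τ D₀ s) :
    callBound a n L τ D D₀ s ≤ callConst L τ D D₀ * y := by
  have hy0 : 0 < y := by linarith
  have h0 : 0 < D₀ / (y * L) := by positivity
  have hγ := scGamma_mul_le (a := a) (s := s) hL hτ hn
  unfold callBound callConst
  have h1 : 8 * ((scGamma a n L τ s * τ + 1) * D ^ 2) / scEta a n L τ D₀ s
      ≤ 8 * ((2 + 2 * τ / L) * D ^ 2) / (D₀ / (y * L)) := by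
    have h3 : scGamma a n L τ s * τ + 1 ≤ 2 + 2 * τ / L := by linarith
    have h4 := mul_le_mul_of_nonneg_right h3 (sq_nonneg D)
    exact div_le_div₀ (by positivity) (by linarith) h0 h
  have h2 : 8 * ((2 + 2 * τ / L) * D ^ 2) / (D₀ / (y * L))
      = 8 * (2 + 2 * τ / L) * D ^ 2 * L / D₀ * y := by field_simp
  rw [h2] at h1
  linarith

lemma callBound_le_first (hL : 0 < L) (hτ : 0 < τ) (hn : 0 < n) (hD : 0 < D₀) (h1 : 1 ≤ s)
    (hs : s ≤ sZero n) : callBound a n L τ D D₀ s ≤ callConst L τ D D₀ * (s * scT n s) := by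
  apply callBound_le hL hτ hn hD
  · have : 1 ≤ s * scT n s := Nat.mul_pos h1 scT_pos
    exact_mod_cast this
  · rw [scEta, if_pos hs]

lemma callBound_le_late (hL : 0 < L) (hτ : 0 < τ) (hn : 0 < n) (hD : 0 < D₀)
    (hs : sZero n < s) : callBound a n L τ D D₀ s
      ≤ callConst L τ D D₀ * (s * n * toleranceRate a n L τ ^ (s - sZero n - 1)) := by
  have he := one_le_toleranceRate (a := a) hL hτ hn
  have hn' : (0 : ℝ) < n := Nat.cast_pos.2 hn
  have hs' : (0 : ℝ) < s := Nat.cast_pos.2 (by omega)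
  apply callBound_le hL hτ hn hD
  · have h1 : (1 : ℝ) ≤ s * n := by
      have : 1 ≤ s * n := Nat.mul_pos (by omega) hn
      exact_mod_cast this
    exact one_le_mul_of_one_le_of_one_le h1 (one_le_pow₀ he)
  · rw [scEta, if_neg (by omega)]
    unfold toleranceRate
    split_ifs with h
    · apply le_of_eq
      rw [show (4 / 5 : ℝ) = (5 / 4)⁻¹ by norm_num, inv_pow]
      field_simp
    · have hg := one_lt_rate (a := a) hL hτ hn
      have e2 : scBigGamma a n L τ s (scT n (sZero n)) = rate a n L τ := by
        rw [scBigGamma_eq, scBeta_late hs, rate, if_neg h, scT_sZero, scT_of_le (by omega)]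
      rw [e2]
      apply le_of_eq
      rw [one_div, inv_pow]
      field_simp

lemma sum_calls_le (hL : 0 < L) (hτ : 0 < τ) (hn : 0 < n) (hD : 0 < D₀) (S : ℕ) :
    ∑ s ∈ Finset.range S, scT n (s + 1) * callBound a n L τ D D₀ (s + 1)
      ≤ callConst L τ D D₀ * S ^ 2 * n ^ 2 * toleranceRate a n L τ ^ (S - sZero n - 1) := by
  have he := one_le_toleranceRate (a := a) hL hτ hn
  have hK := callConst_nonneg (D := D) hL hτ hD.le
  have hterm : ∀ s ∈ Finset.range S, scT n (s + 1) * callBound a n L τ D D₀ (s + 1)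
      ≤ callConst L τ D D₀ * S * n ^ 2 * toleranceRate a n L τ ^ (S - sZero n - 1) := by
    intro s hs
    have hsS : ((s + 1 : ℕ) : ℝ) ≤ S := by exact_mod_cast Finset.mem_range.1 hs
    have hT : (scT n (s + 1) : ℝ) ≤ n := by exact_mod_cast scT_le (s := s + 1) hn
    by_cases h : s + 1 ≤ sZero n
    · calc (scT n (s + 1) : ℝ) * callBound a n L τ D D₀ (s + 1)
          ≤ scT n (s + 1) * (callConst L τ D D₀ * ((s + 1 : ℕ) * scT n (s + 1))) := by
            gcongr; exact callBound_le_first hL hτ hn hD (by omega) h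
        _ ≤ n * (callConst L τ D D₀ * (S * n)) := by gcongr
        _ = callConst L τ D D₀ * S * n ^ 2 * 1 := by ring
        _ ≤ _ := by gcongr; exact one_le_pow₀ he
    · have hexp : s + 1 - sZero n - 1 ≤ S - sZero n - 1 := by
        have := Finset.mem_range.1 hs; omega
      calc (scT n (s + 1) : ℝ) * callBound a n L τ D D₀ (s + 1)
          ≤ scT n (s + 1) * (callConst L τ D D₀ * ((s + 1 : ℕ) * n
            * toleranceRate a n L τ ^ (s + 1 - sZero n - 1))) := by
            gcongr; exact callBound_le_late hL hτ hn hD (by omega)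
        _ ≤ n * (callConst L τ D D₀ * (S * n * toleranceRate a n L τ ^ (S - sZero n - 1))) := by
            gcongr
        _ = _ := by ring
  refine (Finset.sum_le_sum hterm).trans (le_of_eq ?_)
  rw [Finset.sum_const, Finset.card_range, nsmul_eq_mul]
  ring

lemma sum_calls_le_first (hL : 0 < L) (hτ : 0 < τ) (hn : 0 < n) (hD : 0 < D₀) {S : ℕ}
    (hS : S ≤ sZero n) :
    ∑ s ∈ Finset.range S, scT n (s + 1) * callBound a n L τ D D₀ (s + 1)
      ≤ callConst L τ D D₀ * S ^ 2 * (2 ^ S) ^ 2 := by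
  have hK := callConst_nonneg (D := D) hL hτ hD.le
  have hterm : ∀ s ∈ Finset.range S, scT n (s + 1) * callBound a n L τ D D₀ (s + 1)
      ≤ callConst L τ D D₀ * S * (2 ^ S) ^ 2 := by
    intro s hs
    have hs' := Finset.mem_range.1 hs
    have hsS : ((s + 1 : ℕ) : ℝ) ≤ S := by exact_mod_cast hs'
    have hT : (scT n (s + 1) : ℝ) ≤ 2 ^ S := by
      have : scT n (s + 1) ≤ 2 ^ S := by
        rw [scT, if_pos (by omega)]
        exact Nat.pow_le_pow_right two_pos (by omega)
      exact_mod_cast this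
    calc (scT n (s + 1) : ℝ) * callBound a n L τ D D₀ (s + 1)
        ≤ scT n (s + 1) * (callConst L τ D D₀ * ((s + 1 : ℕ) * scT n (s + 1))) := by
          gcongr; exact callBound_le_first hL hτ hn hD (by omega) (by omega)
      _ ≤ 2 ^ S * (callConst L τ D D₀ * (S * 2 ^ S)) := by gcongr
      _ = _ := by ring
  refine (Finset.sum_le_sum hterm).trans (le_of_eq ?_)
  rw [Finset.sum_const, Finset.card_range, nsmul_eq_mul]
  ring

lemma sum_queries_le (hn : 0 < n) (c S : ℕ) :
    ((∑ s ∈ Finset.range S, (n + 2 * scT n (s + 1)) * c : ℕ) : ℝ) ≤ 3 * n * S * c := by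
  have : ∑ s ∈ Finset.range S, (n + 2 * scT n (s + 1)) * c ≤ ∑ _s ∈ Finset.range S, 3 * n * c := by
    refine Finset.sum_le_sum fun s _ => Nat.mul_le_mul_right c ?_
    have := scT_le (s := s + 1) hn
    omega
  rw [Finset.sum_const, Finset.card_range, smul_eq_mul] at this
  calc _ ≤ ((S * (3 * n * c) : ℕ) : ℝ) := by exact_mod_cast this
    _ = _ := by push_cast; ring

end Costs

/-! ### The number of epochs -/

section EpochCount

variable {a : Access} {n : ℕ} {L τ D₀ E ε : ℝ} {A R : ℕ → ℝ} {s S : ℕ}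

lemma one_le_lg (x : ℝ) : 1 ≤ lg x := le_max_left _ _

lemma log_le_lg (x : ℝ) : Real.log x ≤ lg x := le_max_right _ _

lemma lg_mono {x y : ℝ} (hx : 0 < x) (h : x ≤ y) : lg x ≤ lg y :=
  max_le_max le_rfl (Real.log_le_log hx h)

/-- The tangent to the logarithm at `c`. -/
lemma log_le_div_add {x c : ℝ} (hx : 0 < x) (hc : 0 < c) :
    Real.log x ≤ x / c + Real.log c - 1 := by
  have := Real.log_le_sub_one_of_pos (div_pos hx hc)
  rw [Real.log_div hx.ne' hc.ne'] at this
  linarith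

lemma four_mul_lt_of_lt (h : EpochRecursion a n L τ D₀ E A R) (hL : 0 < L) (h0 : ε < A 0) :
    4 * ε < D₀ := by
  have := coef_pos a
  have hR := h.R_nonneg 0
  have h1 := h.initial
  have : 0 ≤ 2 * coef a * L * R 0 := by positivity
  linarith

lemma four_le_errorFactor (hL : 0 < L) (hτ : 0 < τ) (hn : 0 < n) : 4 ≤ errorFactor a n L τ := by
  have := one_lt_rate (a := a) hL hτ hn
  have : 0 ≤ 2 / (rate a n L τ - 1) := div_nonneg two_pos.le (by linarith)
  unfold errorFactor; linarith

/-- The rate in the first `s₀` epochs, read at an epoch that does not reach the accuracy `ε`. -/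
lemma two_pow_lt_of_lt (h : EpochRecursion a n L τ D₀ E A R) (hL : 0 < L) (hτ : 0 < τ)
    (hn : 0 < n) (hE : 0 ≤ E) (hε : 0 < ε) (hEε : errorFactor a n L τ * E ≤ ε / 2) (h1 : 1 ≤ s)
    (hs : s ≤ sZero n) (hA : ε < A s) : (2 : ℝ) ^ s < 6 * (D₀ / ε) * s := by
  have hD := h.D₀_nonneg hL
  have h2 := h.gap_le_first hL hτ hn hE h1 hs
  have h3 := four_le_errorFactor (a := a) hL hτ hn
  have h4 : 4 * E ≤ errorFactor a n L τ * E := by gcongr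
  have hs' : (1 : ℝ) ≤ s := by exact_mod_cast h1
  have hlog : Real.log s ≤ s - 1 := Real.log_le_sub_one_of_pos (by linarith)
  have hlog0 : 0 ≤ Real.log s := Real.log_nonneg hs'
  have h5 : 1 / 4 + coef a / 2 * (1 + Real.log s) ≤ 3 * s := by
    have := coef_le_five a
    have : coef a / 2 * (1 + Real.log s) ≤ 5 / 2 * s := by gcongr; linarith
    linarith
  have h6 : D₀ / 2 ^ s * (1 / 4 + coef a / 2 * (1 + Real.log s)) ≤ D₀ / 2 ^ s * (3 * s) := by
    gcongr
  have h7 : ε / 2 < D₀ / 2 ^ s * (3 * s) := by linarith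
  have hp : (0 : ℝ) < 2 ^ s := by positivity
  have h8 : D₀ / 2 ^ s * (3 * s) = D₀ * 3 * s / 2 ^ s := by ring
  rw [h8, lt_div_iff₀ hp] at h7
  have h9 : 6 * (D₀ / ε) * s = D₀ * 6 * s / ε := by ring
  rw [h9, lt_div_iff₀ hε]
  linarith

/-- The rate after the first `s₀` epochs, read at an epoch that does not reach the accuracy `ε`. -/
lemma rate_pow_lt_of_lt (h : EpochRecursion a n L τ D₀ E A R) (hL : 0 < L) (hτ : 0 < τ)
    (hn : 0 < n) (hE : 0 ≤ E) (hε : 0 < ε) (hEε : errorFactor a n L τ * E ≤ ε / 2) {k : ℕ}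
    (hA : ε < A (sZero n + k)) :
    n * rate a n L τ ^ k < 12 * (D₀ / ε) * (sZero n + k : ℕ) := by
  have hD := h.D₀_nonneg hL
  have h2 := h.gap_le_late hL hτ hn hE k
  have hg := one_lt_rate (a := a) hL hτ hn
  have hgk : 0 < rate a n L τ ^ k := by positivity
  have hn' : (0 : ℝ) < n := Nat.cast_pos.2 hn
  have hs1 : 1 ≤ sZero n + k := by have := one_le_sZero n; omega
  have hs' : (1 : ℝ) ≤ (sZero n + k : ℕ) := by exact_mod_cast hs1
  have hlog : Real.log (sZero n + k : ℕ) ≤ (sZero n + k : ℕ) - 1 :=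
    Real.log_le_sub_one_of_pos (by linarith)
  have h3 : 6 * (D₀ / n) * (1 + Real.log (sZero n + k : ℕ)) / rate a n L τ ^ k
      ≤ 6 * (D₀ / n) * (sZero n + k : ℕ) / rate a n L τ ^ k := by
    gcongr; linarith
  have h4 : ε / 2 < 6 * (D₀ / n) * (sZero n + k : ℕ) / rate a n L τ ^ k := by linarith
  rw [lt_div_iff₀ hgk] at h4
  have h5 : 12 * (D₀ / ε) * (sZero n + k : ℕ) = D₀ * 12 * (sZero n + k : ℕ) / ε := by ring
  have h6 : 6 * (D₀ / n) * (sZero n + k : ℕ) = D₀ * 6 * (sZero n + k : ℕ) / n := by ring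
  rw [h6, lt_div_iff₀ hn'] at h4
  rw [h5, lt_div_iff₀ hε]
  linarith

lemma exists_gap_le (h : EpochRecursion a n L τ D₀ E A R) (hL : 0 < L) (hτ : 0 < τ)
    (hn : 0 < n) (hE : 0 ≤ E) (hε : 0 < ε) (hEε : errorFactor a n L τ * E ≤ ε / 2) :
    ∃ s, A s ≤ ε := by
  by_contra hcon
  push Not at hcon
  have hn' : (0 : ℝ) < n := Nat.cast_pos.2 hn
  have hX : 0 < D₀ / ε := by
    have := four_mul_lt_of_lt h hL (hcon 0)
    exact div_pos (by linarith) hε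
  have hs0 : (0 : ℝ) < sZero n + 1 := by positivity
  have hlim := tendsto_pow_const_div_const_pow_of_one_lt 1 (one_lt_rate (a := a) hL hτ hn)
  have hev := hlim.eventually_lt_const
    (by positivity : (0 : ℝ) < n / (12 * (D₀ / ε) * (sZero n + 1)))
  obtain ⟨k, hk, hk1⟩ := (hev.and (Filter.eventually_ge_atTop 1)).exists
  have h1 := rate_pow_lt_of_lt h hL hτ hn hE hε hEε (hcon (sZero n + k))
  have hg := one_lt_rate (a := a) hL hτ hn
  have hk1' : (1 : ℝ) ≤ k := by exact_mod_cast hk1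
  rw [pow_one, div_lt_div_iff₀ (by positivity) (by positivity)] at hk
  have h2 : ((sZero n + k : ℕ) : ℝ) ≤ (sZero n + 1) * k := by
    push_cast
    have : (0 : ℝ) ≤ sZero n := by positivity
    nlinarith
  have h3 : 12 * (D₀ / ε) * (sZero n + k : ℕ) ≤ 12 * (D₀ / ε) * ((sZero n + 1) * k) := by gcongr
  linarith

/-- The first epoch of accuracy `ε` is among the first `s₀` ones if `ε` is above the threshold. -/
lemma le_sZero_of_threshold_le (h : EpochRecursion a n L τ D₀ E A R) (hL : 0 < L) (hτ : 0 < τ)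
    (hn : 0 < n) (hE : 0 ≤ E) (hEε : errorFactor a n L τ * E ≤ ε / 2)
    (hthr : threshold a n D₀ ≤ ε) : A (sZero n) ≤ ε := by
  have hD := h.D₀_nonneg hL
  have hn' : (0 : ℝ) < n := Nat.cast_pos.2 hn
  have h2 := h.gap_le_first hL hτ hn hE (one_le_sZero n) le_rfl
  have h3 := four_le_errorFactor (a := a) hL hτ hn
  have h4 : 4 * E ≤ errorFactor a n L τ * E := by gcongr
  have hlog0 : 0 ≤ Real.log (sZero n) := Real.log_natCast_nonneg _
  have hpow : (n : ℝ) ≤ 2 ^ sZero n := by exact_mod_cast (lt_two_pow_sZero n).le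
  have hc := coef_pos a
  have h5 : D₀ / 2 ^ sZero n * (1 / 4 + coef a / 2 * (1 + Real.log (sZero n)))
      ≤ D₀ / n * (1 / 4 + coef a / 2 * (1 + Real.log (sZero n))) := by gcongr
  have hDn : 0 ≤ D₀ / n := by positivity
  have h6 : D₀ / n * (1 / 4 + coef a / 2 * (1 + Real.log (sZero n))) ≤ threshold a n D₀ / 2 := by
    cases a with
    | first =>
      have e : threshold .first n D₀ / 2 = D₀ / n * (5 * (2 + Real.log (sZero n)) / 2) := by
        unfold threshold; ring
      rw [e]
      apply mul_le_mul_of_nonneg_left _ hDn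
      norm_num [coef]; linarith
    | zeroth μ =>
      have e : threshold (.zeroth μ) n D₀ / 2 = D₀ / n * (8 * (2 + Real.log (sZero n)) / 2) := by
        unfold threshold; ring
      rw [e]
      apply mul_le_mul_of_nonneg_left _ hDn
      norm_num [coef]; linarith
  linarith

/-- A count `S` with `(9/8) ^ S ≤ 27 X S` is logarithmic in `X`. -/
lemma count_le_lg {X : ℝ} (hX : 4 < X) (hS : 1 ≤ S) (h : (9 / 8 : ℝ) ^ S ≤ 27 * X * S) :
    (S : ℝ) ≤ 116 * lg X := by
  have hS' : (0 : ℝ) < S := Nat.cast_pos.2 hS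
  have h1 := Real.log_le_log (by positivity) h
  rw [Real.log_pow, Real.log_mul (by positivity) hS'.ne', Real.log_mul (by norm_num)
    (by linarith)] at h1
  have h2 : (1 : ℝ) / 9 ≤ Real.log (9 / 8) := by
    have := Real.one_sub_inv_le_log_of_pos (by norm_num : (0 : ℝ) < 9 / 8)
    norm_num at this ⊢; linarith
  have h3 := log_le_div_add hS' (by norm_num : (0 : ℝ) < 18)
  have hl2 := Real.log_two_lt_d9
  have h4 : Real.log 27 ≤ 5 * Real.log 2 := by
    have : Real.log 27 ≤ Real.log (2 ^ 5) := Real.log_le_log (by norm_num) (by norm_num)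
    rwa [Real.log_pow] at this
  have h5 : Real.log 18 ≤ 4.2 * Real.log 2 := by
    have : Real.log (18 ^ 5) ≤ Real.log (2 ^ 21) := Real.log_le_log (by norm_num) (by norm_num)
    rw [Real.log_pow, Real.log_pow] at this
    push_cast at this
    linarith
  have h6 := mul_le_mul_of_nonneg_left h2 hS'.le
  have h7 := one_le_lg X
  have h8 := log_le_lg X
  linarith

end EpochCount

section LateCount

variable {a : Access} {n : ℕ} {L τ : ℝ}

lemma sZero_le_lg (hn : 0 < n) : (sZero n : ℝ) ≤ 3 * lg n := by
  have hn' : (0 : ℝ) < n := Nat.cast_pos.2 hn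
  have h1 : (2 : ℝ) ^ Nat.log 2 n ≤ n := by exact_mod_cast Nat.pow_log_le_self 2 hn.ne'
  have h2 := Real.log_le_log (by positivity) h1
  rw [Real.log_pow] at h2
  have h3 := Real.log_two_gt_d9
  have h4 := one_le_lg n
  have h5 := log_le_lg n
  have h6 : (0 : ℝ) ≤ Nat.log 2 n := Nat.cast_nonneg _
  unfold sZero
  push_cast
  nlinarith

lemma sZero_le_self (hn : 0 < n) : sZero n ≤ n := by
  have := Nat.log_lt_self 2 hn.ne'
  unfold sZero; omega

lemma four_mul_sigma (a : Access) (L τ : ℝ) : 4 * sigma a L τ = coef a * (L / τ) := by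
  unfold sigma; ring

/-- The number of epochs after the first `s₀` if `n < ς`, from `log (1 + α/4) ≥ α/8`. The number
`log (s₀ + k)` on the right of the assumption is absorbed by the tangent to the logarithm at
`16 / α`. -/
lemma late_count_le (hL : 0 < L) (hτ : 0 < τ) (hn : 0 < n) (h : (n : ℝ) < sigma a L τ) {X : ℝ}
    (hX : 0 < X) {k : ℕ} (hk : n * rate a n L τ ^ k ≤ 12 * X * (sZero n + k : ℕ)) :
    (k : ℝ) ≤ 16 / scAlpha a n L τ (sZero n + 1) * (6 + lg (X / n) + Real.log (sZero n + 1)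
      + Real.log (1 / scAlpha a n L τ (sZero n + 1))) := by
  have hn' : (0 : ℝ) < n := Nat.cast_pos.2 hn
  have hα := scAlpha_pos (a := a) (s := sZero n + 1) hL hτ hn
  have hα2 := scAlpha_le_half (a := a) (n := n) (L := L) (τ := τ) (s := sZero n + 1)
  have hg := one_add_scAlpha_le_rate hL hτ hn h
  set α := scAlpha a n L τ (sZero n + 1)
  have hg0 : 0 < rate a n L τ := by linarith
  have hk0 : (0 : ℝ) ≤ k := k.cast_nonneg
  have hs0 : (1 : ℝ) ≤ sZero n := by exact_mod_cast one_le_sZero n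
  have h1 : rate a n L τ ^ k ≤ 12 * (X / n) * ((sZero n + 1) * (k + 1)) := by
    have e : 12 * (X / n) * ((sZero n + 1) * (k + 1))
      = 12 * X * ((sZero n + 1) * (k + 1)) / n := by ring
    rw [e, le_div_iff₀ hn', mul_comm]
    refine hk.trans ?_
    gcongr
    push_cast
    nlinarith
  have h2 := Real.log_le_log (by positivity) h1
  rw [Real.log_pow, Real.log_mul (by positivity) (by positivity), Real.log_mul (by norm_num)
    (by positivity), Real.log_mul (by positivity) (by positivity)] at h2
  have h3 : α / 8 ≤ Real.log (rate a n L τ) := by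
    have h4 := Real.log_le_log (by positivity) hg
    have h5 := Real.one_sub_inv_le_log_of_pos (by positivity : 0 < 1 + α / 4)
    refine le_trans ?_ (h5.trans h4)
    have e : 1 - (1 + α / 4)⁻¹ = α / 4 / (1 + α / 4) := by field_simp; ring
    rw [e, le_div_iff₀ (by positivity)]
    nlinarith
  have h4 := mul_le_mul_of_nonneg_left h3 hk0
  have h5 := log_le_div_add (by positivity : (0 : ℝ) < k + 1) (by positivity : 0 < 16 / α)
  have e5 : ((k : ℝ) + 1) / (16 / α) = (k + 1) * α / 16 := by field_simp
  have e6 : Real.log (16 / α) = 4 * Real.log 2 + Real.log (1 / α) := by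
    rw [show 16 / α = 2 ^ 4 * (1 / α) by ring, Real.log_mul (by norm_num) (by positivity),
      Real.log_pow]
    norm_num
  rw [e5, e6] at h5
  have h6 : Real.log 12 ≤ 4 * Real.log 2 := by
    have : Real.log 12 ≤ Real.log (2 ^ 4) := Real.log_le_log (by norm_num) (by norm_num)
    rw [Real.log_pow] at this
    exact_mod_cast this
  have hl2 := Real.log_two_lt_d9
  have h7 := log_le_lg (X / n)
  rw [div_mul_eq_mul_div, le_div_iff₀ hα]
  linarith

lemma inv_scAlpha_sq (hL : 0 < L) (hτ : 0 < τ) (hn : 0 < n) (h : (n : ℝ) < sigma a L τ) :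
    (n : ℝ) * (1 / scAlpha a n L τ (sZero n + 1)) ^ 2 = coef a * (L / τ) := by
  have hα := scAlpha_pos (a := a) (s := sZero n + 1) hL hτ hn
  have h1 := scAlpha_sq (a := a) hL hτ (Nat.lt_succ_self (sZero n)) h
  change scAlpha a n L τ (sZero n + 1) ^ 2 * (4 * sigma a L τ) = n at h1
  rw [← four_mul_sigma, ← h1]
  field_simp

lemma nat_div_scAlpha_le (hL : 0 < L) (hτ : 0 < τ) (hn : 0 < n) (h : (n : ℝ) < sigma a L τ) :
    n / scAlpha a n L τ (sZero n + 1) ≤ 3 * Real.sqrt (n * L / τ) := by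
  have hα := scAlpha_pos (a := a) (s := sZero n + 1) hL hτ hn
  have h1 := inv_scAlpha_sq hL hτ hn h
  have h5 := coef_le_five a
  rw [← pow_le_pow_iff_left₀ (by positivity) (by positivity) two_ne_zero, mul_pow,
    Real.sq_sqrt (by positivity)]
  have e : (n / scAlpha a n L τ (sZero n + 1)) ^ 2
      = n * (n * (1 / scAlpha a n L τ (sZero n + 1)) ^ 2) := by ring
  rw [e, h1]
  have : coef a * (n * (L / τ)) ≤ 9 * (n * (L / τ)) := by gcongr; linarith
  calc _ = coef a * (n * (L / τ)) := by ring
    _ ≤ _ := this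
    _ = _ := by ring

lemma inv_scAlpha_sq_le (hL : 0 < L) (hτ : 0 < τ) (hn : 0 < n) (h : (n : ℝ) < sigma a L τ) :
    (1 / scAlpha a n L τ (sZero n + 1)) ^ 2 ≤ 5 * (L / τ) := by
  have h1 := inv_scAlpha_sq hL hτ hn h
  have h5 := coef_le_five a
  have hn1 : (1 : ℝ) ≤ n := by exact_mod_cast hn
  have h2 : 0 ≤ (1 / scAlpha a n L τ (sZero n + 1)) ^ 2 := sq_nonneg _
  have h3 : coef a * (L / τ) ≤ 5 * (L / τ) := by gcongr
  nlinarith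

/-- If `n < ς`, then `n` times the number of epochs is of the order of the bound for the queries. -/
lemma nat_mul_late_count_le (hL : 0 < L) (hτ : 0 < τ) (hn : 0 < n) (hσ : (n : ℝ) < sigma a L τ)
    {X : ℝ} (hX : 4 < X) {k : ℕ} (h1 : n * rate a n L τ ^ k ≤ 12 * X * (sZero n + k : ℕ)) :
    (n : ℝ) * (sZero n + k + 1) ≤ 500 * (lg (n + L / τ + X)
      * (n * lg n + Real.sqrt (n * L / τ) * lg (X / n))) := by
  have hX0 : 0 < X := by linarith
  have hn' : (0 : ℝ) < n := Nat.cast_pos.2 hn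
  have hLτ : 0 < L / τ := by positivity
  have hs0 := sZero_le_lg hn
  have hY1 := one_le_lg (n + L / τ + X)
  have hXn1 := one_le_lg (X / n)
  have hln1 := one_le_lg n
  have hkle := late_count_le hL hτ hn hσ hX0 h1
  have hα := scAlpha_pos (a := a) (s := sZero n + 1) hL hτ hn
  have hα2 := inv_scAlpha_sq_le hL hτ hn hσ
  have hnα := nat_div_scAlpha_le hL hτ hn hσ
  set α := scAlpha a n L τ (sZero n + 1)
  set Y := lg (n + L / τ + X)
  set Z := lg (X / n)
  set q := Real.sqrt (n * L / τ)
  have hlogs : Real.log (sZero n + 1) ≤ Y := by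
    refine (Real.log_le_log (by positivity) ?_).trans (log_le_lg _)
    have : (sZero n : ℝ) ≤ n := by exact_mod_cast sZero_le_self hn
    linarith
  have hlogα : Real.log (1 / α) ≤ 1 + Y := by
    have h2 : Real.log ((1 / α) ^ 2) ≤ Real.log (5 * (n + L / τ + X)) := by
      apply Real.log_le_log (by positivity)
      linarith
    rw [Real.log_pow, Real.log_mul (by norm_num) (by positivity)] at h2
    have h3 : Real.log 5 ≤ 2 := by
      have h4 := log_le_div_add (x := 5) (c := 4) (by norm_num) (by norm_num)
      have h5 : Real.log 4 = 2 * Real.log 2 := by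
        rw [show (4 : ℝ) = 2 ^ 2 by norm_num, Real.log_pow]; norm_num
      have := Real.log_two_lt_d9
      linarith
    have h6 := log_le_lg (n + L / τ + X)
    push_cast at h2
    change _ ≤ Y at h6
    linarith
  have hk2 : (n : ℝ) * k ≤ 480 * (q * (Y * Z)) := by
    calc (n : ℝ) * k ≤ n * (16 / α * (6 + Z + Real.log (sZero n + 1) + Real.log (1 / α))) := by
          gcongr
      _ = 16 * (n / α) * (6 + Z + Real.log (sZero n + 1) + Real.log (1 / α)) := by ring
      _ ≤ 16 * (n / α) * (10 * (Y * Z)) := by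
          gcongr
          nlinarith
      _ ≤ 16 * (3 * q) * (10 * (Y * Z)) := by gcongr
      _ = _ := by ring
  have h2 : (n : ℝ) * sZero n ≤ n * (3 * lg n) := by gcongr
  have h3 : (n : ℝ) * 1 ≤ n * lg n := by gcongr
  have h4 : (n : ℝ) * lg n ≤ n * lg n * Y := le_mul_of_one_le_right (by positivity) hY1
  have h5 : 0 ≤ q * (Y * Z) := by positivity
  linarith

/-- A bound for the number of epochs if `n < ς`, in units of `lg (n + D₀ / ε)`. -/
def epochConst (L τ : ℝ) : ℝ :=
  4 + 16 * Real.sqrt (5 * (L / τ)) * (8 + Real.sqrt (5 * (L / τ)))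

lemma late_count_le_lg (hL : 0 < L) (hτ : 0 < τ) (hn : 0 < n) (hσ : (n : ℝ) < sigma a L τ)
    {X : ℝ} (hX : 4 < X) {k : ℕ} (h1 : n * rate a n L τ ^ k ≤ 12 * X * (sZero n + k : ℕ)) :
    (sZero n : ℝ) + k + 1 ≤ epochConst L τ * lg (n + X) := by
  have hX0 : 0 < X := by linarith
  have hn' : (0 : ℝ) < n := Nat.cast_pos.2 hn
  have hn1 : (1 : ℝ) ≤ n := by exact_mod_cast hn
  have hLτ : 0 < L / τ := by positivity
  have hs0 := sZero_le_lg hn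
  have hZ1 := one_le_lg (n + X)
  have hnZ : lg n ≤ lg (n + X) := lg_mono hn' (by linarith)
  have hkle := late_count_le hL hτ hn hσ hX0 h1
  have hα := scAlpha_pos (a := a) (s := sZero n + 1) hL hτ hn
  have hα2 := inv_scAlpha_sq_le hL hτ hn hσ
  have hα3 : 1 / scAlpha a n L τ (sZero n + 1) ≤ Real.sqrt (5 * (L / τ)) :=
    Real.le_sqrt_of_sq_le hα2
  set α := scAlpha a n L τ (sZero n + 1)
  set Z := lg (n + X) with hZ
  set ρ := Real.sqrt (5 * (L / τ)) with hρ
  have hlogs : Real.log (sZero n + 1) ≤ Z := by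
    refine (Real.log_le_log (by positivity) ?_).trans (log_le_lg _)
    have : (sZero n : ℝ) ≤ n := by exact_mod_cast sZero_le_self hn
    linarith
  have hlogX : lg (X / n) ≤ Z := by
    apply lg_mono (by positivity)
    have : X / n ≤ X := div_le_self hX0.le hn1
    linarith
  have hlogα : Real.log (1 / α) ≤ ρ := by
    have := Real.log_le_sub_one_of_pos (by positivity : 0 < 1 / α)
    linarith
  have hρ0 : 0 ≤ ρ := Real.sqrt_nonneg _
  have hk2 : (k : ℝ) ≤ 16 * ρ * ((8 + ρ) * Z) := by
    calc (k : ℝ) ≤ 16 / α * (6 + lg (X / n) + Real.log (sZero n + 1)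
          + Real.log (1 / α)) := hkle
      _ ≤ 16 / α * ((8 + ρ) * Z) := by
          gcongr
          nlinarith
      _ = 16 * (1 / α) * ((8 + ρ) * Z) := by ring
      _ ≤ 16 * ρ * ((8 + ρ) * Z) := by gcongr
  rw [epochConst, ← hρ]
  linarith

end LateCount

/-! ### Oracle complexity -/

section Complexity

variable {d : ℕ}

/-- The constant in the bounds for the linear oracle calls. -/
def oracleConst (L τ D D₀ : ℝ) : ℝ :=
  callConst L τ D D₀
    * (144 * 116 ^ 4 * D₀ ^ 2 + 9 + 12 * D₀ * epochConst L τ ^ 3)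

lemma epochConst_nonneg {L τ : ℝ} (hL : 0 < L) (hτ : 0 < τ) : 0 ≤ epochConst L τ := by
  unfold epochConst; positivity

lemma oracleConst_nonneg {L τ D D₀ : ℝ} (hL : 0 < L) (hτ : 0 < τ) (hD : 0 ≤ D₀) :
    0 ≤ oracleConst L τ D D₀ := by
  have := callConst_nonneg (D := D) hL hτ hD
  have := epochConst_nonneg hL hτ
  unfold oracleConst; positivity

lemma ReachesWithin.mono {r : ℕ → PMF (State d)} {K : Set (Vec d)} {F : Vec d → ℝ}
    {fmin ε Q B Q' B' : ℝ} (h : ReachesWithin r K F fmin ε Q B) (hQ : Q ≤ Q') (hB : B ≤ B') :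
    ReachesWithin r K F fmin ε Q' B' := by
  obtain ⟨S, hS, h⟩ := h
  exact ⟨S, hS, fun st hst => ⟨(h st hst).1, (h st hst).2.1.trans hQ, (h st hst).2.2.mono hB⟩⟩

variable {n : ℕ} [NeZero n] {a : Access} {f : Fin n → Vec d → ℝ} {K : Set (Vec d)}
  {lo : Vec d → Vec d} {x₀ xs : Vec d} {L τ D κ D₀ ε : ℝ}

lemma reachesWithin_zero (hx₀ : x₀ ∈ K) (h : objective f x₀ - objective f xs ≤ ε) {Q B : ℝ}
    (hQ : 0 ≤ Q) (hB : 0 ≤ B) :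
    ReachesWithin (scRun a L τ D₀ f lo x₀) K (objective f) (objective f xs) ε Q B := by
  refine ⟨0, ⟨?_, fun S _ => Nat.zero_le S⟩, ?_⟩
  · simpa [scRun, run, expect_pure] using h
  · intro st hst
    simp only [scRun, run, PMF.support_pure, Set.mem_singleton_iff] at hst
    subst hst
    exact ⟨hx₀, by simpa using hQ, 0, by simp, by simpa using hB⟩

lemma reachesWithin_of_isLeast (H : Admissible a f K lo xs L τ D κ) (hD : 0 < D₀) (hx₀ : x₀ ∈ K)
    {S : ℕ} (hS : IsLeast {S | gapSeq a L τ D₀ f lo x₀ xs S ≤ ε} S) :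
    ReachesWithin (scRun a L τ D₀ f lo x₀) K (objective f) (objective f xs) ε
      (3 * n * S * estCost d a)
      (∑ s ∈ Finset.range S, scT n (s + 1) * callBound a n L τ D D₀ (s + 1)) := by
  refine ⟨S, hS, fun st hst => ?_⟩
  have h := scRun_inv H hD hx₀ S st hst
  refine ⟨h.xt_mem, ?_, h.calls⟩
  rw [h.queries_eq]
  exact sum_queries_le (NeZero.pos n) _ _

lemma le_mul_lg_pow {x y : ℝ} {m : ℕ} (hx : 0 ≤ x) : x ≤ x * lg y ^ m :=
  le_mul_of_one_le_right hx (one_le_pow₀ (one_le_lg y))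

/-- It suffices to bound the oracle calls up to any epoch before which the accuracy is not reached,
and only if it is not reached at the start, in which case `D₀ > 4 ε`. -/
lemma reachesWithin_of_forall (H : Admissible a f K lo xs L τ D κ) (hε : 0 < ε) (hx₀ : x₀ ∈ K)
    (hD₀ : D₀ = initGap a L (objective f) x₀ xs)
    (hE : errorFactor a n L τ * stepError L τ κ ≤ ε / 2) {Q B : ℝ}
    (hQ : 0 ≤ D₀ → 0 ≤ Q) (hB : 0 ≤ D₀ → 0 ≤ B)
    (hmain : ∀ S, 1 ≤ S → 0 < D₀ → 4 < D₀ / ε → ∀ A R : ℕ → ℝ,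
      EpochRecursion a n L τ D₀ (stepError L τ κ) A R → (∀ j < S, ε < A j) →
      3 * n * S * estCost d a ≤ Q ∧
        ∑ s ∈ Finset.range S, scT n (s + 1) * callBound a n L τ D D₀ (s + 1) ≤ B) :
    ReachesWithin (scRun a L τ D₀ f lo x₀) K (objective f) (objective f xs) ε Q B := by
  have hL := H.L_pos
  have hc := coef_pos a
  have hdist : 0 ≤ coef a * L * ‖x₀ - xs‖ ^ 2 := by positivity
  by_cases h0 : objective f x₀ - objective f xs ≤ ε
  · have hD0 : 0 ≤ D₀ := by
      have := H.min x₀ hx₀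
      rw [hD₀]; unfold initGap; linarith
    exact reachesWithin_zero hx₀ h0 (hQ hD0) (hB hD0)
  rw [not_le] at h0
  have hE0 : 0 ≤ stepError L τ κ := by
    have := H.τ_pos
    unfold stepError; positivity
  have hpos : 0 < D₀ := by
    rw [hD₀]; unfold initGap; linarith
  have h := epochRecursion H hpos hx₀ hD₀
  have hA0 : ε < gapSeq a L τ D₀ f lo x₀ xs 0 := by
    simpa [gapSeq, scRun, run, expect_pure] using h0
  classical
  have hex := exists_gap_le h hL H.τ_pos (NeZero.pos n) hE0 hε hE
  obtain ⟨S, hSdef⟩ : ∃ S, S = Nat.find hex := ⟨_, rfl⟩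
  have hSmem : gapSeq a L τ D₀ f lo x₀ xs S ≤ ε := hSdef ▸ Nat.find_spec hex
  have hSmin : ∀ j < S, ε < gapSeq a L τ D₀ f lo x₀ xs j := fun j hj =>
    not_le.1 (Nat.find_min hex (hSdef ▸ hj))
  have hS1 : 1 ≤ S := by
    by_contra hcon
    have : S = 0 := by omega
    rw [this] at hSmem
    linarith
  have hleast : IsLeast {S | gapSeq a L τ D₀ f lo x₀ xs S ≤ ε} S :=
    ⟨hSmem, fun j hj => not_lt.1 fun hlt => (not_le.2 (hSmin j hlt)) hj⟩
  have hcosts := hmain S hS1 hpos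
    (by rw [lt_div_iff₀ hε]; exact four_mul_lt_of_lt h hL hA0) _ _ h hSmin
  exact (reachesWithin_of_isLeast H hpos hx₀ hleast).mono hcosts.1 hcosts.2

/-- The complexity if the accuracy is reached in the first `s₀` epochs or `ς ≤ n`. -/
lemma reachesWithin_easy (H : Admissible a f K lo xs L τ D κ) (hε : 0 < ε) (hx₀ : x₀ ∈ K)
    (hD₀ : D₀ = initGap a L (objective f) x₀ xs)
    (hE : errorFactor a n L τ * stepError L τ κ ≤ ε / 2)
    (hcase : threshold a n D₀ ≤ ε ∨ sigma a L τ ≤ n) :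
    ReachesWithin (scRun a L τ D₀ f lo x₀) K (objective f) (objective f xs) ε
      (348 * lg (D₀ / ε) ^ 4 * (n * estCost d a * lg (D₀ / ε)))
      (oracleConst L τ D D₀ * lg (D₀ / ε) ^ 4 * (1 / ε ^ 2)) := by
  have hL := H.L_pos
  have hτ := H.τ_pos
  have hn : 0 < n := NeZero.pos n
  have hlg := one_le_lg (D₀ / ε)
  refine reachesWithin_of_forall H hε hx₀ hD₀ hE (fun _ => by positivity) (fun hD0 => by
    have := oracleConst_nonneg (D := D) hL hτ hD0
    positivity) ?_
  intro S hS1 hpos hX4 A R h hSmin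
  have hD0 := hpos.le
  have hE0 : 0 ≤ stepError L τ κ := by unfold stepError; positivity
  have hSr : (1 : ℝ) ≤ S := by exact_mod_cast hS1
  have hX0 : 0 < D₀ / ε := by positivity
  have hCK := callConst_nonneg (D := D) hL hτ hD0
  -- the number of epochs and the number of linear oracle calls in terms of it
  have hmain : (9 / 8 : ℝ) ^ S ≤ 27 * (D₀ / ε) * S ∧
      ∑ s ∈ Finset.range S, scT n (s + 1) * callBound a n L τ D D₀ (s + 1)
        ≤ callConst L τ D D₀ * S ^ 2 * (12 * (D₀ / ε) * S) ^ 2 := by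
    by_cases hSs : S ≤ sZero n
    · have h2S : (2 : ℝ) ^ S ≤ 12 * (D₀ / ε) * S := by
        rcases hS1.eq_or_lt with h1 | h1
        · rw [← h1]; norm_num; linarith
        · have h2 := two_pow_lt_of_lt h hL hτ hn hE0 hε hE (s := S - 1) (by omega) (by omega)
            (hSmin _ (by omega))
          have e : (2 : ℝ) ^ S = 2 * 2 ^ (S - 1) := by
            rw [← pow_succ', Nat.sub_add_cancel hS1]
          have h3 : ((S - 1 : ℕ) : ℝ) ≤ S := by exact_mod_cast Nat.sub_le S 1
          have h4 : 6 * (D₀ / ε) * ((S - 1 : ℕ) : ℝ) ≤ 6 * (D₀ / ε) * S := by gcongr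
          rw [e]; linarith
      constructor
      · have h5 : (9 / 8 : ℝ) ^ S ≤ 2 ^ S := by gcongr; norm_num
        have h6 : 0 ≤ (D₀ / ε) * S := by positivity
        linarith
      · refine (sum_calls_le_first hL hτ hn hpos hSs).trans ?_
        gcongr
    · rw [not_le] at hSs
      have hσ : sigma a L τ ≤ n := by
        refine hcase.resolve_left fun hthr => ?_
        exact absurd (le_sZero_of_threshold_le h hL hτ hn hE0 hE hthr) (not_le.2 (hSmin _ hSs))
      obtain ⟨k, hk⟩ : ∃ k, S = sZero n + k + 1 := ⟨S - sZero n - 1, by omega⟩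
      have h1 := rate_pow_lt_of_lt h hL hτ hn hE0 hε hE (k := k) (hSmin _ (by omega))
      rw [rate, if_pos hσ] at h1
      have h2 : ((sZero n + k : ℕ) : ℝ) ≤ S := by
        rw [hk]; push_cast; linarith
      have h3 : (n : ℝ) * (9 / 8) ^ k ≤ 12 * (D₀ / ε) * S := by
        refine h1.le.trans ?_
        gcongr
      constructor
      · have h4 : (2 : ℝ) ^ sZero n ≤ 2 * n := by
          have h5 := two_pow_sZero_le hn
          have e : (2 : ℕ) ^ sZero n = 2 * 2 ^ (sZero n - 1) := by
            rw [← pow_succ', Nat.sub_add_cancel (one_le_sZero n)]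
          have : 2 ^ sZero n ≤ 2 * n := by omega
          exact_mod_cast this
        calc (9 / 8 : ℝ) ^ S = 9 / 8 * ((9 / 8) ^ sZero n * (9 / 8) ^ k) := by
              rw [hk]; ring
          _ ≤ 9 / 8 * (2 ^ sZero n * (9 / 8) ^ k) := by gcongr; norm_num
          _ ≤ 9 / 8 * (2 * n * (9 / 8) ^ k) := by gcongr
          _ = 9 / 4 * (n * (9 / 8) ^ k) := by ring
          _ ≤ 9 / 4 * (12 * (D₀ / ε) * S) := by gcongr
          _ = 27 * (D₀ / ε) * S := by ring
      · refine (sum_calls_le hL hτ hn hpos S).trans ?_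
        have e : S - sZero n - 1 = k := by omega
        rw [e, toleranceRate, if_pos hσ, mul_assoc _ ((n : ℝ) ^ 2)]
        have h5 : (n : ℝ) ^ 2 * (5 / 4) ^ k ≤ (12 * (D₀ / ε) * S) ^ 2 := by
          calc (n : ℝ) ^ 2 * (5 / 4 : ℝ) ^ k ≤ (n : ℝ) ^ 2 * ((9 / 8 : ℝ) ^ 2) ^ k := by
                gcongr; norm_num
            _ = ((n : ℝ) * (9 / 8) ^ k) ^ 2 := by rw [mul_pow, pow_right_comm]
            _ ≤ _ := by gcongr
        gcongr
  have hcount := count_le_lg hX4 hS1 hmain.1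
  refine ⟨?_, hmain.2.trans ?_⟩
  · calc (3 : ℝ) * n * S * estCost d a ≤ 3 * n * (116 * lg (D₀ / ε)) * estCost d a := by gcongr
      _ = 348 * (n * estCost d a * lg (D₀ / ε)) := by ring
      _ ≤ 348 * (n * estCost d a * lg (D₀ / ε)) * lg (D₀ / ε) ^ 4 :=
          le_mul_lg_pow (by positivity)
      _ = _ := by ring
  · calc callConst L τ D D₀ * S ^ 2 * (12 * (D₀ / ε) * S) ^ 2
        = 144 * callConst L τ D D₀ * (D₀ / ε) ^ 2 * (S : ℝ) ^ 4 := by ring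
      _ ≤ 144 * callConst L τ D D₀ * (D₀ / ε) ^ 2 * (116 * lg (D₀ / ε)) ^ 4 := by gcongr
      _ = callConst L τ D D₀ * (144 * 116 ^ 4 * D₀ ^ 2)
          * lg (D₀ / ε) ^ 4 * (1 / ε ^ 2) := by
          field_simp
      _ ≤ _ := by
          have := epochConst_nonneg hL hτ
          unfold oracleConst
          gcongr
          have : 0 ≤ 12 * D₀ * epochConst L τ ^ 3 := by positivity
          linarith

/-- The complexity if high accuracy is asked for and `n < ς`. -/
lemma reachesWithin_hard (H : Admissible a f K lo xs L τ D κ) (hε : 0 < ε) (hx₀ : x₀ ∈ K)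
    (hD₀ : D₀ = initGap a L (objective f) x₀ xs)
    (hE : errorFactor a n L τ * stepError L τ κ ≤ ε / 2) (hσ : (n : ℝ) < sigma a L τ) :
    ReachesWithin (scRun a L τ D₀ f lo x₀) K (objective f) (objective f xs) ε
      (1500 * lg (n + L / τ + D₀ / ε) ^ 4 * ((n * lg n
        + Real.sqrt (n * L / τ) * lg (D₀ / (n * ε))) * estCost d a))
      (oracleConst L τ D D₀ * lg (n + D₀ / ε) ^ 4 * ((n : ℝ) ^ 2 + n / ε)) := by
  have hL := H.L_pos
  have hτ := H.τ_pos
  have hn : 0 < n := NeZero.pos n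
  have hn' : (0 : ℝ) < n := Nat.cast_pos.2 hn
  have hY1 := one_le_lg (n + L / τ + D₀ / ε)
  have hZ1 := one_le_lg (n + D₀ / ε)
  have hXn1 := one_le_lg (D₀ / (n * ε))
  have hln1 := one_le_lg n
  refine reachesWithin_of_forall H hε hx₀ hD₀ hE (fun _ => by positivity) (fun hD0 => by
    have := oracleConst_nonneg (D := D) hL hτ hD0
    positivity) ?_
  intro S hS1 hpos hX4 A R h hSmin
  have hE0 : 0 ≤ stepError L τ κ := by unfold stepError; positivity
  have hCK := callConst_nonneg (D := D) hL hτ hpos.le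
  have hEC := epochConst_nonneg hL hτ
  have hs0 := sZero_le_lg hn
  have hX0 : 0 < D₀ / ε := by positivity
  have hnZ : lg n ≤ lg (n + D₀ / ε) := lg_mono hn' (by linarith)
  have e1 : D₀ / (n * ε) = D₀ / ε / n := by field_simp
  have hnε : 0 ≤ n / ε := by positivity
  obtain ⟨P, hP⟩ : ∃ P, P = n * lg n + Real.sqrt (n * L / τ) * lg (D₀ / (n * ε)) := ⟨_, rfl⟩
  have hPn : n * lg n ≤ P := by
    have : 0 ≤ Real.sqrt (n * L / τ) * lg (D₀ / (n * ε)) := by positivity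
    linarith
  have hP0 : 0 ≤ P := le_trans (by positivity) hPn
  rw [← hP]
  -- the queries follow from a bound for `n S`
  have hqueries : ∀ Y : ℝ, 1 ≤ Y → n * S ≤ 500 * (Y * P) →
      3 * n * S * (estCost d a : ℝ) ≤ 1500 * Y ^ 4 * (P * estCost d a) := by
    intro Y hY h2
    have hY4 : Y ≤ Y ^ 4 := le_self_pow₀ hY (by norm_num)
    calc 3 * n * S * (estCost d a : ℝ) = 3 * (n * S) * estCost d a := by ring
      _ ≤ 3 * (500 * (Y * P)) * estCost d a := by gcongr
      _ = 1500 * Y * (P * estCost d a) := by ring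
      _ ≤ 1500 * Y ^ 4 * (P * estCost d a) := by gcongr
  rcases le_or_gt S (sZero n) with hSs | hSs
  · have hS3 : (S : ℝ) ≤ 3 * lg n := le_trans (by exact_mod_cast hSs) hs0
    refine ⟨hqueries _ hY1 ?_, (sum_calls_le hL hτ hn hpos S).trans ?_⟩
    · have h2 : (n : ℝ) * S ≤ n * (3 * lg n) := by gcongr
      have h3 : P ≤ lg (n + L / τ + D₀ / ε) * P := le_mul_of_one_le_left hP0 hY1
      linarith
    · have hS4 : (S : ℝ) ≤ 3 * lg (n + D₀ / ε) := by linarith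
      have e : S - sZero n - 1 = 0 := by omega
      rw [e, pow_zero, mul_one]
      set Z := lg (n + D₀ / ε)
      have hZ24 : Z ^ 2 ≤ Z ^ 4 := pow_le_pow_right₀ hZ1 (by norm_num)
      calc callConst L τ D D₀ * (S : ℝ) ^ 2 * n ^ 2
          ≤ callConst L τ D D₀ * (3 * Z) ^ 2 * (n ^ 2 + n / ε) := by
            gcongr
            linarith
        _ = callConst L τ D D₀ * 9 * Z ^ 2 * (n ^ 2 + n / ε) := by ring
        _ ≤ callConst L τ D D₀ * 9 * Z ^ 4 * (n ^ 2 + n / ε) := by gcongr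
        _ ≤ _ := by
            unfold oracleConst
            gcongr
            have : 0 ≤ 144 * 116 ^ 4 * D₀ ^ 2 := by positivity
            have : 0 ≤ 12 * D₀ * epochConst L τ ^ 3 := by positivity
            linarith
  · obtain ⟨k, hk⟩ : ∃ k, S = sZero n + k + 1 := ⟨S - sZero n - 1, by omega⟩
    have h1 := rate_pow_lt_of_lt h hL hτ hn hE0 hε hE (k := k) (hSmin _ (by omega))
    have hSr : (S : ℝ) = sZero n + k + 1 := by rw [hk]; push_cast; ring
    refine ⟨hqueries _ hY1 ?_, (sum_calls_le hL hτ hn hpos S).trans ?_⟩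
    · rw [hSr, hP, e1]
      exact nat_mul_late_count_le hL hτ hn hσ hX4 h1.le
    · have hSZ := late_count_le_lg hL hτ hn hσ hX4 h1.le
      rw [← hSr] at hSZ
      have e : S - sZero n - 1 = k := by omega
      rw [e, toleranceRate, if_neg (not_le.2 hσ)]
      have h2 : ((sZero n + k : ℕ) : ℝ) ≤ S := by
        rw [hSr]; push_cast; linarith
      have h3 : (n : ℝ) * rate a n L τ ^ k ≤ 12 * (D₀ / ε) * S := by
        refine h1.le.trans ?_
        gcongr
      set Z := lg (n + D₀ / ε)
      have hZ34 : Z ^ 3 ≤ Z ^ 4 := pow_le_pow_right₀ hZ1 (by norm_num)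
      calc callConst L τ D D₀ * (S : ℝ) ^ 2 * n ^ 2 * rate a n L τ ^ k
          = callConst L τ D D₀ * (S : ℝ) ^ 2 * n * (n * rate a n L τ ^ k) := by ring
        _ ≤ callConst L τ D D₀ * (S : ℝ) ^ 2 * n * (12 * (D₀ / ε) * S) := by gcongr
        _ = callConst L τ D D₀ * (12 * D₀) * (S : ℝ) ^ 3 * (n / ε) := by ring
        _ ≤ callConst L τ D D₀ * (12 * D₀) * (epochConst L τ * Z) ^ 3 * (n ^ 2 + n / ε) := by
            gcongr
            have : 0 ≤ (n : ℝ) ^ 2 := by positivity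
            linarith
        _ = callConst L τ D D₀ * (12 * D₀ * epochConst L τ ^ 3) * Z ^ 3 * (n ^ 2 + n / ε) := by
            ring
        _ ≤ callConst L τ D D₀ * (12 * D₀ * epochConst L τ ^ 3) * Z ^ 4 * (n ^ 2 + n / ε) := by
            gcongr
        _ ≤ _ := by
            unfold oracleConst
            gcongr
            have : 0 ≤ 144 * 116 ^ 4 * D₀ ^ 2 := by positivity
            linarith

/-- The bound for the smoothing parameter: it makes the total effect of the estimation errors at
most `ε / 2`. -/
def maxSmoothing (L τ : ℝ) (d n : ℕ) (ε : ℝ) : ℝ :=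
  2 * Real.sqrt (ε / (2 * (errorFactor (.zeroth 0) n L τ * (1 / τ + 1 / L)))) / ((d + 1) * L)

lemma maxSmoothing_pos {n : ℕ} (hL : 0 < L) (hτ : 0 < τ) (hn : 0 < n) (hε : 0 < ε) :
    0 < maxSmoothing L τ d n ε := by
  have := four_le_errorFactor (a := .zeroth 0) hL hτ hn
  unfold maxSmoothing
  have : 0 < errorFactor (.zeroth 0) n L τ := by linarith
  positivity

lemma errorFactor_mul_le {n : ℕ} (hL : 0 < L) (hτ : 0 < τ) (hn : 0 < n) (hε : 0 < ε) {μ : ℝ}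
    (hμ : 0 < μ) (h : μ ≤ maxSmoothing L τ d n ε) :
    errorFactor (.zeroth μ) n L τ * stepError L τ (d * (L * μ / 2)) ≤ ε / 2 := by
  have e : errorFactor (.zeroth μ) n L τ = errorFactor (.zeroth 0) n L τ := rfl
  have h4 := four_le_errorFactor (a := .zeroth 0) hL hτ hn
  rw [e]
  unfold maxSmoothing at h
  set M := errorFactor (.zeroth 0) n L τ
  have hM : 0 < M := by linarith
  set B := ε / (2 * (M * (1 / τ + 1 / L))) with hB
  have hB0 : 0 < B := by positivity
  rw [le_div_iff₀ (by positivity)] at h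
  have h1 : d * (L * μ / 2) ≤ Real.sqrt B := by
    have : 0 ≤ L * μ := by positivity
    nlinarith
  have h2 : (d * (L * μ / 2)) ^ 2 ≤ B := by
    calc _ ≤ Real.sqrt B ^ 2 := by gcongr
      _ = B := Real.sq_sqrt hB0.le
  unfold stepError
  calc M * ((d * (L * μ / 2)) ^ 2 * (1 / τ + 1 / L)) ≤ M * (B * (1 / τ + 1 / L)) := by gcongr
    _ = ε / 2 := by rw [hB]; field_simp

end Complexity

end ARCS

end

theorem corollary2 :
    ∃ (C : ℝ) (k : ℕ) (K : ℝ → ℝ → ℝ → ℝ → ℝ) (μ₀ : ℝ → ℝ → ℕ → ℕ → ℝ → ℝ),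
      (∀ (L τ : ℝ) (d n : ℕ) (ε : ℝ), 0 < L → 0 < τ → 0 < n → 0 < ε → 0 < μ₀ L τ d n ε) ∧
      ∀ (d n : ℕ) [NeZero n] (f : Fin n → ARCS.Vec d → ℝ) (𝒞 : Set (ARCS.Vec d))
        (lo : ARCS.Vec d → ARCS.Vec d) (x₀ xs : ARCS.Vec d) (L τ D ε : ℝ),
        0 < L → 0 < τ → 0 < ε →
        (∀ i, ARCS.LSmooth L (f i)) →
        (∀ i, ARCS.StronglyConvex 0 (f i)) →
        ARCS.StronglyConvex τ (ARCS.objective f) →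
        Convex ℝ 𝒞 →
        (∀ x ∈ 𝒞, ∀ y ∈ 𝒞, ‖x - y‖ ≤ D) →
        ARCS.IsLinearOracle 𝒞 lo →
        x₀ ∈ 𝒞 →
        xs ∈ 𝒞 →
        (∀ x ∈ 𝒞, ARCS.objective f xs ≤ ARCS.objective f x) →
        -- first-order case
        (∀ D₀ : ℝ, D₀ = ARCS.initGap .first L (ARCS.objective f) x₀ xs →
         ((ARCS.threshold .first n D₀ ≤ ε ∨ ARCS.sigma .first L τ ≤ n) →
            ARCS.ReachesWithin (ARCS.scRun .first L τ D₀ f lo x₀) 𝒞 (ARCS.objective f)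
              (ARCS.objective f xs) ε
              (C * ARCS.lg (D₀ / ε) ^ k * (n * ARCS.lg (D₀ / ε)))
              (K L τ D D₀ * ARCS.lg (D₀ / ε) ^ k * (1 / ε ^ 2))) ∧
         ((ε < ARCS.threshold .first n D₀ ∧ (n : ℝ) < ARCS.sigma .first L τ) →
            ARCS.ReachesWithin (ARCS.scRun .first L τ D₀ f lo x₀) 𝒞 (ARCS.objective f)
              (ARCS.objective f xs) ε
              (C * ARCS.lg (n + L / τ + D₀ / ε) ^ k *
                (n * ARCS.lg n + Real.sqrt (n * L / τ) * ARCS.lg (D₀ / (n * ε))))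
              (K L τ D D₀ * ARCS.lg (n + D₀ / ε) ^ k * ((n : ℝ) ^ 2 + n / ε)))) ∧
        -- zeroth-order case, for every sufficiently small smoothing parameter
        (∀ μ D₀ : ℝ, 0 < μ → μ ≤ μ₀ L τ d n ε →
         D₀ = ARCS.initGap (.zeroth μ) L (ARCS.objective f) x₀ xs →
         ((ARCS.threshold (.zeroth μ) n D₀ ≤ ε ∨ ARCS.sigma (.zeroth μ) L τ ≤ n) →
            ARCS.ReachesWithin (ARCS.scRun (.zeroth μ) L τ D₀ f lo x₀) 𝒞 (ARCS.objective f)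
              (ARCS.objective f xs) ε
              (C * ARCS.lg (D₀ / ε) ^ k * (n * d * ARCS.lg (D₀ / ε)))
              (K L τ D D₀ * ARCS.lg (D₀ / ε) ^ k * (1 / ε ^ 2))) ∧
         ((ε < ARCS.threshold (.zeroth μ) n D₀ ∧ (n : ℝ) < ARCS.sigma (.zeroth μ) L τ) →
            ARCS.ReachesWithin (ARCS.scRun (.zeroth μ) L τ D₀ f lo x₀) 𝒞 (ARCS.objective f)
              (ARCS.objective f xs) ε
              (C * ARCS.lg (n + L / τ + D₀ / ε) ^ k *
                (n * d * ARCS.lg n + d * Real.sqrt (n * L / τ) * ARCS.lg (D₀ / (n * ε))))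
              (K L τ D D₀ * ARCS.lg (n + D₀ / ε) ^ k * ((n : ℝ) ^ 2 + n / ε)))) := by
  refine ⟨3000, 4, ARCS.oracleConst, ARCS.maxSmoothing,
    fun L τ d n ε hL hτ hn hε => ARCS.maxSmoothing_pos hL hτ hn hε, ?_⟩
  intro d n _ f 𝒞 lo x₀ xs L τ D ε hL hτ hε hsm hcv hsc hconv hdiam hlo hx₀ hxs hmin
  have hlg0 : ∀ x, 0 ≤ ARCS.lg x := fun x => zero_le_one.trans (ARCS.one_le_lg x)
  constructor
  · intro D₀ hD₀
    have H : ARCS.Admissible .first f 𝒞 lo xs L τ D 0 :=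
      ⟨hL, hτ, hsm, hcv, hsc, hconv, hdiam, hlo, hxs, hmin, fun i x => by simp [ARCS.est],
        fun _ => rfl⟩
    have hE : ARCS.errorFactor .first n L τ * ARCS.stepError L τ 0 ≤ ε / 2 := by
      simp [ARCS.stepError]; positivity
    constructor
    · intro hcase
      refine (ARCS.reachesWithin_easy H hε hx₀ hD₀ hE hcase).mono ?_ le_rfl
      have h1 := mul_nonneg (pow_nonneg (hlg0 (D₀ / ε)) 4)
        (mul_nonneg (Nat.cast_nonneg (α := ℝ) n) (hlg0 (D₀ / ε)))
      simp only [ARCS.estCost, Nat.cast_one, mul_one]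
      linarith
    · rintro ⟨_, hσ⟩
      refine (ARCS.reachesWithin_hard H hε hx₀ hD₀ hE hσ).mono ?_ le_rfl
      have h1 := mul_nonneg (pow_nonneg (hlg0 (n + L / τ + D₀ / ε)) 4)
        (add_nonneg (mul_nonneg (Nat.cast_nonneg (α := ℝ) n) (hlg0 n))
          (mul_nonneg (Real.sqrt_nonneg (n * L / τ)) (hlg0 (D₀ / (n * ε)))))
      simp only [ARCS.estCost, Nat.cast_one, mul_one]
      linarith
  · intro μ D₀ hμ hμ₀ hD₀
    have H : ARCS.Admissible (.zeroth μ) f 𝒞 lo xs L τ D (d * (L * μ / 2)) :=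
      ⟨hL, hτ, hsm, hcv, hsc, hconv, hdiam, hlo, hxs, hmin,
        fun i x => ARCS.norm_coordGrad_sub_le hμ (hsm i) x, fun h => by cases h⟩
    have hE := ARCS.errorFactor_mul_le (d := d) (n := n) hL hτ (NeZero.pos n) hε hμ hμ₀
    constructor
    · intro hcase
      refine (ARCS.reachesWithin_easy H hε hx₀ hD₀ hE hcase).mono ?_ le_rfl
      have h1 := mul_nonneg (pow_nonneg (hlg0 (D₀ / ε)) 4)
        (mul_nonneg (mul_nonneg (Nat.cast_nonneg (α := ℝ) n) (Nat.cast_nonneg (α := ℝ) d))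
          (hlg0 (D₀ / ε)))
      simp only [ARCS.estCost]
      push_cast
      linarith
    · rintro ⟨_, hσ⟩
      refine (ARCS.reachesWithin_hard H hε hx₀ hD₀ hE hσ).mono (le_of_eq ?_) le_rfl
      simp only [ARCS.estCost]
      push_cast
      ring
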